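/- Let $N=\{1,2,3\}$ be three agents and $M$ a finite set of $m$ indivisible items. Agent $i$ has an additive valuation $v_i$, given by item values $v_{ig}\in\mathbb{R}_{\ge 0}$, with $v_i(S)=\sum_{g\in S}v_{ig}$ for $S\subseteq M$. An allocation is an ordered partition $(A_1,A_2,A_3)$ of $M$ into possibly empty bundles. It is $\mathrm{EF}^{+1}_{-1}$ for the profile $(v_1,v_2,v_3)$ if for all agents $i,j$ there are sets of items $S$ and $T$ with $S\cap A_i=\emptyset$, $T\subseteq A_j$, $|S|\le 1$, $|T|\le 1$ and $v_i(A_i\cup S)\ge v_i(A_j\setminus T)$. A fractional allocation is a matrix $X=(x_{ig})$ with $x_{ig}\ge 0$ and $\sum_i x_{ig}=1$ for each item $g$; put $v_i(X)=\sum_g v_{ig}x_{ig}$. A randomized mechanism is a pair $(\mathcal{F},\mathcal{D})$, where $\mathcal{F}$ maps each profile to a fractional allocation, and $\mathcal{D}$, given the profile and a fractional allocation $X$, returns a finite probability distribution $\{(p_k,\mathcal{A}_k)\}_{k=1,\dots,K}$ of allocations, with $p_k>0$, under which each item $g$ goes to each agent $i$ with probability $x_{ig}$. On a profile $v$ the mechanism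 outputs $\mathcal{D}(v,\mathcal{F}(v))$. It is truthful (in expectation) if $v_i(\mathcal{F}(v))\ge v_i(\mathcal{F}(v_i',v_{-i}))$ for every profile $v$, every agent $i$ and every additive valuation $v_i'$. It is $\mathrm{EF}^{+1}_{-1}$ if, for every profile, every allocation $\mathcal{A}_k$ in its output distribution is $\mathrm{EF}^{+1}_{-1}$ for that profile. **Theorem.** For three agents with additive valuations there is a randomized mechanism $(\mathcal{F},\mathcal{D})$, defined for every number $m\ge 0$ of items, that is truthful and $\mathrm{EF}^{+1}_{-1}$. In addition, the mechanism outputs the distribution of $\mathrm{EF}^{+1}_{-1}$ allocations in polynomial time: there is one algorithm (a program for a random access machine with logarithmic cost) that, for every $m$ and every profile of nonnegative rational item values, given in binary, computes the whole list $\{(p_k,\mathcal{A}_k)\}_{k}$ that the mechanism outputs on this profile, in time polynomial in the bit length of the profile. -/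

import Mathlib

open scoped NNReal

/-! ## Additive valuations, allocations and `EF^{+u}_{-v}` -/

namespace FairDivision

/-- An additive valuation on the items `Fin m`, given by the values of the single items. -/
abbrev Valuation (m : ℕ) := Fin m → ℝ≥0

/-- The value of a set of items under an additive valuation. -/
def Valuation.value {m : ℕ} (v : Valuation m) (S : Finset (Fin m)) : ℝ≥0 := ∑ g ∈ S, v g

/-- One additive valuation for each of the `n` agents. -/
abbrev Profile (n m : ℕ) := Fin n → Valuation m

/-- An ordered partition of the items into `n` (possibly empty) bundles, given by the agent that
receives each item. -/
abbrev Allocation (n m : ℕ) := Fin m → Fin n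

/-- The set of items that agent `i` receives. -/
def Allocation.bundle {n m : ℕ} (A : Allocation n m) (i : Fin n) : Finset (Fin m) :=
  Finset.univ.filter fun g => A g = i

/-- Envy-freeness up to adding `a` items and removing `r` items. -/
def IsEF {n m : ℕ} (a r : ℕ) (v : Profile n m) (A : Allocation n m) : Prop :=
  ∀ i j : Fin n, ∃ S T : Finset (Fin m),
    Disjoint S (A.bundle i) ∧ T ⊆ A.bundle j ∧ S.card ≤ a ∧ T.card ≤ r ∧
      (v i).value (A.bundle j \ T) ≤ (v i).value (A.bundle i ∪ S)

/-! ## Randomized mechanisms -/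

/-- `share i g` is the fraction of item `g` that agent `i` receives. -/
structure FractionalAllocation (n m : ℕ) where
  share : Fin n → Fin m → ℝ
  share_nonneg : ∀ i g, 0 ≤ share i g
  sum_share : ∀ g, ∑ i, share i g = 1

/-- The expected utility of agent `i` with (true) valuation `v` under a fractional allocation. -/
def FractionalAllocation.utility {n m : ℕ} (X : FractionalAllocation n m) (i : Fin n)
    (v : Valuation m) : ℝ :=
  ∑ g, (v g : ℝ) * X.share i g

/-- A finitely supported probability distribution of allocations, written as a list
`(p_k, A_k)`, `k < K`, with positive probabilities `p_k` that sum to one. -/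
structure Lottery (n m : ℕ) where
  K : ℕ
  prob : Fin K → ℝ
  alloc : Fin K → Allocation n m
  prob_pos : ∀ k, 0 < prob k
  sum_prob : ∑ k, prob k = 1

/-- The probability that agent `i` receives item `g`. -/
def Lottery.marginal {n m : ℕ} (L : Lottery n m) (i : Fin n) (g : Fin m) : ℝ :=
  ∑ k ∈ Finset.univ.filter (fun k => L.alloc k g = i), L.prob k

/-- A randomized mechanism `(F, D)`: `F` maps the reported profile to a fractional allocation, and
`D`, which sees the reported profile as well, decomposes a fractional allocation into a
distribution of allocations with these marginals. -/
structure RandomizedMechanism (n m : ℕ) where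
  F : Profile n m → FractionalAllocation n m
  D : Profile n m → FractionalAllocation n m → Lottery n m
  marginal_D : ∀ v X i g, (D v X).marginal i g = X.share i g

/-- The distribution of allocations that the mechanism outputs on a reported profile. -/
def RandomizedMechanism.output {n m : ℕ} (M : RandomizedMechanism n m) (v : Profile n m) :
    Lottery n m :=
  M.D v (M.F v)

/-- Truthfulness in expectation. -/
def RandomizedMechanism.Truthful {n m : ℕ} (M : RandomizedMechanism n m) : Prop :=
  ∀ (v : Profile n m) (i : Fin n) (w : Valuation m),
    (M.F (Function.update v i w)).utility i (v i) ≤ (M.F v).utility i (v i)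

/-- Every allocation that the mechanism possibly outputs is `EF^{+a}_{-r}`. -/
def RandomizedMechanism.IsEF {n m : ℕ} (M : RandomizedMechanism n m) (a r : ℕ) : Prop :=
  ∀ (v : Profile n m) (k : Fin (M.output v).K), FairDivision.IsEF a r v ((M.output v).alloc k)

end FairDivision

/-! ## A random access machine with logarithmic cost -/

namespace RAM

/-- The memory consists of arrays of integers; `μ a k` is the content of cell `k` of array `a`. -/
abbrev Mem := ℕ → ℤ → ℤ

/-- The number of bits charged for an integer. -/
def bits (z : ℤ) : ℕ := z.natAbs.size + 1

/-- Integer expressions; `read a e` is the content of the cell of array `a` with address `e`. -/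
inductive Expr where
  | const (c : ℤ)
  | read (a : ℕ) (e : Expr)
  | add (e₁ e₂ : Expr)
  | sub (e₁ e₂ : Expr)
  | mul (e₁ e₂ : Expr)
  | div (e₁ e₂ : Expr)

/-- The value of an expression (`div` is integer division, with `z / 0 = 0`). -/
def Expr.eval (μ : Mem) : Expr → ℤ
  | const c => c
  | read a e => μ a (e.eval μ)
  | add e₁ e₂ => e₁.eval μ + e₂.eval μ
  | sub e₁ e₂ => e₁.eval μ - e₂.eval μ
  | mul e₁ e₂ => e₁.eval μ * e₂.eval μ
  | div e₁ e₂ => e₁.eval μ / e₂.eval μ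

/-- The time to evaluate an expression: the bit lengths of the values of all subexpressions, and
so, for every single operation, at least those of its operands and of its result. -/
def Expr.cost (μ : Mem) : Expr → ℕ
  | const c => bits c
  | read a e => e.cost μ + bits (μ a (e.eval μ))
  | add e₁ e₂ => e₁.cost μ + e₂.cost μ + bits (e₁.eval μ + e₂.eval μ)
  | sub e₁ e₂ => e₁.cost μ + e₂.cost μ + bits (e₁.eval μ - e₂.eval μ)
  | mul e₁ e₂ => e₁.cost μ + e₂.cost μ + bits (e₁.eval μ * e₂.eval μ)
  | div e₁ e₂ => e₁.cost μ + e₂.cost μ + bits (e₁.eval μ / e₂.eval μ)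

/-- Programs: `set a e₁ e₂` stores the value of `e₂` in the cell of array `a` with address `e₁`;
`cond` and `loop` test whether the value of `e` is positive. -/
inductive Prog where
  | skip
  | set (a : ℕ) (e₁ e₂ : Expr)
  | seq (P Q : Prog)
  | cond (e : Expr) (P Q : Prog)
  | loop (e : Expr) (P : Prog)

/-- The memory after storing `z` in cell `k` of array `a`. -/
def Mem.store (μ : Mem) (a : ℕ) (k z : ℤ) : Mem :=
  Function.update μ a (Function.update (μ a) k z)

/-- `Run P μ t μ'`: started with memory `μ`, program `P` halts after time exactly `t` with
memory `μ'`. -/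
inductive Run : Prog → Mem → ℕ → Mem → Prop
  | skip (μ : Mem) : Run .skip μ 1 μ
  | set (μ : Mem) (a : ℕ) (e₁ e₂ : Expr) :
      Run (.set a e₁ e₂) μ (e₁.cost μ + e₂.cost μ + 1) (μ.store a (e₁.eval μ) (e₂.eval μ))
  | seq {P Q : Prog} {μ μ₁ μ₂ : Mem} {s t : ℕ} :
      Run P μ s μ₁ → Run Q μ₁ t μ₂ → Run (.seq P Q) μ (s + t + 1) μ₂
  | cond_pos {e : Expr} {P Q : Prog} {μ μ' : Mem} {t : ℕ} :
      0 < e.eval μ → Run P μ t μ' → Run (.cond e P Q) μ (e.cost μ + t + 1) μ'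
  | cond_neg {e : Expr} {P Q : Prog} {μ μ' : Mem} {t : ℕ} :
      ¬ 0 < e.eval μ → Run Q μ t μ' → Run (.cond e P Q) μ (e.cost μ + t + 1) μ'
  | loop_pos {e : Expr} {P : Prog} {μ μ₁ μ₂ : Mem} {s t : ℕ} :
      0 < e.eval μ → Run P μ s μ₁ → Run (.loop e P) μ₁ t μ₂ →
        Run (.loop e P) μ (e.cost μ + s + t + 1) μ₂
  | loop_neg {e : Expr} {P : Prog} {μ : Mem} :
      ¬ 0 < e.eval μ → Run (.loop e P) μ (e.cost μ + 1) μ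

/-- The memory whose `a`-th array starts with the `a`-th list and is zero otherwise. -/
def Mem.ofLists (L : List (List ℤ)) : Mem := fun a k =>
  if 0 ≤ k then (L.getD a []).getD k.toNat 0 else 0

end RAM

/-! ## Mechanisms that output their distribution in polynomial time -/

namespace FairDivision

/-- The input for a rational profile: array `0` holds the number `m` of items, array `1 + i` the
numerators and array `1 + n + i` the denominators of the values of the items to agent `i`. -/
def inputLists {n m : ℕ} (v : Fin n → Fin m → ℚ≥0) : List (List ℤ) :=
  [(m : ℤ)] ::
    (List.ofFn (fun i => List.ofFn fun g => ((v i g).num : ℤ)) ++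
      List.ofFn (fun i => List.ofFn fun g => ((v i g).den : ℤ)))

/-- The bit length of the input. -/
def inputSize {n m : ℕ} (v : Fin n → Fin m → ℚ≥0) : ℕ :=
  ((inputLists v).flatten.map RAM.bits).sum

/-- The memory `μ` holds the list `(p_k, A_k)`, `k < K`: array `0` starts with `K`, the cells with
address `k` of arrays `1` and `2` hold numerator and denominator of `p_k`, and cell `k * m + g` of
array `3` holds the agent that receives item `g` in `A_k`. -/
def HoldsLottery {n m : ℕ} (μ : RAM.Mem) (L : Lottery n m) : Prop :=
  μ 0 0 = (L.K : ℤ) ∧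
  (∀ k : Fin L.K, 0 < μ 2 (k : ℕ) ∧ L.prob k = (μ 1 (k : ℕ) : ℝ) / (μ 2 (k : ℕ) : ℝ)) ∧
  ∀ (k : Fin L.K) (g : Fin m), μ 3 ((k : ℕ) * m + (g : ℕ)) = ((L.alloc k : Fin m → Fin n) g : ℕ)

/-- One program computes, for every number `m` of items and every rational profile, the full list
of probabilities and allocations that the mechanism outputs on that profile, in time polynomial
in the bit length of the profile. -/
def OutputsInPolynomialTime {n : ℕ} (M : (m : ℕ) → RandomizedMechanism n m) : Prop :=
  ∃ (P : RAM.Prog) (p : Polynomial ℕ), ∀ (m : ℕ) (v : Fin n → Fin m → ℚ≥0),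
    ∃ (t : ℕ) (μ : RAM.Mem),
      RAM.Run P (RAM.Mem.ofLists (inputLists v)) t μ ∧ t ≤ p.eval (inputSize v) ∧
        HoldsLottery μ ((M m).output fun i g => (v i g : ℝ≥0))

end FairDivision

/-!
The fractional allocation is constant, every agent receiving a third of every item, so truthfulness
is immediate. All the work lies in the decomposition of this one allocation: it suffices to find a
colouring `c` of the items by the three agents such that, for *every* assignment of the three colour
classes to the agents, nobody envies beyond one added and one removed item. The three cyclic shifts
of `c`, with probability `1 / 3` each, then have the right marginals (`shiftLottery_marginal`). The
mechanism has to decompose the other fractional allocations too, although it never produces them;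
they are decomposed by independent assignment of the items (`exists_lottery`).

*Two splits.* A class `C` is split off from a set `A` of items with `k = 3`, and what remains is
split into two with `k = 2`. Two of the agents, "left" and "right", are only asked for the order of
the items by value. Their orders are divided into groups of `k` items, and `C` takes about one item
from every group; then on every prefix of an order `C` has, up to about one item, a `k`-th part of
the items. After both splits, with the two agents in exchanged roles in the second one, any two of
the three classes differ by at most two items on every prefix (`card_prefix_left`,
`card_prefix_right`), which is what an agent needs who may add one item and remove one
(`noEnvy_of_card_le`). The third agent is cardinal: the value of `C` differs from a `k`-th part by
at most half the value of an item (`IsSplit.value`, `noEnvyAmong_value`).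

*One split.* Let `A` consist of `k * G - 1` items, if necessary after addition of items without
value. Every item joins its group in the left order to its group in the right order, and the
resulting bipartite graph has maximum degree `k`; the left groups are shifted by one, so the first
left group and the last right group are deficient (`IsGroupGraph`). A proper edge colouring with `k`
colours is built edge by edge along alternating chains (`does_insert`). Every colour class meets the
prefix conditions, but its value may be far from a `k`-th part. The excesses of the `k` classes over
a `k`-th part sum to zero, so the class `X` missing at the first left group and some class `Y` have
excesses of opposite sign (or one of them is zero). The colours `X` and `Y` are now exchanged along
their alternating path from the first left group and then along the cycles, each started at its
first left group; one step replaces a single item of the class by another. In the middle of a chain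
the class is short of one item at one left group and has one too many at another, but in such an
order that the prefix conditions still hold (`IsBaseColouring.leftCounts_first`,
`IsBaseColouring.leftCounts_later`). At the end `X` has become the old class `Y`, so the excess of
`X` changes its sign at some step, and before or after this step it is at most half the value of an
item (`does_exchange`).

*Computation.* The construction is carried out by a program for the random access machine
(`mainProg`), and the existence of the colouring is read off from its correctness
(`exists_run_mainProg`). The predicate `RAM.Does` is a total-correctness program logic that keeps
count of the time: a loop is given a bound `N` for its iterations and a bound `B` for the absolute
values in memory, and the resulting running time `RAM.Prog.time` is polynomial in `N` and in the bit
length of `B` by recursion on the program (`RAM.polyBdd_time`). The rational values of an agent are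
first multiplied by the product of their denominators, whose bit length is linear in that of the
input.

*Real values.* A fixed colouring works for a closed set of profiles; there are finitely many
colourings and the rational profiles are dense, so some colouring works for every real profile
(`exists_colouring`).

The programs keep the following arrays: `10`, `11`, `12` the scaled values to the agents, `13` marks
of the items that take part in the split, `14` and `15` their left and right groups, `16` their
colours (`0` for none), `17` a copy of the colours. Cell `0` of an array with a number from `30` on
is a scalar variable, among them `30` the bound for the items, `31` the number `k`, `45` and `46`
the colours `X` and `Y`, and `52` the number of items.
-/

/-! ### Program logic for the random access machine -/

namespace RAM

/-- All memory cells have absolute value at most `B`. -/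
def Bd (B : ℤ) (μ : Mem) : Prop := ∀ a k, |μ a k| ≤ B

theorem bits_le_bits {z B : ℤ} (h : |z| ≤ B) : bits z ≤ bits B := by
  unfold bits
  have : z.natAbs ≤ B.natAbs := by
    rw [Int.natAbs_le_iff_sq_le]
    exact sq_le_sq' (by linarith [neg_abs_le z]) (by linarith [le_abs_self z])
  have := Nat.size_le_size this
  omega

theorem one_le_bits (z : ℤ) : 1 ≤ bits z := by unfold bits; omega

theorem size_add_le (a b : ℕ) : (a + b).size ≤ max a.size b.size + 1 := by
  rw [Nat.size_le, pow_succ]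
  have h1 : a < 2 ^ max a.size b.size :=
    lt_of_lt_of_le (Nat.lt_size_self a) (Nat.pow_le_pow_right (by norm_num) (le_max_left _ _))
  have h2 : b < 2 ^ max a.size b.size :=
    lt_of_lt_of_le (Nat.lt_size_self b) (Nat.pow_le_pow_right (by norm_num) (le_max_right _ _))
  omega

theorem size_mul_le (a b : ℕ) : (a * b).size ≤ a.size + b.size := by
  rw [Nat.size_le, pow_add]
  exact Nat.mul_lt_mul'' (Nat.lt_size_self a) (Nat.lt_size_self b)

theorem bits_add_le (a b : ℤ) : bits (a + b) ≤ bits a + bits b := by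
  unfold bits
  have h1 := Nat.size_le_size (Int.natAbs_add_le a b)
  have h2 := size_add_le a.natAbs b.natAbs
  omega

theorem bits_sub_le (a b : ℤ) : bits (a - b) ≤ bits a + bits b := by
  have := bits_add_le a (-b)
  rw [← sub_eq_add_neg] at this
  simpa [bits] using this

theorem bits_mul_le (a b : ℤ) : bits (a * b) ≤ bits a + bits b := by
  unfold bits
  rw [Int.natAbs_mul]
  have h2 := size_mul_le a.natAbs b.natAbs
  omega

theorem bits_div_le (a b : ℤ) : bits (a / b) ≤ bits a + bits b := by
  unfold bits
  have := Nat.size_le_size (Int.natAbs_ediv_le_natAbs a b)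
  omega

/-- A bound for the bit length of the value of an expression, in units of the bit length of the
memory cells. -/
def Expr.len : Expr → ℕ
  | const c => bits c
  | read _ _ => 1
  | add e₁ e₂ => e₁.len + e₂.len
  | sub e₁ e₂ => e₁.len + e₂.len
  | mul e₁ e₂ => e₁.len + e₂.len
  | div e₁ e₂ => e₁.len + e₂.len

/-- A bound for the cost of an expression, in units of the bit length of the memory cells. -/
def Expr.weight : Expr → ℕ
  | const c => bits c
  | read _ e => e.weight + 1
  | add e₁ e₂ => e₁.weight + e₂.weight + (e₁.len + e₂.len)
  | sub e₁ e₂ => e₁.weight + e₂.weight + (e₁.len + e₂.len)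
  | mul e₁ e₂ => e₁.weight + e₂.weight + (e₁.len + e₂.len)
  | div e₁ e₂ => e₁.weight + e₂.weight + (e₁.len + e₂.len)

theorem Expr.one_le_len (e : Expr) : 1 ≤ e.len := by
  induction e <;> simp only [Expr.len] <;> first | exact one_le_bits _ | omega

theorem Expr.bits_eval_le {W : ℕ} {μ : Mem} (h : ∀ a k, bits (μ a k) ≤ W) (e : Expr) :
    bits (e.eval μ) ≤ e.len * W := by
  have hW : 1 ≤ W := (one_le_bits _).trans (h 0 0)
  induction e with
  | const c => exact Nat.le_mul_of_pos_right _ hW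
  | read a e _ => simpa [Expr.len, Expr.eval] using h a (e.eval μ)
  | add e₁ e₂ h₁ h₂ =>
    simp only [Expr.len, Expr.eval, add_mul]
    exact (bits_add_le _ _).trans (by omega)
  | sub e₁ e₂ h₁ h₂ =>
    simp only [Expr.len, Expr.eval, add_mul]
    exact (bits_sub_le _ _).trans (by omega)
  | mul e₁ e₂ h₁ h₂ =>
    simp only [Expr.len, Expr.eval, add_mul]
    exact (bits_mul_le _ _).trans (by omega)
  | div e₁ e₂ h₁ h₂ =>
    simp only [Expr.len, Expr.eval, add_mul]
    exact (bits_div_le _ _).trans (by omega)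

theorem Expr.cost_le {W : ℕ} {μ : Mem} (h : ∀ a k, bits (μ a k) ≤ W) (e : Expr) :
    e.cost μ ≤ e.weight * W := by
  have hW : 1 ≤ W := (one_le_bits _).trans (h 0 0)
  induction e with
  | const c => exact Nat.le_mul_of_pos_right _ hW
  | read a e ih =>
    simp only [Expr.weight, Expr.cost, add_mul, one_mul]
    exact add_le_add ih (h _ _)
  | add e₁ e₂ h₁ h₂ =>
    have := Expr.bits_eval_le h (e₁.add e₂)
    simp only [Expr.weight, Expr.cost, Expr.eval, Expr.len, add_mul] at this ⊢
    omega
  | sub e₁ e₂ h₁ h₂ =>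
    have := Expr.bits_eval_le h (e₁.sub e₂)
    simp only [Expr.weight, Expr.cost, Expr.eval, Expr.len, add_mul] at this ⊢
    omega
  | mul e₁ e₂ h₁ h₂ =>
    have := Expr.bits_eval_le h (e₁.mul e₂)
    simp only [Expr.weight, Expr.cost, Expr.eval, Expr.len, add_mul] at this ⊢
    omega
  | div e₁ e₂ h₁ h₂ =>
    have := Expr.bits_eval_le h (e₁.div e₂)
    simp only [Expr.weight, Expr.cost, Expr.eval, Expr.len, add_mul] at this ⊢
    omega

theorem Mem.store_apply (μ : Mem) (a : ℕ) (k z : ℤ) (b : ℕ) :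
    μ.store a k z b = if b = a then Function.update (μ a) k z else μ b := by
  unfold Mem.store
  rw [Function.update_apply]

/-- Programs without loops. -/
def Prog.LoopFree : Prog → Prop
  | skip => True
  | set _ _ _ => True
  | seq P Q => P.LoopFree ∧ Q.LoopFree
  | cond _ P Q => P.LoopFree ∧ Q.LoopFree
  | loop _ _ => False

/-- The effect of a loop-free program (loops are ignored). -/
noncomputable def Prog.exec : Prog → Mem → Mem
  | skip, μ => μ
  | set a e₁ e₂, μ => μ.store a (e₁.eval μ) (e₂.eval μ)
  | seq P Q, μ => Q.exec (P.exec μ)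
  | cond e P Q, μ => if 0 < e.eval μ then P.exec μ else Q.exec μ
  | loop _ _, μ => μ

/-- The factor by which a loop-free program can increase the bit length of the memory cells. -/
def Prog.grow : Prog → ℕ
  | skip => 1
  | set _ _ e => e.len
  | seq P Q => P.grow * Q.grow
  | cond _ P Q => P.grow * Q.grow
  | loop _ _ => 1

theorem Prog.one_le_grow (P : Prog) : 1 ≤ P.grow := by
  induction P with
  | skip => exact le_rfl
  | set a e₁ e₂ => exact e₂.one_le_len
  | seq P Q hP hQ => exact Nat.mul_pos hP hQ
  | cond e P Q hP hQ => exact Nat.mul_pos hP hQ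
  | loop e P _ => exact le_rfl

/-- A bound for the running time of a program whose loops make at most `N` iterations each, where
`W` bounds the bit length of the memory cells before and after every loop. -/
def Prog.time (N : ℕ) : ℕ → Prog → ℕ
  | W, skip => W
  | W, set _ e₁ e₂ => (e₁.weight + e₂.weight + 1) * W
  | W, seq P Q => P.time N W + Q.time N (P.grow * W) + 1
  | W, cond e P Q => e.weight * W + P.time N W + Q.time N W + 1
  | W, loop e P => (N + 1) * (P.time N W + e.weight * W + 1)

theorem Prog.time_mono {N W W' : ℕ} (h : W ≤ W') (P : Prog) : P.time N W ≤ P.time N W' := by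
  induction P generalizing W W' with
  | skip => exact h
  | set a e₁ e₂ => exact Nat.mul_le_mul_left _ h
  | seq P Q hP hQ =>
    have h1 := hP h
    have h2 := hQ (Nat.mul_le_mul_left P.grow h)
    simp only [time]; omega
  | cond e P Q hP hQ =>
    have h1 := hP h
    have h2 := hQ h
    have h3 := Nat.mul_le_mul_left e.weight h
    simp only [time]; omega
  | loop e P hP =>
    have h1 := hP h
    have h3 := Nat.mul_le_mul_left e.weight h
    exact Nat.mul_le_mul_left _ (by omega)

theorem Prog.run_exec (P : Prog) (hP : P.LoopFree) (N : ℕ) {W : ℕ} {μ : Mem}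
    (h : ∀ a k, bits (μ a k) ≤ W) :
    (∃ t, Run P μ t (P.exec μ) ∧ t ≤ P.time N W) ∧
      ∀ a k, bits (P.exec μ a k) ≤ P.grow * W := by
  have hW : 1 ≤ W := (one_le_bits _).trans (h 0 0)
  induction P generalizing μ W with
  | skip => exact ⟨⟨1, Run.skip μ, hW⟩, by simpa [grow, exec] using h⟩
  | set a e₁ e₂ =>
    refine ⟨⟨_, Run.set μ a e₁ e₂, ?_⟩, ?_⟩
    · have h1 := e₁.cost_le h
      have h2 := e₂.cost_le h
      simp only [time, add_mul]
      omega
    · intro b k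
      simp only [exec, grow, Mem.store_apply]
      have hl : W ≤ e₂.len * W := Nat.le_mul_of_pos_left _ e₂.one_le_len
      split_ifs with hb
      · rw [Function.update_apply]
        split_ifs
        · exact e₂.bits_eval_le h
        · exact (h _ _).trans hl
      · exact (h _ _).trans hl
  | seq P Q ihP ihQ =>
    obtain ⟨⟨t, hr, ht⟩, hb⟩ := ihP hP.1 h hW
    obtain ⟨⟨t', hr', ht'⟩, hb'⟩ := ihQ hP.2 hb (Nat.mul_pos P.one_le_grow hW)
    refine ⟨⟨_, Run.seq hr hr', ?_⟩, ?_⟩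
    · simp only [time]
      omega
    · intro a k
      have := hb' a k
      simp only [exec, grow]
      calc _ ≤ _ := this
        _ = _ := by ring
  | cond e P Q ihP ihQ =>
    obtain ⟨⟨t, hr, ht⟩, hb⟩ := ihP hP.1 h hW
    obtain ⟨⟨t', hr', ht'⟩, hb'⟩ := ihQ hP.2 h hW
    have hc := e.cost_le h
    have hg1 : P.grow * W ≤ P.grow * Q.grow * W :=
      Nat.mul_le_mul_right _ (Nat.le_mul_of_pos_right _ Q.one_le_grow)
    have hg2 : Q.grow * W ≤ P.grow * Q.grow * W :=
      Nat.mul_le_mul_right _ (Nat.le_mul_of_pos_left _ P.one_le_grow)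
    by_cases he : 0 < e.eval μ
    · refine ⟨⟨_, by simpa [exec, he] using Run.cond_pos he hr, ?_⟩, ?_⟩
      · simp only [time]; omega
      · intro a k
        simp only [exec, he, if_true, grow]
        exact (hb a k).trans hg1
    · refine ⟨⟨_, by simpa [exec, he] using Run.cond_neg he hr', ?_⟩, ?_⟩
      · simp only [time]; omega
      · intro a k
        simp only [exec, he, if_false, grow]
        exact (hb' a k).trans hg2
  | loop e P _ => exact hP.elim

/-- `Does N B P μ Q`: started with memory `μ`, the program `P` halts with a memory that satisfies
`Q`, within the time that is allowed for at most `N` iterations of each loop and memory cells of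
absolute value at most `B`. -/
def Does (N : ℕ) (B : ℤ) (P : Prog) (μ : Mem) (Q : Mem → Prop) : Prop :=
  ∃ t μ', Run P μ t μ' ∧ t ≤ P.time N (bits B) ∧ Q μ'

section Does

variable {N : ℕ} {B : ℤ} {P P' : Prog} {e : Expr} {μ : Mem} {Q Q' : Mem → Prop}

theorem Does.imp (h : Does N B P μ Q) (hQ : ∀ μ', Q μ' → Q' μ') : Does N B P μ Q' := by
  obtain ⟨t, μ', h1, h2, h3⟩ := h
  exact ⟨t, μ', h1, h2, hQ _ h3⟩

theorem Does.line (hP : P.LoopFree) (hB : Bd B μ) (hQ : Q (P.exec μ)) : Does N B P μ Q := by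
  obtain ⟨⟨t, h1, h2⟩, -⟩ := P.run_exec hP N (fun a k => bits_le_bits (hB a k))
  exact ⟨t, _, h1, h2, hQ⟩

theorem Does.seq (h : Does N B P μ fun μ₁ => Does N B P' μ₁ Q) : Does N B (P.seq P') μ Q := by
  obtain ⟨t, μ', h1, h2, t', μ'', h3, h4, h5⟩ := h
  refine ⟨_, μ'', Run.seq h1 h3, ?_, h5⟩
  have := P'.time_mono (N := N) (Nat.le_mul_of_pos_left (bits B) P.one_le_grow)
  simp only [Prog.time]
  omega

theorem Does.line_seq (hP : P.LoopFree) (hB : Bd B μ) (h : Does N B P' (P.exec μ) Q) :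
    Does N B (P.seq P') μ Q := Does.seq (Does.line hP hB h)

theorem Does.cond (hB : Bd B μ) (h : 0 < e.eval μ → Does N B P μ Q)
    (h' : ¬ 0 < e.eval μ → Does N B P' μ Q) : Does N B (P.cond e P') μ Q := by
  have hc := e.cost_le (fun a k => bits_le_bits (hB a k))
  by_cases he : 0 < e.eval μ
  · obtain ⟨t, μ', h1, h2, h3⟩ := h he
    exact ⟨_, μ', Run.cond_pos he h1, by simp only [Prog.time]; omega, h3⟩
  · obtain ⟨t, μ', h1, h2, h3⟩ := h' he
    exact ⟨_, μ', Run.cond_neg he h1, by simp only [Prog.time]; omega, h3⟩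

/-- The rule for loops with a variant. -/
theorem Does.loop (I : ℕ → Mem → Prop) (hB : ∀ n μ, I n μ → Bd B μ)
    (step : ∀ n μ, I n μ → 0 < e.eval μ → Does N B P μ fun μ' => ∃ n' < n, I n' μ')
    {n : ℕ} (h : I n μ) (hn : n ≤ N) :
    Does N B (P.loop e) μ fun μ' => (∃ n', I n' μ') ∧ ¬ 0 < e.eval μ' := by
  have key : ∀ n μ, I n μ → ∃ t μ', Run (P.loop e) μ t μ' ∧
      t ≤ (n + 1) * (P.time N (bits B) + e.weight * bits B + 1) ∧
      (∃ n', I n' μ') ∧ ¬ 0 < e.eval μ' := by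
    intro n
    induction n using Nat.strong_induction_on with
    | _ n ih =>
      intro μ h
      have hc := e.cost_le (fun a k => bits_le_bits (hB n μ h a k))
      by_cases he : 0 < e.eval μ
      · obtain ⟨t, μ', h1, h2, n', hn', h3⟩ := step n μ h he
        obtain ⟨t', μ'', h4, h5, h6⟩ := ih n' hn' μ' h3
        refine ⟨_, μ'', Run.loop_pos he h1 h4, ?_, h6⟩
        have : (n' + 1 + 1) * (P.time N (bits B) + e.weight * bits B + 1) ≤
            (n + 1) * (P.time N (bits B) + e.weight * bits B + 1) :=
          Nat.mul_le_mul_right _ (by omega)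
        rw [add_mul (n' + 1)] at this
        omega
      · refine ⟨_, μ, Run.loop_neg he, ?_, ⟨n, h⟩, he⟩
        have : 1 * (P.time N (bits B) + e.weight * bits B + 1) ≤
            (n + 1) * (P.time N (bits B) + e.weight * bits B + 1) :=
          Nat.mul_le_mul_right _ (by omega)
        omega
  obtain ⟨t, μ', h1, h2, h3⟩ := key n μ h
  exact ⟨t, μ', h1, h2.trans (Nat.mul_le_mul_right _ (by omega)), h3⟩

/-- The rule for loops that count up to `n`. -/
theorem Does.count {n : ℤ} (I : ℤ → Mem → Prop)
    (hI : ∀ i μ, I i μ → Bd B μ ∧ e.eval μ = n - i) {i₀ : ℤ} (h : I i₀ μ)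
    (hin : i₀ ≤ n) (hN : n - i₀ ≤ N)
    (step : ∀ i μ, i₀ ≤ i → i < n → I i μ → Does N B P μ (I (i + 1))) :
    Does N B (P.loop e) μ (I n) := by
  refine (Does.loop (fun j μ => ∃ i, i₀ ≤ i ∧ i ≤ n ∧ (n - i).toNat = j ∧ I i μ)
    (fun j μ ⟨i, _, _, _, h⟩ => (hI i μ h).1) ?_ (n := (n - i₀).toNat)
    ⟨i₀, le_rfl, hin, rfl, h⟩ (by omega)).imp ?_
  · rintro j μ ⟨i, h1, h2, h3, h4⟩ he
    rw [(hI i μ h4).2] at he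
    exact (step i μ h1 (by omega) h4).imp fun μ' h => ⟨(n - (i + 1)).toNat, by omega, i + 1,
      by omega, by omega, rfl, h⟩
  · rintro μ' ⟨⟨j, i, h1, h2, h3, h4⟩, h5⟩
    rw [(hI i μ' h4).2] at h5
    obtain rfl : i = n := by omega
    exact h4

end Does

theorem Bd.store {B : ℤ} {μ : Mem} (h : Bd B μ) {a : ℕ} {k z : ℤ} (hz : |z| ≤ B) :
    Bd B (μ.store a k z) := by
  intro b l
  rw [Mem.store_apply]
  split_ifs
  · rw [Function.update_apply]
    split_ifs
    exacts [hz, h _ _]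
  · exact h _ _

theorem Bd.nonneg {B : ℤ} {μ : Mem} (h : Bd B μ) : 0 ≤ B := (abs_nonneg _).trans (h 0 0)

/-- The scalar variable stored in cell `0` of array `x`. -/
def Expr.var (x : ℕ) : Expr := .read x (.const 0)

/-- The assignment of the value of `e` to the scalar variable `x`. -/
def Prog.assign (x : ℕ) (e : Expr) : Prog := .set x (.const 0) e

instance : Add Expr := ⟨.add⟩
instance : Sub Expr := ⟨.sub⟩
instance : Mul Expr := ⟨.mul⟩
instance : Div Expr := ⟨.div⟩
instance (n : ℕ) : OfNat Expr n := ⟨.const n⟩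

infixr:30 " ;; " => Prog.seq

@[simp] theorem Expr.eval_var (μ : Mem) (x : ℕ) : (Expr.var x).eval μ = μ x 0 := rfl
@[simp] theorem Expr.eval_read (μ : Mem) (a : ℕ) (e : Expr) :
    (Expr.read a e).eval μ = μ a (e.eval μ) := rfl
@[simp] theorem Expr.eval_add (μ : Mem) (e₁ e₂ : Expr) :
    (e₁ + e₂).eval μ = e₁.eval μ + e₂.eval μ := rfl
@[simp] theorem Expr.eval_sub (μ : Mem) (e₁ e₂ : Expr) :
    (e₁ - e₂).eval μ = e₁.eval μ - e₂.eval μ := rfl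
@[simp] theorem Expr.eval_mul (μ : Mem) (e₁ e₂ : Expr) :
    (e₁ * e₂).eval μ = e₁.eval μ * e₂.eval μ := rfl
@[simp] theorem Expr.eval_div (μ : Mem) (e₁ e₂ : Expr) :
    (e₁ / e₂).eval μ = e₁.eval μ / e₂.eval μ := rfl
@[simp] theorem Expr.eval_zero (μ : Mem) : (0 : Expr).eval μ = 0 := rfl
@[simp] theorem Expr.eval_one (μ : Mem) : (1 : Expr).eval μ = 1 := rfl
@[simp] theorem Expr.eval_two (μ : Mem) : (2 : Expr).eval μ = 2 := rfl
@[simp] theorem Expr.eval_three (μ : Mem) : (3 : Expr).eval μ = 3 := rfl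
@[simp] theorem Expr.eval_const (μ : Mem) (c : ℤ) : (Expr.const c).eval μ = c := rfl

@[simp] theorem Prog.exec_assign (x : ℕ) (e : Expr) (μ : Mem) :
    (Prog.assign x e).exec μ = μ.store x 0 (e.eval μ) := rfl
@[simp] theorem Prog.exec_set (a : ℕ) (e₁ e₂ : Expr) (μ : Mem) :
    (Prog.set a e₁ e₂).exec μ = μ.store a (e₁.eval μ) (e₂.eval μ) := rfl
@[simp] theorem Prog.exec_seq (P Q : Prog) (μ : Mem) : (P.seq Q).exec μ = Q.exec (P.exec μ) := rfl
@[simp] theorem Prog.exec_skip (μ : Mem) : Prog.skip.exec μ = μ := rfl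
@[simp] theorem Prog.exec_cond (e : Expr) (P Q : Prog) (μ : Mem) :
    (Prog.cond e P Q).exec μ = if 0 < e.eval μ then P.exec μ else Q.exec μ := rfl

@[simp] theorem Prog.loopFree_assign (x : ℕ) (e : Expr) : (Prog.assign x e).LoopFree := trivial
@[simp] theorem Prog.loopFree_set (a : ℕ) (e₁ e₂ : Expr) : (Prog.set a e₁ e₂).LoopFree := trivial
@[simp] theorem Prog.loopFree_skip : Prog.skip.LoopFree := trivial
@[simp] theorem Prog.loopFree_seq (P Q : Prog) :
    (P.seq Q).LoopFree ↔ P.LoopFree ∧ Q.LoopFree := Iff.rfl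
@[simp] theorem Prog.loopFree_cond (e : Expr) (P Q : Prog) :
    (P.cond e Q).LoopFree ↔ P.LoopFree ∧ Q.LoopFree := Iff.rfl

/-- An expression that is positive exactly when the two expressions have equal values. -/
def Expr.eqv (e₁ e₂ : Expr) : Expr := 1 - (e₁ - e₂) * (e₁ - e₂)

theorem one_sub_sq_pos (a b : ℤ) : 0 < 1 - (a - b) * (a - b) ↔ a = b := by
  constructor
  · intro h
    have : (a - b) * (a - b) = 0 := le_antisymm (by omega) (mul_self_nonneg _)
    have := mul_self_eq_zero.1 this
    omega
  · rintro rfl; simp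

@[simp] theorem Expr.eval_eqv_pos (μ : Mem) (e₁ e₂ : Expr) :
    0 < (Expr.eqv e₁ e₂).eval μ ↔ e₁.eval μ = e₂.eval μ := one_sub_sq_pos _ _

attribute [simp] Mem.store_apply

/-- Functions bounded by a polynomial. -/
def PolyBdd (f : ℕ → ℕ) : Prop := ∃ p : Polynomial ℕ, ∀ n, f n ≤ p.eval n

theorem PolyBdd.const (c : ℕ) : PolyBdd fun _ => c := ⟨Polynomial.C c, by simp⟩
theorem PolyBdd.id : PolyBdd fun n => n := ⟨Polynomial.X, by simp⟩
theorem PolyBdd.add {f g : ℕ → ℕ} : PolyBdd f → PolyBdd g → PolyBdd fun n => f n + g n :=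
  fun ⟨p, hp⟩ ⟨q, hq⟩ => ⟨p + q, fun n => by simpa using add_le_add (hp n) (hq n)⟩
theorem PolyBdd.mul {f g : ℕ → ℕ} : PolyBdd f → PolyBdd g → PolyBdd fun n => f n * g n :=
  fun ⟨p, hp⟩ ⟨q, hq⟩ => ⟨p * q, fun n => by simpa using Nat.mul_le_mul (hp n) (hq n)⟩

theorem polyBdd_time {N W : ℕ → ℕ} (hN : PolyBdd N) (hW : PolyBdd W) (P : Prog) :
    PolyBdd fun n => P.time (N n) (W n) := by
  induction P generalizing W with
  | skip => exact hW
  | set a e₁ e₂ => exact (PolyBdd.const _).mul hW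
  | seq P Q hP hQ =>
    exact ((hP hW).add (hQ ((PolyBdd.const _).mul hW))).add (PolyBdd.const 1)
  | cond e P Q hP hQ =>
    exact ((((PolyBdd.const _).mul hW).add (hP hW)).add (hQ hW)).add (PolyBdd.const 1)
  | loop e P hP =>
    exact (hN.add (PolyBdd.const 1)).mul
      (((hP hW).add ((PolyBdd.const _).mul hW)).add (PolyBdd.const 1))

end RAM

/-! ### Ranks and prefixes -/

namespace FairDivision

/-- The number of items of `A` with a larger key than `g`. -/
def rank (A : Finset ℤ) (key : ℤ → ℤ) (g : ℤ) : ℤ := ((A.filter fun h => key g < key h).card : ℤ)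

section Rank

variable {A : Finset ℤ} {key : ℤ → ℤ}

theorem rank_nonneg (g : ℤ) : 0 ≤ rank A key g := Int.natCast_nonneg _

theorem rank_lt_rank {g h : ℤ} (hh : h ∈ A) (hgh : key g < key h) :
    rank A key h < rank A key g := by
  unfold rank
  rw [Nat.cast_lt]
  refine Finset.card_lt_card (Finset.ssubset_iff_of_subset ?_ |>.2 ⟨h, ?_, ?_⟩)
  · intro x
    simp only [Finset.mem_filter]
    exact fun hx => ⟨hx.1, hgh.trans hx.2⟩
  · simp [hh, hgh]
  · simp

theorem rank_lt_card {g : ℤ} (hg : g ∈ A) : rank A key g < A.card := by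
  unfold rank
  rw [Nat.cast_lt]
  exact Finset.card_lt_card (Finset.filter_ssubset.2 ⟨g, hg, lt_irrefl _⟩)

theorem rank_injOn (hk : Set.InjOn key A) : Set.InjOn (rank A key) A := by
  intro g hg h hh e
  rcases lt_trichotomy (key g) (key h) with hlt | heq | hlt
  · exact absurd e (rank_lt_rank hh hlt).ne'
  · exact hk hg hh heq
  · exact absurd e (rank_lt_rank hg hlt).ne

theorem image_rank (hk : Set.InjOn key A) :
    A.image (rank A key) = Finset.Ico (0 : ℤ) A.card := by
  refine Finset.eq_of_subset_of_card_le ?_ ?_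
  · intro x hx
    obtain ⟨g, hg, rfl⟩ := Finset.mem_image.1 hx
    exact Finset.mem_Ico.2 ⟨rank_nonneg g, rank_lt_card hg⟩
  · rw [Finset.card_image_of_injOn (rank_injOn hk)]
    simp

theorem card_rank_between (hk : Set.InjOn key A) {a b : ℤ} (ha : 0 ≤ a) (hb : b ≤ A.card) :
    (A.filter fun g => a ≤ rank A key g ∧ rank A key g < b).card = (b - a).toNat := by
  rw [← Int.card_Ico, ← Finset.card_image_of_injOn
    ((rank_injOn hk).mono (Finset.coe_subset.2 (Finset.filter_subset _ _)))]
  congr 1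
  ext x
  simp only [Finset.mem_image, Finset.mem_filter, Finset.mem_Ico]
  constructor
  · rintro ⟨g, ⟨-, h⟩, rfl⟩; exact h
  · intro h
    have : x ∈ A.image (rank A key) := by
      rw [image_rank hk, Finset.mem_Ico]; omega
    obtain ⟨g, hg, rfl⟩ := Finset.mem_image.1 this
    exact ⟨g, ⟨hg, h⟩, rfl⟩

/-- A set of items that contains, with an item, all items of larger key consists of the items of
smallest rank. -/
theorem mem_prefix_iff (hk : Set.InjOn key A) {U : Finset ℤ} (hU : U ⊆ A)
    (hup : ∀ g ∈ U, ∀ h ∈ A, key g < key h → h ∈ U) {g : ℤ} (hg : g ∈ A) :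
    g ∈ U ↔ rank A key g < U.card := by
  unfold rank
  rw [Nat.cast_lt]
  constructor
  · intro h
    refine Finset.card_lt_card (Finset.ssubset_iff_of_subset ?_ |>.2 ⟨g, h, by simp⟩)
    intro x hx
    exact hup g h x (Finset.mem_filter.1 hx).1 (Finset.mem_filter.1 hx).2
  · intro h
    by_contra hgU
    refine absurd (Finset.card_le_card ?_) h.not_ge
    intro u hu
    rw [Finset.mem_filter]
    refine ⟨hU hu, ?_⟩
    rcases lt_trichotomy (key g) (key u) with hlt | heq | hlt
    · exact hlt
    · exact absurd (hk hg (hU hu) heq ▸ hu) hgU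
    · exact absurd (hup u hu g hg hlt) hgU

end Rank

/-- The group of an item when the items, in the order of their ranks, are divided into groups of
`k`, except that the first group has only `k - 1` items. -/
def leftGroup (k : ℤ) (A : Finset ℤ) (key : ℤ → ℤ) (g : ℤ) : ℤ := (rank A key g + 1) / k

/-- The group of an item when the items, in the order of their ranks, are divided into groups of
`k`. -/
def rightGroup (k : ℤ) (A : Finset ℤ) (key : ℤ → ℤ) (g : ℤ) : ℤ := rank A key g / k

/-- A set `C` of items that is close to a `k`-th part of `A` for three agents: one that orders the
items by `keyL`, one that orders them by `keyR`, and one with the values `w`. The items of `A` just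
fail to fill `G` groups of `k`. -/
structure IsSplit (k G : ℤ) (A : Finset ℤ) (keyL keyR w : ℤ → ℤ) (C : Finset ℤ) : Prop where
  subset : C ⊆ A
  left_ge : ∀ z, 0 ≤ z → z < G → z ≤ ((C.filter fun g => leftGroup k A keyL g ≤ z).card : ℤ)
  left_le : ∀ z, 0 ≤ z → z < G → ((C.filter fun g => leftGroup k A keyL g ≤ z).card : ℤ) ≤ z + 1
  right_le : ∀ z, 0 ≤ z → z < G → (C.filter fun g => rightGroup k A keyR g = z).card ≤ 1
  right_ge : ∀ z, 0 ≤ z → z < G - 1 → 1 ≤ (C.filter fun g => rightGroup k A keyR g = z).card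
  value : ∃ y ∈ A, 2 * |k * ∑ g ∈ C, w g - ∑ g ∈ A, w g| ≤ k * w y ∧
    (0 < k * ∑ g ∈ C, w g - ∑ g ∈ A, w g → y ∈ C) ∧
    (k * ∑ g ∈ C, w g - ∑ g ∈ A, w g < 0 → y ∉ C)

section Prefix

variable {k G : ℤ} {A : Finset ℤ} {keyL keyR w : ℤ → ℤ} {C : Finset ℤ}

theorem leftGroup_le_iff (hk : 0 < k) {g z : ℤ} :
    leftGroup k A keyL g ≤ z ↔ rank A keyL g < k * (z + 1) - 1 := by
  unfold leftGroup
  rw [← Int.lt_add_one_iff, Int.ediv_lt_iff_lt_mul hk, mul_comm]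
  omega

theorem rightGroup_le_iff (hk : 0 < k) {g z : ℤ} :
    rightGroup k A keyR g ≤ z ↔ rank A keyR g < k * (z + 1) := by
  unfold rightGroup
  rw [← Int.lt_add_one_iff, Int.ediv_lt_iff_lt_mul hk, mul_comm]

theorem IsSplit.left_prefix (h : IsSplit k G A keyL keyR w C) (hk : 0 < k)
    (hA : (A.card : ℤ) = k * G - 1) (hkey : Set.InjOn keyL A) {U : Finset ℤ} (hU : U ⊆ A)
    (hup : ∀ g ∈ U, ∀ h ∈ A, keyL g < keyL h → h ∈ U) {J r : ℤ} (hJ : (U.card : ℤ) + 1 = k * J + r)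
    (hr : 0 ≤ r) (hrk : r < k) :
    J - 1 ≤ ((U ∩ C).card : ℤ) ∧ ((U ∩ C).card : ℤ) ≤ J + 1 ∧ ((U ∩ C).card : ℤ) ≤ J + r := by
  have hUA : (U.card : ℤ) ≤ A.card := by exact_mod_cast Finset.card_le_card hU
  have hJ0 : 0 ≤ J := by
    by_contra hneg
    have : k * J ≤ k * (-1) := mul_le_mul_of_nonneg_left (by omega) hk.le
    omega
  have hJG : J ≤ G := by
    by_contra hneg
    have : k * (G + 1) ≤ k * J := mul_le_mul_of_nonneg_left (by omega) hk.le
    rw [mul_add] at this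
    omega
  have hmem : ∀ g ∈ A, (g ∈ U ↔ rank A keyL g < k * J + r - 1) := fun g hg => by
    rw [mem_prefix_iff hkey hU hup hg]; omega
  -- the items of the groups before group `J`
  have hlow : (C.filter fun g => leftGroup k A keyL g ≤ J - 1) ⊆ U ∩ C := by
    intro g hg
    rw [Finset.mem_filter, leftGroup_le_iff hk] at hg
    rw [Finset.mem_inter, hmem g (h.subset hg.1)]
    refine ⟨?_, hg.1⟩
    have := hg.2
    ring_nf at this ⊢
    omega
  have hlow' := Finset.card_le_card hlow
  have hup1 : U ∩ C ⊆ (C.filter fun g => leftGroup k A keyL g ≤ J - 1) ∪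
      A.filter fun g => k * J - 1 ≤ rank A keyL g ∧ rank A keyL g < k * J + r - 1 := by
    intro g hg
    rw [Finset.mem_inter] at hg
    rw [Finset.mem_union, Finset.mem_filter, Finset.mem_filter, leftGroup_le_iff hk]
    have hgA := h.subset hg.2
    have h1 := (hmem g hgA).1 hg.1
    by_cases h2 : rank A keyL g < k * J - 1
    · left; refine ⟨hg.2, ?_⟩; ring_nf at h2 ⊢; omega
    · right; exact ⟨hgA, by omega, h1⟩
  have hup2 := (Finset.card_le_card hup1).trans (Finset.card_union_le _ _)
  have hS : J - 1 ≤ ((C.filter fun g => leftGroup k A keyL g ≤ J - 1).card : ℤ) ∧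
      ((C.filter fun g => leftGroup k A keyL g ≤ J - 1).card : ℤ) ≤ J := by
    by_cases hJ1 : J = 0
    · have : (C.filter fun g => leftGroup k A keyL g ≤ J - 1) = ∅ := by
        refine Finset.filter_eq_empty_iff.2 fun g _ => ?_
        rw [leftGroup_le_iff hk, hJ1]
        have := rank_nonneg (A := A) (key := keyL) g
        simp; omega
      rw [this, hJ1]; simp
    · have h1 := h.left_ge (J - 1) (by omega) (by omega)
      have h2 := h.left_le (J - 1) (by omega) (by omega)
      omega
  have hr' : ((A.filter fun g => k * J - 1 ≤ rank A keyL g ∧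
      rank A keyL g < k * J + r - 1).card : ℤ) ≤ r := by
    by_cases hJ1 : J = 0
    · have : (A.filter fun g => k * J - 1 ≤ rank A keyL g ∧ rank A keyL g < k * J + r - 1) ⊆
          A.filter fun g => 0 ≤ rank A keyL g ∧ rank A keyL g < r - 1 := by
        intro g hg
        rw [Finset.mem_filter] at hg ⊢
        have := rank_nonneg (A := A) (key := keyL) g
        rw [hJ1] at hg
        exact ⟨hg.1, this, by have := hg.2.2; simp at this; omega⟩
      have h1 := Finset.card_le_card this
      rw [card_rank_between hkey le_rfl (by rw [hJ1] at hJ; simp at hJ; omega)] at h1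
      omega
    · have : 1 * 1 ≤ k * J := mul_le_mul (by omega) (by omega) (by omega) (by omega)
      rw [card_rank_between hkey (by omega) (by omega)]
      omega
  refine ⟨by omega, ?_, by omega⟩
  by_cases hJG' : J = G
  · have : r ≤ 0 := by rw [hJG'] at hJ; omega
    omega
  · have h2 := h.left_le J (by omega) (by omega)
    have : U ∩ C ⊆ C.filter fun g => leftGroup k A keyL g ≤ J := by
      intro g hg
      rw [Finset.mem_inter] at hg
      rw [Finset.mem_filter, leftGroup_le_iff hk]
      have h1 := (hmem g (h.subset hg.2)).1 hg.1
      refine ⟨hg.2, ?_⟩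
      rw [mul_add]; omega
    have := Finset.card_le_card this
    omega

theorem IsSplit.right_prefix (h : IsSplit k G A keyL keyR w C) (hk : 0 < k)
    (hA : (A.card : ℤ) = k * G - 1) (hkey : Set.InjOn keyR A) {U : Finset ℤ} (hU : U ⊆ A)
    (hup : ∀ g ∈ U, ∀ h ∈ A, keyR g < keyR h → h ∈ U) {J r : ℤ} (hJ : (U.card : ℤ) = k * J + r)
    (hr : 0 ≤ r) (hrk : r < k) :
    J ≤ ((U ∩ C).card : ℤ) ∧ ((U ∩ C).card : ℤ) ≤ J + 1 ∧ (r = 0 → ((U ∩ C).card : ℤ) = J) := by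
  have hUA : (U.card : ℤ) ≤ A.card := by exact_mod_cast Finset.card_le_card hU
  have hJ0 : 0 ≤ J := by
    by_contra hneg
    have : k * J ≤ k * (-1) := mul_le_mul_of_nonneg_left (by omega) hk.le
    omega
  have hJG : J < G := by
    by_contra hneg
    have : k * G ≤ k * J := mul_le_mul_of_nonneg_left (by omega) hk.le
    omega
  have hmem : ∀ g ∈ A, (g ∈ U ↔ rank A keyR g < k * J + r) := fun g hg => by
    rw [mem_prefix_iff hkey hU hup hg]; omega
  have hfull : ∀ j : ℕ, (j : ℤ) ≤ G - 1 →
      ((C.filter fun g => rightGroup k A keyR g ≤ j - 1).card : ℤ) = j := by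
    intro j
    induction j with
    | zero =>
      intro _
      have : (C.filter fun g => rightGroup k A keyR g ≤ ((0 : ℕ) : ℤ) - 1) = ∅ := by
        refine Finset.filter_eq_empty_iff.2 fun g _ => ?_
        rw [rightGroup_le_iff hk]
        have := rank_nonneg (A := A) (key := keyR) g
        simp; omega
      rw [this]; simp
    | succ j ih =>
      intro hj
      push_cast at hj
      have h1 := h.right_le j (by omega) (by omega)
      have h2 := h.right_ge j (by omega) (by omega)
      have : (C.filter fun g => rightGroup k A keyR g ≤ ((j + 1 : ℕ) : ℤ) - 1) =
          (C.filter fun g => rightGroup k A keyR g ≤ (j : ℤ) - 1) ∪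
            C.filter fun g => rightGroup k A keyR g = j := by
        ext g
        simp only [Finset.mem_union, Finset.mem_filter, ← and_or_left]
        push_cast
        exact and_congr_right fun _ => by omega
      rw [this, Finset.card_union_of_disjoint]
      · have := ih (by omega)
        push_cast
        omega
      · rw [Finset.disjoint_filter]
        intro g _ h1 h2
        omega
  have hlow : (C.filter fun g => rightGroup k A keyR g ≤ J - 1) ⊆ U ∩ C := by
    intro g hg
    rw [Finset.mem_filter, rightGroup_le_iff hk] at hg
    rw [Finset.mem_inter, hmem g (h.subset hg.1)]
    refine ⟨?_, hg.1⟩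
    have := hg.2
    ring_nf at this ⊢
    omega
  have hup1 : U ∩ C ⊆ (C.filter fun g => rightGroup k A keyR g ≤ J - 1) ∪
      C.filter fun g => rightGroup k A keyR g = J := by
    intro g hg
    rw [Finset.mem_inter] at hg
    have h1 := (hmem g (h.subset hg.2)).1 hg.1
    rw [Finset.mem_union, Finset.mem_filter, Finset.mem_filter, ← and_or_left]
    have h2 : rightGroup k A keyR g ≤ J := by rw [rightGroup_le_iff hk, mul_add]; omega
    exact ⟨hg.2, by omega⟩
  have hlow' := Finset.card_le_card hlow
  have hup2 := (Finset.card_le_card hup1).trans (Finset.card_union_le _ _)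
  have hS := hfull J.toNat (by omega)
  rw [show ((J.toNat : ℕ) : ℤ) = J by omega] at hS
  have hone := h.right_le J hJ0 hJG
  refine ⟨by omega, by omega, fun hr0 => ?_⟩
  have : U ∩ C ⊆ C.filter fun g => rightGroup k A keyR g ≤ J - 1 := by
    intro g hg
    rw [Finset.mem_inter] at hg
    have h1 := (hmem g (h.subset hg.2)).1 hg.1
    rw [Finset.mem_filter, rightGroup_le_iff hk]
    refine ⟨hg.2, ?_⟩
    ring_nf at h1 ⊢
    omega
  have := Finset.card_le_card this
  omega

end Prefix

/-! ### From prefix counts to envy-freeness -/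

section Dominate

variable {ι : Type*} [DecidableEq ι] {w : ι → ℤ}

theorem sum_le_sum_of_card_le (hw : ∀ g, 0 ≤ w g) {P Q : Finset ι}
    (h : ∀ t : ℤ, 0 ≤ t → (P.filter fun g => t < w g).card ≤ (Q.filter fun g => t < w g).card) :
    ∑ g ∈ P, w g ≤ ∑ g ∈ Q, w g := by
  obtain ⟨T, hT⟩ : ∃ T : ℕ, ∀ g ∈ P ∪ Q, (w g).toNat ≤ T :=
    ⟨(P ∪ Q).sup fun g => (w g).toNat, fun g hg => Finset.le_sup (f := fun g => (w g).toNat) hg⟩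
  have key : ∀ S ⊆ P ∪ Q, ∑ g ∈ S, w g =
      ∑ t ∈ Finset.range T, ((S.filter fun g => (t : ℤ) < w g).card : ℤ) := by
    intro S hS
    have h1 : ∀ t ∈ Finset.range T, ((S.filter fun g => (t : ℤ) < w g).card : ℤ) =
        ∑ g ∈ S, if (t : ℤ) < w g then (1 : ℤ) else 0 := fun t _ => by
      rw [Finset.card_filter]; push_cast; rfl
    rw [Finset.sum_congr rfl h1, Finset.sum_comm]
    refine Finset.sum_congr rfl fun g hg => ?_
    have h2 := hT g (hS hg)
    have h3 := hw g
    rw [← Finset.sum_filter, Finset.sum_const, nsmul_eq_mul, mul_one]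
    have : (Finset.range T).filter (fun t : ℕ => (t : ℤ) < w g) = Finset.range (w g).toNat := by
      ext t; simp only [Finset.mem_filter, Finset.mem_range]; omega
    rw [this, Finset.card_range]; omega
  rw [key P Finset.subset_union_left, key Q Finset.subset_union_right]
  exact Finset.sum_le_sum fun t _ => by exact_mod_cast h t (by omega)

/-- Adding one item to `Q` and removing one from `P` removes the envy for `P`. -/
def NoEnvy (w : ι → ℤ) (Q P : Finset ι) : Prop :=
  ∃ S T : Finset ι, Disjoint S Q ∧ T ⊆ P ∧ S.card ≤ 1 ∧ T.card ≤ 1 ∧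
    ∑ g ∈ P \ T, w g ≤ ∑ g ∈ Q ∪ S, w g

/-- If no prefix of the items, in the order of their values, contains more than two items more of
`P` than of `Q`, then moving the best item of `P` to `Q` makes `Q` dominate `P`. -/
theorem noEnvy_of_card_le (hw : ∀ g, 0 ≤ w g) {P Q : Finset ι} (hPQ : Disjoint Q P)
    (h : ∀ t : ℤ, 0 ≤ t →
      (P.filter fun g => t < w g).card ≤ (Q.filter fun g => t < w g).card + 2) :
    NoEnvy w Q P := by
  rcases P.eq_empty_or_nonempty with rfl | hP
  · exact ⟨∅, ∅, by simp, by simp, by simp, by simp,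
      by simpa using Finset.sum_nonneg fun g _ => hw g⟩
  · obtain ⟨b, hb, hmax⟩ := Finset.exists_max_image P w hP
    have hbQ : b ∉ Q := fun hbQ => Finset.disjoint_left.1 hPQ hbQ hb
    refine ⟨{b}, {b}, by simpa using hbQ, by simpa using hb, by simp, by simp, ?_⟩
    refine sum_le_sum_of_card_le hw fun t ht => ?_
    by_cases htb : t < w b
    · have h1 : (P.filter fun g => t < w g) = insert b ((P \ {b}).filter fun g => t < w g) := by
        ext g
        simp only [Finset.mem_filter, Finset.mem_insert, Finset.mem_sdiff, Finset.mem_singleton]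
        by_cases hgb : g = b
        · subst hgb; simp [hb, htb]
        · simp [hgb]
      have h2 : ((Q ∪ {b}).filter fun g => t < w g) = insert b (Q.filter fun g => t < w g) := by
        ext g
        simp only [Finset.mem_filter, Finset.mem_insert, Finset.mem_union, Finset.mem_singleton]
        by_cases hgb : g = b
        · subst hgb; simp [htb]
        · simp [hgb]
      have h3 := h t ht
      rw [h1, Finset.card_insert_of_notMem (by simp)] at h3
      rw [h2, Finset.card_insert_of_notMem (by simp [hbQ])]
      omega
    · have : ((P \ {b}).filter fun g => t < w g) = ∅ := by
        refine Finset.filter_eq_empty_iff.2 fun g hg => ?_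
        have := hmax g (Finset.mem_sdiff.1 hg).1
        omega
      simp [this]

theorem noEnvy_of_sum_le {P Q S T : Finset ι} (hS : Disjoint S Q) (hT : T ⊆ P)
    (hS1 : S.card ≤ 1) (hT1 : T.card ≤ 1)
    (h : ∑ g ∈ P, w g ≤ ∑ g ∈ Q, w g + ∑ g ∈ S, w g + ∑ g ∈ T, w g) : NoEnvy w Q P := by
  refine ⟨S, T, hS, hT, hS1, hT1, ?_⟩
  rw [Finset.sum_union hS.symm]
  have := Finset.sum_sdiff (f := w) hT
  linarith

end Dominate

end FairDivision

/-! ### Alternating chains in edge colourings -/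

namespace FairDivision

/-- The items of `A` are the edges of a graph, and `L g` is one of the ends of the edge `g`. Edges
with a common end have different colours; the colour `0` stands for uncoloured edges. -/
def Proper (A : Finset ℤ) (L col : ℤ → ℤ) : Prop :=
  ∀ g ∈ A, ∀ h ∈ A, g ≠ h → L g = L h → col g ≠ 0 → col g ≠ col h

/-- The colouring `col` arises from the proper colouring `χ` by exchanging the colours `p` and `q`
on some edges, among them those that are exchanged in `col₀`; at the right ends it is proper.
An edge can only receive colour `p` at a right end at which there was an edge of colour `p`. -/
structure ChainBase (A : Finset ℤ) (L R χ : ℤ → ℤ) (p q : ℤ) (col₀ col : ℤ → ℤ) : Prop where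
  hL : Proper A L χ
  hR : Proper A R χ
  ne : p ≠ q
  hp : p ≠ 0
  hq : q ≠ 0
  flip : ∀ g, col g = χ g ∨ (χ g = p ∧ col g = q) ∨ (χ g = q ∧ col g = p)
  mono : ∀ g, col₀ g ≠ χ g → col g ≠ χ g
  right : Proper A R col
  back : ∀ h ∈ A, χ h = q → col₀ h = q → col h = p → ∃ e ∈ A, R e = R h ∧ χ e = p

/-- A state of the exchange of `p` and `q` along a chain that starts at the left end `l₀`; the edge
`e` of colour `p` is the next one to be exchanged. Its left end has, unless it is `l₀`, just
received another edge of colour `p`. -/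
structure ChainRun (A : Finset ℤ) (L R χ : ℤ → ℤ) (p q : ℤ) (col₀ : ℤ → ℤ) (l₀ : ℤ)
    (col : ℤ → ℤ) (e : ℤ) : Prop extends ChainBase A L R χ p q col₀ col where
  mem : e ∈ A
  chi : χ e = p
  cur : col e = p
  left : ∀ g ∈ A, ∀ h ∈ A, g ≠ h → L g = L h → L g ≠ l₀ → L g ≠ L e → col g ≠ 0 → col g ≠ col h
  start : (L e = l₀ ∧ Proper A L col) ∨ (L e ≠ l₀ ∧ (∀ h ∈ A, L h = L e → χ h = q → col h = p) ∧
    (∀ g ∈ A, L g = l₀ → χ g = p → col g = q) ∧ (∀ h ∈ A, L h = l₀ → χ h = q → col h = q))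

/-- The state after the exchange of `p` and `q` along a whole chain from `l₀`. -/
structure ChainEnd (A : Finset ℤ) (L R χ : ℤ → ℤ) (p q : ℤ) (col₀ : ℤ → ℤ) (l₀ : ℤ)
    (col : ℤ → ℤ) : Prop extends ChainBase A L R χ p q col₀ col where
  left : ∀ g ∈ A, ∀ h ∈ A, g ≠ h → L g = L h → L g ≠ l₀ → col g ≠ 0 → col g ≠ col h
  start : ∀ g ∈ A, L g = l₀ → χ g = p → col g = q
  cause : (∃ e ∈ A, χ e = p ∧ ∀ h ∈ A, R h = R e → χ h ≠ q) ∨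
    (∃ f ∈ A, χ f = q ∧ col₀ f = χ f ∧ ∀ g ∈ A, L g = L f → χ g ≠ p) ∨ Proper A L col

section Chain

variable {A : Finset ℤ} {L R χ : ℤ → ℤ} {p q : ℤ} {col₀ : ℤ → ℤ} {l₀ : ℤ} {col : ℤ → ℤ} {e : ℤ}

theorem ChainRun.not_mem_right (h : ChainRun A L R χ p q col₀ l₀ col e)
    (hf : ∀ f ∈ A, R f = R e → col f ≠ q) :
    ChainEnd A L R χ p q col₀ l₀ (Function.update col e q) := by
  obtain ⟨⟨hL, hR, ne, hp, hq, flip, mono, right, back⟩, mem, chi, cur, left, start⟩ := h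
  have hχ : ∀ f ∈ A, R f = R e → χ f ≠ q := by
    intro f hfA hfR hfq
    have := hf f hfA hfR
    have := flip f
    have := right f hfA e mem
    grind
  refine ⟨⟨hL, hR, ne, hp, hq, ?_, ?_, ?_, ?_⟩, ?_, ?_, Or.inl ⟨e, mem, chi, hχ⟩⟩
  · intro g
    have := flip g
    grind
  · intro g
    have := mono g
    grind
  · intro g hg h hh
    have := right g hg h hh
    have := hf g hg
    have := hf h hh
    grind
  · intro h hh h1 h2
    have := back h hh h1 h2
    grind
  · intro g hg h hh
    have h1 := left g hg h hh
    have h2 := flip g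
    have h3 := flip h
    have h4 := hL g hg e mem
    have h5 := hL h hh e mem
    have h6 := hL g hg h hh
    simp only [Function.update_apply]
    grind
  · intro g hg h1 h2
    have := hL g hg e mem
    simp only [Function.update_apply]
    grind

theorem ChainRun.mem_right (h : ChainRun A L R χ p q col₀ l₀ col e) {f : ℤ} (hf : f ∈ A)
    (hfR : R f = R e) (hfq : col f = q) :
    χ f = q ∧ f ≠ e ∧ (L e ≠ l₀ → L f ≠ L e) := by
  obtain ⟨⟨hL, hR, ne, hp, hq, flip, mono, right, back⟩, mem, chi, cur, left, start⟩ := h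
  have h1 : f ≠ e := by rintro rfl; exact ne (cur.symm.trans hfq)
  have h2 : χ f = q := by
    have := flip f
    have := hR e mem f hf
    grind
  refine ⟨h2, h1, ?_⟩
  grind

theorem ChainRun.base (h : ChainRun A L R χ p q col₀ l₀ col e) {f : ℤ} (hf : f ∈ A)
    (hfR : R f = R e) (hfq : col f = q) :
    ChainBase A L R χ p q col₀ (Function.update (Function.update col e q) f p) := by
  obtain ⟨h1, h2, -⟩ := h.mem_right hf hfR hfq
  obtain ⟨⟨hL, hR, ne, hp, hq, flip, mono, right, back⟩, mem, chi, cur, left, start⟩ := h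
  refine ⟨hL, hR, ne, hp, hq, ?_, ?_, ?_, ?_⟩
  · intro g
    have := flip g
    grind
  · intro g
    have := mono g
    grind
  · intro g hg h hh
    have := right g hg h hh
    have := right g hg e mem
    have := right g hg f hf
    have := right h hh e mem
    have := right h hh f hf
    simp only [Function.update_apply]
    grind
  · intro h hh h3 h4
    by_cases hhf : h = f
    · exact fun _ => ⟨e, mem, by rw [hhf, hfR], chi⟩
    · have := back h hh h3 h4
      grind

theorem ChainRun.next (h : ChainRun A L R χ p q col₀ l₀ col e) {f : ℤ} (hf : f ∈ A)
    (hfR : R f = R e) (hfq : col f = q) {e' : ℤ} (he' : e' ∈ A) (heL : L e' = L f)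
    (hep : Function.update col e q e' = p) :
    ChainRun A L R χ p q col₀ l₀ (Function.update (Function.update col e q) f p) e' := by
  have hb := h.base hf hfR hfq
  obtain ⟨h1, h2, h3⟩ := h.mem_right hf hfR hfq
  obtain ⟨⟨hL, hR, ne, hp, hq, flip, mono, right, back⟩, mem, chi, cur, left, start⟩ := h
  have h4 : e' ≠ e := by rintro rfl; simp at hep; exact ne hep.symm
  have h5 : e' ≠ f := by rintro rfl; simp [h4] at hep; exact ne (hep.symm.trans hfq)
  have h6 : col e' = p := by simpa [h4] using hep
  have h7 : χ e' = p := by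
    have := flip e'
    have := hL e' he' f hf
    grind
  -- the two edges of colour `q` at `l₀` would have to be equal if the chain were back at `l₀`
  have h8 : L e' ≠ l₀ := by
    intro h8
    have := hL e' he' e mem
    rcases start with ⟨s1, s2⟩ | ⟨s1, s2, s3, s4⟩
    · grind
    · grind
  refine ⟨hb, he', h7, by simp [h4, h5, h6], ?_, Or.inr ⟨h8, ?_, ?_, ?_⟩⟩
  · intro g hg h hh
    have h11 := left g hg h hh
    have h12 := flip g
    have h13 := flip h
    have h14 := hL g hg e mem
    have h15 := hL h hh e mem
    have h16 := hL g hg h hh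
    have h17 := hL g hg f hf
    have h18 := hL h hh f hf
    simp only [Function.update_apply]
    grind
  · intro g hg
    have := hL g hg f hf
    simp only [Function.update_apply]
    grind
  · intro g hg
    have := hL g hg e mem
    have := hL g hg f hf
    simp only [Function.update_apply]
    grind
  · intro g hg
    have := flip g
    have := hL g hg e mem
    have := hL g hg f hf
    rcases start with ⟨s1, s2⟩ | ⟨s1, s2, s3, s4⟩
    · have := s2 g hg e mem
      simp only [Function.update_apply]
      grind
    · have := s4 g hg
      simp only [Function.update_apply]
      grind

theorem ChainRun.finish (h : ChainRun A L R χ p q col₀ l₀ col e) {f : ℤ} (hf : f ∈ A)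
    (hfR : R f = R e) (hfq : col f = q)
    (hno : ∀ g ∈ A, L g = L f → Function.update col e q g ≠ p) :
    ChainEnd A L R χ p q col₀ l₀ (Function.update (Function.update col e q) f p) := by
  have hb := h.base hf hfR hfq
  obtain ⟨h1, h2, h3⟩ := h.mem_right hf hfR hfq
  obtain ⟨⟨hL, hR, ne, hp, hq, flip, mono, right, back⟩, mem, chi, cur, left, start⟩ := h
  have hleft : ∀ g ∈ A, ∀ h ∈ A, g ≠ h → L g = L h → L g ≠ l₀ →
      Function.update (Function.update col e q) f p g ≠ 0 →
      Function.update (Function.update col e q) f p g ≠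
        Function.update (Function.update col e q) f p h := by
    intro g hg h hh
    have h11 := left g hg h hh
    have h12 := flip g
    have h13 := flip h
    have h14 := hL g hg e mem
    have h15 := hL h hh e mem
    have h16 := hL g hg h hh
    have h17 := hL g hg f hf
    have h18 := hL h hh f hf
    have h19 := hno g hg
    have h20 := hno h hh
    simp only [Function.update_apply] at h19 h20 ⊢
    grind
  have hstart : ∀ g ∈ A, L g = l₀ → χ g = p →
      Function.update (Function.update col e q) f p g = q := by
    intro g hg
    have := hL g hg e mem
    have := hL g hg f hf
    simp only [Function.update_apply]
    grind
  refine ⟨hb, hleft, hstart, ?_⟩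
  by_cases hfl : L f = l₀
  · right; right
    intro g hg h hh
    have h11 := hleft g hg h hh
    have h12 := flip g
    have h13 := flip h
    have h14 := hL g hg e mem
    have h15 := hL h hh e mem
    have h16 := hL g hg h hh
    have h17 := hL g hg f hf
    have h18 := hL h hh f hf
    have h19 := hno g hg
    have h20 := hno h hh
    have h21 := hstart g hg
    have h22 := hstart h hh
    by_cases hgl : L g = l₀
    · simp only [Function.update_apply] at h19 h20 h21 h22 ⊢
      grind
    · intro a b
      exact h11 a b hgl
  · right; left
    refine ⟨f, hf, h1, ?_, ?_⟩
    · by_contra hc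
      exact mono f hc (hfq.trans h1.symm)
    · intro g hg hgL hgp
      have h11 := left g hg f hf
      have h12 := flip g
      have h19 := hno g hg hgL
      simp only [Function.update_apply] at h19
      grind

theorem ChainBase.run (h : ChainBase A L R χ p q col₀ col) (hL : Proper A L col) (he : e ∈ A)
    (hep : col e = p) (hχ : χ e = p) : ChainRun A L R χ p q col₀ (L e) col e :=
  ⟨h, he, hχ, hep, fun g hg h' hh hne e _ _ => hL g hg h' hh hne e, Or.inl ⟨rfl, hL⟩⟩

/-- Every step of the exchange decreases the number of the edges that are still to be exchanged. -/
theorem ChainRun.measure_lt (h : ChainRun A L R χ p q col₀ l₀ col e) {f : ℤ} (hf : f ∈ A)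
    (hfR : R f = R e) (hfq : col f = q) :
    (A.filter fun g => χ g = p ∧ Function.update (Function.update col e q) f p g = p).card <
      (A.filter fun g => χ g = p ∧ col g = p).card := by
  obtain ⟨h1, h2, h3⟩ := h.mem_right hf hfR hfq
  refine Finset.card_lt_card (Finset.ssubset_iff_of_subset ?_ |>.2 ⟨e, ?_, ?_⟩)
  · intro g
    simp only [Finset.mem_filter, Function.update_apply]
    have := h.ne
    grind
  · simp [h.mem, h.chi, h.cur]
  · simp [h2.symm, h.ne.symm]

end Chain

end FairDivision

/-! ### Edge colourings of the graph of groups -/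

namespace FairDivision

/-- The items of `A` as the edges of a bipartite graph with `G` left ends and `G` right ends: all
ends have degree `k`, except that the first left end has degree `k - 1` and the last right end has
degree at most `k`. -/
structure IsGroupGraph (k G : ℤ) (A : Finset ℤ) (L R : ℤ → ℤ) : Prop where
  two_le : 2 ≤ k
  L_mem : ∀ g ∈ A, 0 ≤ L g ∧ L g < G
  R_mem : ∀ g ∈ A, 0 ≤ R g ∧ R g < G
  L_zero : ((A.filter fun g => L g = 0).card : ℤ) = k - 1
  L_pos : ∀ z, 0 < z → z < G → ((A.filter fun g => L g = z).card : ℤ) = k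
  R_lt : ∀ z, 0 ≤ z → z < G - 1 → ((A.filter fun g => R g = z).card : ℤ) = k
  R_le : ∀ z, ((A.filter fun g => R g = z).card : ℤ) ≤ k

theorem isGroupGraph_groups {k G : ℤ} {A : Finset ℤ} {keyL keyR : ℤ → ℤ} (hk : 2 ≤ k)
    (hG : 1 ≤ G) (hA : (A.card : ℤ) = k * G - 1) (hkL : Set.InjOn keyL A)
    (hkR : Set.InjOn keyR A) {L R : ℤ → ℤ} (hL : ∀ g ∈ A, L g = leftGroup k A keyL g)
    (hR : ∀ g ∈ A, R g = rightGroup k A keyR g) : IsGroupGraph k G A L R := by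
  have hk0 : 0 < k := by omega
  have eL : ∀ z, (A.filter fun g => L g = z) =
      A.filter fun g => k * z - 1 ≤ rank A keyL g ∧ rank A keyL g < k * z + k - 1 := by
    intro z
    refine Finset.filter_congr fun g hg => ?_
    rw [hL g hg]
    have h1 := leftGroup_le_iff (A := A) (keyL := keyL) hk0 (g := g) (z := z)
    have h2 := leftGroup_le_iff (A := A) (keyL := keyL) hk0 (g := g) (z := z - 1)
    rw [sub_add_cancel] at h2
    rw [mul_add, mul_one] at h1
    omega
  have eR : ∀ z, (A.filter fun g => R g = z) =
      A.filter fun g => k * z ≤ rank A keyR g ∧ rank A keyR g < k * z + k := by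
    intro z
    refine Finset.filter_congr fun g hg => ?_
    rw [hR g hg]
    have h1 := rightGroup_le_iff (A := A) (keyR := keyR) hk0 (g := g) (z := z)
    have h2 := rightGroup_le_iff (A := A) (keyR := keyR) hk0 (g := g) (z := z - 1)
    rw [sub_add_cancel] at h2
    rw [mul_add, mul_one] at h1
    omega
  have hmul : ∀ {a b : ℤ}, a ≤ b → k * a ≤ k * b := fun h => mul_le_mul_of_nonneg_left h hk0.le
  refine ⟨hk, ?_, ?_, ?_, ?_, ?_, ?_⟩
  · intro g hg
    have h0 := rank_nonneg (A := A) (key := keyL) g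
    have h1 := rank_lt_card (key := keyL) hg
    rw [hL g hg, leftGroup]
    exact ⟨Int.ediv_nonneg (by omega) hk0.le,
      by rw [Int.ediv_lt_iff_lt_mul hk0, mul_comm]; omega⟩
  · intro g hg
    have h0 := rank_nonneg (A := A) (key := keyR) g
    have h1 := rank_lt_card (key := keyR) hg
    rw [hR g hg, rightGroup]
    exact ⟨Int.ediv_nonneg (by omega) hk0.le,
      by rw [Int.ediv_lt_iff_lt_mul hk0, mul_comm]; omega⟩
  · rw [eL]
    have : (A.filter fun g => k * 0 - 1 ≤ rank A keyL g ∧ rank A keyL g < k * 0 + k - 1) =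
        A.filter fun g => 0 ≤ rank A keyL g ∧ rank A keyL g < k - 1 := by
      refine Finset.filter_congr fun g _ => ?_
      have := rank_nonneg (A := A) (key := keyL) g
      simp only [mul_zero, zero_add]
      omega
    have h1 := hmul hG
    rw [this, card_rank_between hkL le_rfl (by omega)]
    omega
  · intro z h0 hz
    have h1 := hmul (show z + 1 ≤ G by omega)
    have h2 := hmul (show 1 ≤ z by omega)
    rw [mul_add] at h1
    rw [eL, card_rank_between hkL (by omega) (by omega)]
    omega
  · intro z h0 hz
    have h1 := hmul (show z + 2 ≤ G by omega)
    have h2 := hmul h0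
    rw [mul_add] at h1
    rw [eR, card_rank_between hkR (by omega) (by omega)]
    omega
  · intro z
    rw [eR]
    have himg : ((A.filter fun g => k * z ≤ rank A keyR g ∧ rank A keyR g < k * z + k).image
        (rank A keyR)) ⊆ Finset.Ico (k * z) (k * z + k) := by
      intro x hx
      obtain ⟨g, hg, rfl⟩ := Finset.mem_image.1 hx
      exact Finset.mem_Ico.2 (Finset.mem_filter.1 hg).2
    have := Finset.card_le_card himg
    rw [Finset.card_image_of_injOn ((rank_injOn hkR).mono
      (Finset.coe_subset.2 (Finset.filter_subset _ _))), Int.card_Ico] at this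
    omega

theorem exists_missing_colour {T : Finset ℤ} {col : ℤ → ℤ} {k : ℤ} (h : (T.card : ℤ) < k) :
    ∃ c, 1 ≤ c ∧ c ≤ k ∧ ∀ g ∈ T, col g ≠ c := by
  by_contra hc
  push Not at hc
  have : Finset.Icc 1 k ⊆ T.image col := by
    intro c hc'
    rw [Finset.mem_Icc] at hc'
    obtain ⟨g, hg, e⟩ := hc c hc'.1 hc'.2
    exact Finset.mem_image.2 ⟨g, hg, e⟩
  have := (Finset.card_le_card this).trans Finset.card_image_le
  rw [Int.card_Icc] at this
  omega

theorem exists_colour {T S : Finset ℤ} {col : ℤ → ℤ} (hS : S.card ≤ T.card)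
    (hinj : ∀ g ∈ T, ∀ h ∈ T, g ≠ h → col g ≠ col h) (hmem : ∀ g ∈ T, col g ∈ S) {c : ℤ}
    (hc : c ∈ S) : ∃ g ∈ T, col g = c := by
  have h1 : T.image col ⊆ S := by
    intro x hx
    obtain ⟨g, hg, rfl⟩ := Finset.mem_image.1 hx
    exact hmem g hg
  have h2 : (T.image col).card = T.card :=
    Finset.card_image_of_injOn fun g hg h hh e => by
      by_contra hne
      exact hinj g hg h hh hne e
  have := Finset.eq_of_subset_of_card_le h1 (by omega)
  rw [← this] at hc
  simpa using hc

/-- All edges have one of the colours `1, …, k`. -/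
def Complete (k : ℤ) (A : Finset ℤ) (col : ℤ → ℤ) : Prop := ∀ g ∈ A, 1 ≤ col g ∧ col g ≤ k

section Colour

variable {k G : ℤ} {A : Finset ℤ} {L R χ col : ℤ → ℤ} {X Y : ℤ}

theorem exists_colour_left (hG : IsGroupGraph k G A L R) (hc : Complete k A χ) {z : ℤ} (h0 : 0 < z)
    (hz : z < G) (hp : ∀ g ∈ A, ∀ h ∈ A, g ≠ h → L g = L h → L g = z → χ g ≠ χ h) (hX : 1 ≤ X)
    (hXk : X ≤ k) : ∃ g ∈ A, L g = z ∧ χ g = X := by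
  obtain ⟨g, hg, e⟩ := exists_colour (T := A.filter fun g => L g = z) (S := Finset.Icc 1 k)
    (col := χ) (by have := hG.L_pos z h0 hz; rw [Int.card_Icc]; omega)
    (by
      intro g hg h hh hne
      rw [Finset.mem_filter] at hg hh
      exact hp g hg.1 h hh.1 hne (hg.2.trans hh.2.symm) hg.2)
    (fun g hg => Finset.mem_Icc.2 (hc g (Finset.mem_filter.1 hg).1)) (Finset.mem_Icc.2 ⟨hX, hXk⟩)
  rw [Finset.mem_filter] at hg
  exact ⟨g, hg.1, hg.2, e⟩

theorem exists_colour_right (hG : IsGroupGraph k G A L R) (hc : Complete k A χ)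
    (hp : Proper A R χ) {z : ℤ} (h0 : 0 ≤ z) (hz : z < G - 1) (hX : 1 ≤ X) (hXk : X ≤ k) :
    ∃ g ∈ A, R g = z ∧ χ g = X := by
  obtain ⟨g, hg, e⟩ := exists_colour (T := A.filter fun g => R g = z) (S := Finset.Icc 1 k)
    (col := χ) (by have := hG.R_lt z h0 hz; rw [Int.card_Icc]; omega)
    (by
      intro g hg h hh hne
      rw [Finset.mem_filter] at hg hh
      have := hc g hg.1
      exact hp g hg.1 h hh.1 hne (hg.2.trans hh.2.symm) (by omega))
    (fun g hg => Finset.mem_Icc.2 (hc g (Finset.mem_filter.1 hg).1)) (Finset.mem_Icc.2 ⟨hX, hXk⟩)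
  rw [Finset.mem_filter] at hg
  exact ⟨g, hg.1, hg.2, e⟩

theorem exists_colour_zero (hG : IsGroupGraph k G A L R) (hc : Complete k A χ)
    (hp : Proper A L χ) (hX : 1 ≤ X ∧ X ≤ k) (hX0 : ∀ g ∈ A, L g = 0 → χ g ≠ X) (hY : 1 ≤ Y)
    (hYk : Y ≤ k) (hXY : X ≠ Y) : ∃ g ∈ A, L g = 0 ∧ χ g = Y := by
  obtain ⟨g, hg, e⟩ := exists_colour (T := A.filter fun g => L g = 0)
    (S := (Finset.Icc 1 k).erase X) (col := χ)
    (by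
      have := hG.L_zero
      rw [Finset.card_erase_of_mem (Finset.mem_Icc.2 hX), Int.card_Icc]
      omega)
    (by
      intro g hg h hh hne
      rw [Finset.mem_filter] at hg hh
      have := hc g hg.1
      exact hp g hg.1 h hh.1 hne (hg.2.trans hh.2.symm) (by omega))
    (by
      intro g hg
      rw [Finset.mem_filter] at hg
      exact Finset.mem_erase.2 ⟨hX0 g hg.1 hg.2, Finset.mem_Icc.2 (hc g hg.1)⟩)
    (Finset.mem_erase.2 ⟨hXY.symm, Finset.mem_Icc.2 ⟨hY, hYk⟩⟩)
  rw [Finset.mem_filter] at hg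
  exact ⟨g, hg.1, hg.2, e⟩

/-- A colour other than the one missing at the first left end occurs at all left ends, hence, being
a matching of the full size, at all right ends. -/
theorem exists_colour_all_right (hG : IsGroupGraph k G A L R) (hc : Complete k A χ)
    (hpL : Proper A L χ) (hpR : Proper A R χ) (hX : 1 ≤ X ∧ X ≤ k)
    (hX0 : ∀ g ∈ A, L g = 0 → χ g ≠ X) (hY : 1 ≤ Y) (hYk : Y ≤ k) (hXY : X ≠ Y) {g : ℤ}
    (hg : g ∈ A) : ∃ h ∈ A, R h = R g ∧ χ h = Y := by
  have h1 : ∀ z, 0 ≤ z → z < G → ∃ g ∈ A, L g = z ∧ χ g = Y := by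
    intro z hz0 hzG
    rcases hz0.eq_or_lt with rfl | hz0
    · exact exists_colour_zero hG hc hpL hX hX0 hY hYk hXY
    · exact exists_colour_left hG hc hz0 hzG (fun g hg h hh hne hgh _ =>
        hpL g hg h hh hne hgh (by have := hc g hg; omega)) hY hYk
  have h2 : Finset.Ico 0 G ⊆ (A.filter fun g => χ g = Y).image L := by
    intro z hz
    rw [Finset.mem_Ico] at hz
    obtain ⟨g, hg, e, e'⟩ := h1 z hz.1 hz.2
    exact Finset.mem_image.2 ⟨g, Finset.mem_filter.2 ⟨hg, e'⟩, e⟩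
  obtain ⟨h, hh, e⟩ := exists_colour (T := A.filter fun g => χ g = Y) (S := Finset.Ico 0 G)
    (col := R) ((Finset.card_le_card h2).trans Finset.card_image_le)
    (by
      intro g hg h hh hne hgh
      rw [Finset.mem_filter] at hg hh
      exact hpR g hg.1 h hh.1 hne hgh (by omega) (hg.2.trans hh.2.symm))
    (fun g hg => Finset.mem_Ico.2 (hG.R_mem g (Finset.mem_filter.1 hg).1))
    (Finset.mem_Ico.2 (hG.R_mem g hg))
  rw [Finset.mem_filter] at hh
  exact ⟨h, hh.1, e, hh.2⟩

/-- The numbers of the edges of colour `X` at the left ends: one at each, except that an end `u`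
may have one too few and a later end `v` one too many; the value `-1` of `u` or `v` means that
there is no such end. -/
def LeftCounts (G : ℤ) (A : Finset ℤ) (L col : ℤ → ℤ) (X : ℤ) : Prop :=
  ∃ u v : ℤ, (v = -1 ∨ 0 ≤ u ∧ u < v) ∧ ∀ z, 0 ≤ z → z < G →
    ((A.filter fun g => L g = z ∧ col g = X).card : ℤ) =
      1 - (if z = u then 1 else 0) + if z = v then 1 else 0

theorem LeftCounts.bounds (hG : ∀ g ∈ A, 0 ≤ L g) (h : LeftCounts G A L col X) {z : ℤ} (h0 : 0 ≤ z)
    (hz : z < G) : z ≤ ((A.filter fun g => col g = X ∧ L g ≤ z).card : ℤ) ∧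
      ((A.filter fun g => col g = X ∧ L g ≤ z).card : ℤ) ≤ z + 1 := by
  obtain ⟨u, v, huv, h⟩ := h
  have h1 : ((A.filter fun g => col g = X ∧ L g ≤ z).card : ℤ) =
      ∑ i ∈ Finset.Icc 0 z, (1 - (if i = u then 1 else 0) + if i = v then (1 : ℤ) else 0) := by
    rw [Finset.card_eq_sum_card_fiberwise (f := L) (t := Finset.Icc 0 z)]
    · push_cast
      refine Finset.sum_congr rfl fun i hi => ?_
      rw [Finset.mem_Icc] at hi
      rw [← h i hi.1 (by omega), Finset.filter_filter]
      congr 2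
      refine Finset.filter_congr fun g _ => ?_
      constructor
      · rintro ⟨⟨a, -⟩, c⟩; exact ⟨c, a⟩
      · rintro ⟨a, b⟩; exact ⟨⟨b, by omega⟩, a⟩
    · intro g hg
      simp only [Finset.coe_filter, Set.mem_ofPred_eq] at hg
      exact Finset.mem_coe.2 (Finset.mem_Icc.2 ⟨hG g hg.1, hg.2.2⟩)
  rw [h1, Finset.sum_add_distrib, Finset.sum_sub_distrib, Finset.sum_ite_eq', Finset.sum_ite_eq']
  simp only [Finset.sum_const, Int.card_Icc, Finset.mem_Icc, mul_one, nsmul_eq_mul]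
  split_ifs <;> omega

theorem isSplit_of_colouring {keyL keyR w : ℤ → ℤ} (hG : IsGroupGraph k G A L R)
    (hL : ∀ g ∈ A, L g = leftGroup k A keyL g) (hR : ∀ g ∈ A, R g = rightGroup k A keyR g)
    (hc : Complete k A col) (hpR : Proper A R col) (hX : 1 ≤ X) (hXk : X ≤ k)
    (hcount : LeftCounts G A L col X)
    (hv : ∃ y ∈ A, 2 * |k * ∑ g ∈ A with col g = X, w g - ∑ g ∈ A, w g| ≤ k * w y ∧
      (0 < k * ∑ g ∈ A with col g = X, w g - ∑ g ∈ A, w g → col y = X) ∧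
      (k * ∑ g ∈ A with col g = X, w g - ∑ g ∈ A, w g < 0 → col y ≠ X)) :
    IsSplit k G A keyL keyR w (A.filter fun g => col g = X) := by
  have eL : ∀ z, ((A.filter fun g => col g = X).filter fun g => leftGroup k A keyL g ≤ z) =
      A.filter fun g => col g = X ∧ L g ≤ z := by
    intro z
    rw [Finset.filter_filter]
    exact Finset.filter_congr fun g hg => by rw [hL g hg]
  have eR : ∀ z, ((A.filter fun g => col g = X).filter fun g => rightGroup k A keyR g = z) =
      A.filter fun g => col g = X ∧ R g = z := by
    intro z
    rw [Finset.filter_filter]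
    exact Finset.filter_congr fun g hg => by rw [hR g hg]
  have hL0 : ∀ g ∈ A, 0 ≤ L g := fun g hg => (hG.L_mem g hg).1
  refine ⟨Finset.filter_subset _ _, ?_, ?_, ?_, ?_, ?_⟩
  · intro z h0 hz
    rw [eL]; exact (hcount.bounds hL0 h0 hz).1
  · intro z h0 hz
    rw [eL]; exact (hcount.bounds hL0 h0 hz).2
  · intro z h0 hz
    rw [eR, Finset.card_le_one]
    intro g hg h hh
    rw [Finset.mem_filter] at hg hh
    by_contra hne
    exact hpR g hg.1 h hh.1 hne (hg.2.2.trans hh.2.2.symm) (by omega)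
      (hg.2.1.trans hh.2.1.symm)
  · intro z h0 hz
    rw [eR]
    obtain ⟨g, hg, e, e'⟩ := exists_colour_right hG hc hpR h0 hz hX hXk
    exact Finset.card_pos.2 ⟨g, Finset.mem_filter.2 ⟨hg, e', e⟩⟩
  · obtain ⟨y, hy, h1, h2, h3⟩ := hv
    refine ⟨y, hy, h1, fun h => Finset.mem_filter.2 ⟨hy, h2 h⟩, fun h h' => ?_⟩
    exact h3 h (Finset.mem_filter.1 h').2

theorem card_eq_one_of_proper (hG : IsGroupGraph k G A L R) (hc : Complete k A col) {z : ℤ}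
    (h0 : 0 < z) (hz : z < G)
    (hp : ∀ g ∈ A, ∀ h ∈ A, g ≠ h → L g = L h → L g = z → col g ≠ col h) (hX : 1 ≤ X)
    (hXk : X ≤ k) : ((A.filter fun g => L g = z ∧ col g = X).card : ℤ) = 1 := by
  obtain ⟨g, hg, e, e'⟩ := exists_colour_left hG hc h0 hz hp hX hXk
  have h1 : (A.filter fun g => L g = z ∧ col g = X).card ≤ 1 := by
    rw [Finset.card_le_one]
    intro g hg h hh
    rw [Finset.mem_filter] at hg hh
    by_contra hne
    exact hp g hg.1 h hh.1 hne (hg.2.1.trans hh.2.1.symm) hg.2.1 (hg.2.2.trans hh.2.2.symm)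
  have h2 : 1 ≤ (A.filter fun g => L g = z ∧ col g = X).card :=
    Finset.card_pos.2 ⟨g, Finset.mem_filter.2 ⟨hg, e, e'⟩⟩
  omega

/-- `χ` is a proper `k`-edge-colouring in which `X` is the colour missing at the first left end, and
`Y` is another colour. -/
structure IsBaseColouring (k G : ℤ) (A : Finset ℤ) (L R χ : ℤ → ℤ) (X Y : ℤ) : Prop where
  graph : IsGroupGraph k G A L R
  complete : Complete k A χ
  hL : Proper A L χ
  hR : Proper A R χ
  hX : 1 ≤ X ∧ X ≤ k
  hY : 1 ≤ Y ∧ Y ≤ k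
  ne : X ≠ Y
  X_zero : ∀ g ∈ A, L g = 0 → χ g ≠ X

/-- Exchanging `X` and `Y` on some edges leaves the colouring complete, and if all edges of colour
`Y` at the first left end are exchanged, there is exactly one edge of colour `X` there. -/
theorem IsBaseColouring.complete_flip (hb : IsBaseColouring k G A L R χ X Y)
    (flip : ∀ g, col g = χ g ∨ (χ g = X ∧ col g = Y) ∨ (χ g = Y ∧ col g = X)) :
    Complete k A col := by
  intro g hg
  have := hb.complete g hg
  have := flip g
  have := hb.hX
  have := hb.hY
  omega

theorem IsBaseColouring.card_zero (hb : IsBaseColouring k G A L R χ X Y)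
    (flip : ∀ g, col g = χ g ∨ (χ g = X ∧ col g = Y) ∨ (χ g = Y ∧ col g = X))
    (hY0 : ∀ g ∈ A, L g = 0 → χ g = Y → col g = X) :
    ((A.filter fun g => L g = 0 ∧ col g = X).card : ℤ) = 1 := by
  obtain ⟨y, hy, e, e'⟩ := exists_colour_zero hb.graph hb.complete hb.hL hb.hX hb.X_zero hb.hY.1
    hb.hY.2 hb.ne
  have : (A.filter fun g => L g = 0 ∧ col g = X) = {y} := by
    ext g
    simp only [Finset.mem_filter, Finset.mem_singleton]
    constructor
    · rintro ⟨hg, h0, hX⟩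
      by_contra hne
      have h1 := hb.X_zero g hg h0
      have h2 := hb.hL g hg y hy hne (h0.trans e.symm) (by have := hb.complete g hg; omega)
      have := flip g
      grind
    · rintro rfl
      exact ⟨hy, e, hY0 _ hy e e'⟩
  rw [this]; simp

theorem IsBaseColouring.leftCounts_proper (hb : IsBaseColouring k G A L R χ X Y)
    (flip : ∀ g, col g = χ g ∨ (χ g = X ∧ col g = Y) ∨ (χ g = Y ∧ col g = X))
    (hY0 : ∀ g ∈ A, L g = 0 → χ g = Y → col g = X)
    (hp : ∀ g ∈ A, ∀ h ∈ A, g ≠ h → L g = L h → L g ≠ 0 → col g ≠ 0 → col g ≠ col h) :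
    LeftCounts G A L col X := by
  have hc := hb.complete_flip flip
  refine ⟨-1, -1, Or.inl rfl, fun z h0 hz => ?_⟩
  rcases h0.eq_or_lt with rfl | h0
  · rw [hb.card_zero flip hY0]; simp
  · rw [card_eq_one_of_proper hb.graph hc h0 hz
      (fun g hg h hh hne e ez => hp g hg h hh hne e (by omega) (by have := hc g hg; omega))
      hb.hX.1 hb.hX.2]
    rw [if_neg (by omega)]; simp

/-- The states of the first chain, which exchanges `Y` for `X` from the first left end on. -/
theorem IsBaseColouring.leftCounts_first (hb : IsBaseColouring k G A L R χ X Y) {col₀ : ℤ → ℤ}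
    {e : ℤ} (h : ChainRun A L R χ Y X col₀ 0 col e) : LeftCounts G A L col X := by
  have flip : ∀ g, col g = χ g ∨ (χ g = X ∧ col g = Y) ∨ (χ g = Y ∧ col g = X) := fun g => by
    have := h.flip g; tauto
  have hc := hb.complete_flip flip
  rcases h.start with ⟨s1, s2⟩ | ⟨s1, s2, s3, s4⟩
  · refine ⟨0, -1, Or.inl rfl, fun z h0 hz => ?_⟩
    rcases h0.eq_or_lt with rfl | h0
    · have : (A.filter fun g => L g = 0 ∧ col g = X) = ∅ := by
        refine Finset.filter_eq_empty_iff.2 ?_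
        rintro g hg ⟨h1, h2⟩
        have h3 := hb.X_zero g hg h1
        have h4 := flip g
        have h5 := hb.hL g hg e h.mem
        have h6 := h.chi
        have h7 := h.cur
        have h8 := hb.ne
        have := hb.hY
        grind
      rw [this]; simp
    · rw [card_eq_one_of_proper hb.graph hc h0 hz
        (fun g hg h hh hne e ez => s2 g hg h hh hne e (by have := hc g hg; omega))
        hb.hX.1 hb.hX.2]
      rw [if_neg (by omega), if_neg (by omega)]; simp
  · refine ⟨L e, -1, Or.inl rfl, fun z h0 hz => ?_⟩
    rcases h0.eq_or_lt with rfl | h0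
    · rw [hb.card_zero flip s3, if_neg (Ne.symm s1)]; simp
    · by_cases hze : z = L e
      · have : (A.filter fun g => L g = z ∧ col g = X) = ∅ := by
          refine Finset.filter_eq_empty_iff.2 ?_
          rintro g hg ⟨h1, h2⟩
          have h3 := s2 g hg
          have h4 := flip g
          have h5 := hb.hL g hg e h.mem
          have h6 := h.chi
          have h7 := h.cur
          have h8 := hb.ne
          have := hb.hY
          grind
        rw [this, if_pos hze, if_neg (by omega)]; simp
      · rw [card_eq_one_of_proper hb.graph hc h0 hz
          (fun g hg h' hh hne e ez => h.left g hg h' hh hne e (by omega) (by omega)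
            (by have := hc g hg; omega)) hb.hX.1 hb.hX.2]
        rw [if_neg hze, if_neg (by omega)]; simp

/-- The states of a later chain, which exchanges `X` for `Y` from the left end `l₀` on, where `l₀`
is the first left end of its component. -/
theorem IsBaseColouring.leftCounts_later (hb : IsBaseColouring k G A L R χ X Y) {col₀ : ℤ → ℤ}
    {e l₀ : ℤ} (hl₀ : 0 < l₀) (h : ChainRun A L R χ X Y col₀ l₀ col e)
    (hY0 : ∀ g ∈ A, L g = 0 → χ g = Y → col g = X)
    (hlt : ∀ g ∈ A, χ g = X → L g < l₀ → col g = Y) : LeftCounts G A L col X := by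
  have hc := hb.complete_flip h.flip
  rcases h.start with ⟨s1, s2⟩ | ⟨s1, s2, s3, s4⟩
  · exact hb.leftCounts_proper h.flip hY0 fun g hg h hh hne e _ => s2 g hg h hh hne e
  · have hle : l₀ < L e := by
      have h1 := hlt e h.mem h.chi
      have h2 := h.cur
      have h3 := hb.ne
      by_contra h4
      exact h3 (h2.symm.trans (h1 (by omega)))
    refine ⟨l₀, L e, Or.inr ⟨hl₀.le, hle⟩, fun z h0 hz => ?_⟩
    rcases h0.eq_or_lt with rfl | h0
    · rw [hb.card_zero h.flip hY0, if_neg (by omega), if_neg (by omega)]; simp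
    · by_cases hze : z = L e
      · obtain ⟨f, hf, f1, f2⟩ := exists_colour_left hb.graph hb.complete h0 hz
          (fun g hg h hh hne e ez => hb.hL g hg h hh hne e (by have := hb.complete g hg; omega))
          hb.hY.1 hb.hY.2
        have hfX := s2 f hf (by omega) f2
        have hef : e ≠ f := by
          rintro rfl; exact hb.ne (h.chi.symm.trans f2)
        have : (A.filter fun g => L g = z ∧ col g = X) = {e, f} := by
          ext g
          simp only [Finset.mem_filter, Finset.mem_insert, Finset.mem_singleton]
          constructor
          · rintro ⟨hg, h1, h2⟩
            have h4 := h.flip g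
            have h5 := hb.hL g hg e h.mem
            have h6 := h.chi
            have h7 := hb.hL g hg f hf
            have h8 := hb.hX
            have h9 := hb.hY
            grind
          · rintro (rfl | rfl)
            · exact ⟨h.mem, hze.symm, h.cur⟩
            · exact ⟨hf, f1, hfX⟩
        rw [this, Finset.card_pair hef, if_neg (by omega), if_pos hze]; simp
      · by_cases hzl : z = l₀
        · have : (A.filter fun g => L g = z ∧ col g = X) = ∅ := by
            refine Finset.filter_eq_empty_iff.2 ?_
            rintro g hg ⟨h1, h2⟩
            have h3 := s3 g hg
            have h4 := s4 g hg
            have h5 := h.flip g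
            have h8 := hb.ne
            grind
          rw [this, if_pos hzl, if_neg hze]; simp
        · rw [card_eq_one_of_proper hb.graph hc h0 hz
            (fun g hg h' hh hne e ez => h.left g hg h' hh hne e (by omega) (by omega)
              (by have := hc g hg; omega)) hb.hX.1 hb.hX.2]
          rw [if_neg hzl, if_neg hze]; simp

/-- A later chain runs around a cycle, and so leaves a proper colouring. -/
theorem IsBaseColouring.proper_of_end (hb : IsBaseColouring k G A L R χ X Y) {col₀ : ℤ → ℤ}
    {l₀ : ℤ} (h : ChainEnd A L R χ X Y col₀ l₀ col)
    (hY0 : ∀ g ∈ A, L g = 0 → χ g = Y → col₀ g = X) : Proper A L col := by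
  rcases h.cause with ⟨e, he, -, h2⟩ | ⟨f, hf, h1, h2, h3⟩ | h1
  · obtain ⟨g, hg, h4, h5⟩ := exists_colour_all_right hb.graph hb.complete hb.hL hb.hR hb.hX
      hb.X_zero hb.hY.1 hb.hY.2 hb.ne he
    exact absurd h5 (h2 g hg h4)
  · exfalso
    obtain ⟨hf0, hfG⟩ := hb.graph.L_mem f hf
    rcases hf0.eq_or_lt with hf0 | hf0
    · have := hY0 f hf hf0.symm h1
      exact hb.ne (this.symm.trans (h2.trans h1))
    · obtain ⟨g, hg, h4, h5⟩ := exists_colour_left hb.graph hb.complete hf0 hfG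
        (fun g hg h hh hne e ez => hb.hL g hg h hh hne e (by have := hb.complete g hg; omega))
        hb.hX.1 hb.hX.2
      exact h3 g hg h4 h5
  · exact h1

/-- If the colouring is proper and all edges of colour `X` are exchanged, then so are those of
colour `Y`. -/
theorem IsBaseColouring.all_exchanged (hb : IsBaseColouring k G A L R χ X Y)
    (flip : ∀ g, col g = χ g ∨ (χ g = X ∧ col g = Y) ∨ (χ g = Y ∧ col g = X))
    (hY0 : ∀ g ∈ A, L g = 0 → χ g = Y → col g = X) (hp : Proper A L col)
    (hX : ∀ g ∈ A, χ g = X → col g = Y) :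
    (A.filter fun g => col g = X) = A.filter fun g => χ g = Y := by
  refine Finset.filter_congr fun g hg => ?_
  have h1 := flip g
  have h2 := hb.ne
  have h4 := hX g hg
  constructor
  · grind
  · intro h3
    obtain ⟨hg0, hgG⟩ := hb.graph.L_mem g hg
    rcases hg0.eq_or_lt with hg0 | hg0
    · exact hY0 g hg hg0.symm h3
    · obtain ⟨f, hf, h4, h5⟩ := exists_colour_left hb.graph hb.complete hg0 hgG
        (fun g hg h hh hne e ez => hb.hL g hg h hh hne e (by have := hb.complete g hg; omega))
        hb.hX.1 hb.hX.2
      have h6 := hX f hf h5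
      have h7 := hp g hg f hf
      have h8 := hb.hY
      grind

end Colour

end FairDivision

/-! ### Programs for edge colourings -/

namespace FairDivision

open RAM Expr Prog

/-- The search for an item `h` with `end h = z` and colour `c`, where array `side` holds the ends,
array `16` the colours, and `z` and `c` are the variables `34` and `35`. The result, or `-1`, is put
into variable `36`. The number of items is variable `30`. -/
def findProg (side : ℕ) : Prog :=
  (assign 36 (const (-1)) ;; assign 33 0) ;;
  loop (var 30 - var 33)
    ((cond (eqv (read side (var 33)) (var 34))
      (cond (eqv (read 16 (var 33)) (var 35)) (assign 36 (var 33)) skip) skip) ;;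
    assign 33 (var 33 + 1))

section Find

variable {N : ℕ} {B mm : ℤ} {μ : Mem}

theorem does_find {side : ℕ} (h33 : side ≠ 33) (h36 : side ≠ 36) (hB : Bd B μ)
    (hmm : μ 30 0 = mm) (h0 : 0 ≤ mm) (hmN : mm ≤ N) (hmB : mm + 1 ≤ B) :
    Does N B (findProg side) μ fun μ' => Bd B μ' ∧ (∀ a, a ≠ 33 → a ≠ 36 → μ' a = μ a) ∧
      ((μ' 36 0 = -1 ∧ ∀ h, 0 ≤ h → h < mm → μ side h = μ 34 0 → μ 16 h ≠ μ 35 0) ∨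
        (0 ≤ μ' 36 0 ∧ μ' 36 0 < mm ∧ μ side (μ' 36 0) = μ 34 0 ∧ μ 16 (μ' 36 0) = μ 35 0)) := by
  refine Does.line_seq (by simp) hB ?_
  refine (Does.count (n := mm) (i₀ := 0) (fun i μ' => Bd B μ' ∧
    (∀ a, a ≠ 33 → a ≠ 36 → μ' a = μ a) ∧ 0 ≤ i ∧ μ' 33 0 = i ∧
      ((μ' 36 0 = -1 ∧ ∀ h, 0 ≤ h → h < i → μ side h = μ 34 0 → μ 16 h ≠ μ 35 0) ∨
        (0 ≤ μ' 36 0 ∧ μ' 36 0 < mm ∧ μ side (μ' 36 0) = μ 34 0 ∧ μ 16 (μ' 36 0) = μ 35 0)))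
    ?_ ?_ h0 (by omega) ?_).imp ?_
  · rintro i μ' ⟨h1, h2, h3, h4, -⟩
    refine ⟨h1, ?_⟩
    simp [h2, hmm, h4]
  · refine ⟨?_, ?_, le_rfl, ?_, ?_⟩
    · exact (hB.store (by simp; omega)).store (by simp; omega)
    · intro a h1 h2; simp [h1, h2]
    · simp
    · left; simp; intro h h1 h2; omega
  · rintro i μ' hi0 hi ⟨h1, h2, h3, h4, h5⟩
    refine Does.line (by simp) h1 ?_
    simp only [exec_seq, exec_assign, exec_cond, exec_skip, eval_eqv_pos, eval_read, eval_var, h4,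
      h2 side h33 h36, h2 16 (by decide) (by decide), h2 34 (by decide) (by decide),
      h2 35 (by decide) (by decide)]
    by_cases c1 : μ side i = μ 34 0 <;> by_cases c2 : μ 16 i = μ 35 0
    · simp only [c1, c2, if_true]
      refine ⟨(h1.store (abs_le.2 (by omega))).store (abs_le.2 (by simp [h4]; omega)), ?_, by omega,
        by simp [h4], ?_⟩
      · intro a h6 h7; simp [h6, h7, h2]
      · right; simp [c1, c2]; omega
    all_goals
      simp only [c1, c2, if_true, if_false]
      refine ⟨h1.store (abs_le.2 (by simp [h4]; omega)), ?_, by omega, by simp [h4], ?_⟩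
      · intro a h6 h7; simp [h6, h7, h2]
      · rcases h5 with ⟨h5, h6⟩ | h5
        · left
          refine ⟨by simpa using h5, fun h h7 h8 => ?_⟩
          by_cases h9 : h = i
          · subst h9; tauto
          · exact h6 h h7 (by omega)
        · right; simpa using h5
  · rintro μ' ⟨h1, h2, h3, h4, h5⟩
    exact ⟨h1, h2, h5⟩

end Find

/-- The search for a colour that does not occur at the end `z` (variable `34`); the result is put
into variable `35`. -/
def missingProg (side : ℕ) : Prog :=
  assign 35 1 ;; findProg side ;;
  loop (var 36 + 1) (assign 35 (var 35 + 1) ;; findProg side)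

/-- One step of `chainProg` that is not the last one: the edges `e` and `f` (variables `37` and
`38`) receive the colours `q` and `p`, and the next edge of the chain is searched. -/
def chainStep : Prog :=
  (assign 41 (var 41 + var 43) ;; set 16 (var 37) (var 40)) ;;
  Prog.cond (var 38 + 1)
    ((assign 34 (read 14 (var 38)) ;; assign 35 (var 39)) ;;
      findProg 14 ;;
      (assign 37 (var 36) ;; set 16 (var 38) (var 39)))
    (assign 37 (const (-1)))

/-- The last step of `chainProg` when the balance changes its sign. -/
def chainStop : Prog :=
  assign 44 1 ;;
  (Prog.cond (0 - var 43 * (2 * var 41 + var 43))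
    (assign 41 (var 41 + var 43) ;; set 16 (var 37) (var 40) ;;
      Prog.cond (var 38 + 1) (set 16 (var 38) (var 39)) skip)
    skip) ;;
  assign 37 (const (-1))

/-- The body of the loop of `chainProg`. -/
def chainBody : Prog :=
  (assign 34 (read 15 (var 37)) ;; assign 35 (var 40)) ;;
  findProg 15 ;;
  (assign 38 (var 36) ;;
    assign 43 (var 42 * var 31 * (read 12 (var 37) - read 12 (var 38)))) ;;
  Prog.cond (var 41 * (var 41 + var 43)) chainStep chainStop

/-- The exchange of the colours `p` and `q` (variables `39` and `40`) along a chain that starts with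
the edge `e` (variable `37`). The balance (variable `41`) changes by `σ * k * w` for an edge of
value `w` that receives colour `q`, where `σ` is variable `42` and `k` is variable `31`. The chain is
left when the balance changes its sign; variable `44` is then set to `1`, and the last exchange is
carried out only if that decreases the absolute value of the balance. -/
def chainProg : Prog := loop (var 37 + 1) chainBody

/-- The data of the programs: `A` is a set of items below `mm`, `w` their values, and the bounds are
those for the memory cells and the numbers of iterations. -/
structure Data (N : ℕ) (B mm k : ℤ) (A : Finset ℤ) (w : ℤ → ℤ) : Prop where
  k_two : 2 ≤ k
  k_three : k ≤ 3
  mm_three : 3 ≤ mm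
  sub : ∀ g ∈ A, 0 ≤ g ∧ g < mm
  w_nonneg : ∀ g, 0 ≤ w g
  w_neg : w (-1) = 0
  sum_le : 10 * ∑ g ∈ A, w g + 10 * mm ≤ B
  N_le : mm + 1 ≤ N

/-- The memory holds the data and the graph; the items outside `A` are uncoloured. -/
structure Holds (B mm k : ℤ) (A : Finset ℤ) (w L R : ℤ → ℤ) (μ : Mem) : Prop where
  bd : Bd B μ
  mm : μ 30 0 = mm
  k : μ 31 0 = k
  w : μ 12 = w
  L : μ 14 = L
  R : μ 15 = R
  col : ∀ g, g ∉ A → μ 16 g = 0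

theorem Holds.frame {B mm k : ℤ} {A : Finset ℤ} {w L R : ℤ → ℤ} {μ μ' : Mem}
    (h : Holds B mm k A w L R μ) (bd : Bd B μ')
    (hf : ∀ a, a = 12 ∨ a = 14 ∨ a = 15 ∨ a = 30 ∨ a = 31 → μ' a = μ a)
    (col : ∀ g, g ∉ A → μ' 16 g = 0) : Holds B mm k A w L R μ' :=
  ⟨bd, by rw [hf _ (by simp), h.mm], by rw [hf _ (by simp), h.k], by rw [hf _ (by simp), h.w],
    by rw [hf _ (by simp), h.L], by rw [hf _ (by simp), h.R], col⟩

section Chain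

variable {N : ℕ} {B mm k : ℤ} {A : Finset ℤ} {w L R χ : ℤ → ℤ} {μ : Mem}

theorem Data.w_le (d : Data N B mm k A w) {g : ℤ} (hg : g ∈ A ∨ g = -1) :
    w g ≤ ∑ g ∈ A, w g := by
  rcases hg with hg | rfl
  · exact Finset.single_le_sum (fun g _ => d.w_nonneg g) hg
  · rw [d.w_neg]; exact Finset.sum_nonneg fun g _ => d.w_nonneg g

theorem Data.sum_nonneg (d : Data N B mm k A w) : 0 ≤ ∑ g ∈ A, w g :=
  Finset.sum_nonneg fun g _ => d.w_nonneg g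

theorem does_find_mem (d : Data N B mm k A w) (h : Holds B mm k A w L R μ) {side : ℕ}
    (h33 : side ≠ 33) (h36 : side ≠ 36) (hc : μ 35 0 ≠ 0) :
    Does N B (findProg side) μ fun μ' => Holds B mm k A w L R μ' ∧
      (∀ a, a ≠ 33 → a ≠ 36 → μ' a = μ a) ∧
      ((μ' 36 0 = -1 ∧ ∀ h ∈ A, μ side h = μ 34 0 → μ 16 h ≠ μ 35 0) ∨
        (μ' 36 0 ∈ A ∧ μ side (μ' 36 0) = μ 34 0 ∧ μ 16 (μ' 36 0) = μ 35 0)) := by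
  have := d.mm_three
  have := d.sum_le
  have := d.sum_nonneg
  have := d.N_le
  refine (does_find h33 h36 h.bd h.mm (by omega) (by omega) (by omega)).imp ?_
  rintro μ' ⟨h1, h2, h3⟩
  refine ⟨h.frame h1 (fun a ha => h2 a (by omega) (by omega))
    (by rw [h2 _ (by decide) (by decide)]; exact h.col), h2, ?_⟩
  · rcases h3 with ⟨h3, h4⟩ | ⟨h3, h4, h5, h6⟩
    · exact Or.inl ⟨h3, fun g hg => h4 g (d.sub g hg).1 (d.sub g hg).2⟩
    · refine Or.inr ⟨?_, h5, h6⟩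
      by_contra hA
      exact hc (by rw [← h6, h.col _ hA])

theorem does_missing (d : Data N B mm k A w) (h : Holds B mm k A w L R μ) {side : ℕ}
    (h33 : side ≠ 33) (h35 : side ≠ 35) (h36 : side ≠ 36)
    (hex : ∃ c, 1 ≤ c ∧ c ≤ k ∧ ∀ h ∈ A, μ side h = μ 34 0 → μ 16 h ≠ c) :
    Does N B (missingProg side) μ fun μ' => Holds B mm k A w L R μ' ∧
      (∀ a, a ≠ 33 → a ≠ 35 → a ≠ 36 → μ' a = μ a) ∧ 1 ≤ μ' 35 0 ∧ μ' 35 0 ≤ k ∧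
      ∀ h ∈ A, μ side h = μ 34 0 → μ 16 h ≠ μ' 35 0 := by
  obtain ⟨c, hc1, hck, hc⟩ := hex
  have hk3 := d.k_three
  have := d.mm_three
  have := d.sum_le
  have := d.sum_nonneg
  have := d.N_le
  have hB := h.bd.nonneg
  refine Does.line_seq (by simp) h.bd (Does.seq ?_)
  refine (does_find_mem (μ := (assign 35 1).exec μ) d
    (h.frame (h.bd.store (by simp; omega)) (by rintro a (rfl | rfl | rfl | rfl | rfl) <;> simp)
      (by simpa using h.col)) h33 h36 (by simp)).imp ?_
  rintro μ₁ ⟨h1, h2, h3⟩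
  refine (Does.loop (n := (c - 1).toNat) (fun n μ' => Holds B mm k A w L R μ' ∧
    (∀ a, a ≠ 33 → a ≠ 35 → a ≠ 36 → μ' a = μ a) ∧ 1 ≤ μ' 35 0 ∧ μ' 35 0 ≤ c ∧
      n = (c - μ' 35 0).toNat ∧
      ((μ' 36 0 = -1 ∧ ∀ h ∈ A, μ side h = μ 34 0 → μ 16 h ≠ μ' 35 0) ∨
        (μ' 36 0 ∈ A ∧ μ side (μ' 36 0) = μ 34 0 ∧ μ 16 (μ' 36 0) = μ' 35 0)))
    (fun n μ' h => h.1.bd) ?_ ?_ (by omega)).imp ?_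
  · rintro n μ' ⟨i1, i2, i3, i4, i5, i6⟩ he
    simp only [eval_add, eval_var, eval_one] at he
    have i7 : μ' 35 0 ≠ c := by
      rcases i6 with ⟨i6, -⟩ | ⟨i6, i7, i8⟩
      · omega
      · intro e; exact hc _ i6 i7 (i8.trans e)
    refine Does.line_seq (by simp) i1.bd ?_
    refine (does_find_mem (μ := (assign 35 (var 35 + 1)).exec μ') d
      (i1.frame (i1.bd.store (abs_le.2 (by simp; omega)))
        (by rintro a (rfl | rfl | rfl | rfl | rfl) <;> simp) (by simpa using i1.col))
      h33 h36 (by simp; omega)).imp ?_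
    rintro μ'' ⟨j1, j2, j3⟩
    have e35 : μ'' 35 0 = μ' 35 0 + 1 := by rw [j2 _ (by decide) (by decide)]; simp
    refine ⟨(c - μ'' 35 0).toNat, by omega, j1, ?_, by omega, by omega, rfl, ?_⟩
    · intro a a1 a2 a3
      rw [j2 a a1 a3]; simp [a2, i2 a a1 a2 a3]
    · rw [e35]
      simpa [h35, i2 side h33 h35 h36, i2 34, i2 16] using j3
  · have e35 : μ₁ 35 0 = 1 := by rw [h2 _ (by decide) (by decide)]; simp
    refine ⟨h1, ?_, by omega, by omega, by omega, ?_⟩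
    · intro a a1 a2 a3
      rw [h2 a a1 a3]; simp [a2]
    · rw [e35]
      simpa [h35] using h3
  · rintro μ' ⟨⟨n, i1, i2, i3, i4, i5, i6⟩, he⟩
    simp only [eval_add, eval_var, eval_one] at he
    refine ⟨i1, i2, i3, by omega, ?_⟩
    rcases i6 with ⟨-, i6⟩ | ⟨i6, -⟩
    · exact i6
    · have := d.sub _ i6; omega

/-- The value of the edges of colour `q`. -/
def classValue (A : Finset ℤ) (w col : ℤ → ℤ) (q : ℤ) : ℤ := ∑ g ∈ A with col g = q, w g

theorem classValue_update {col : ℤ → ℤ} {p q e f : ℤ} (hpq : p ≠ q) (he : e ∈ A) (hep : col e = p)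
    (hf : f ∈ A) (hfq : col f = q) (hef : f ≠ e) :
    classValue A w (Function.update (Function.update col e q) f p) q =
      classValue A w col q + (w e - w f) := by
  unfold classValue
  have h1 : (A.filter fun g => Function.update (Function.update col e q) f p g = q) =
      insert e ((A.filter fun g => col g = q).erase f) := by
    ext g
    simp only [Finset.mem_filter, Finset.mem_insert, Finset.mem_erase, Function.update_apply]
    grind
  have h2 := Finset.add_sum_erase (A.filter fun g => col g = q) w (a := f)
    (Finset.mem_filter.2 ⟨hf, hfq⟩)
  rw [h1, Finset.sum_insert]
  · linarith
  · simp [hep, hpq]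

theorem classValue_update_one {col : ℤ → ℤ} {p q e : ℤ} (hpq : p ≠ q) (he : e ∈ A)
    (hep : col e = p) : classValue A w (Function.update col e q) q = classValue A w col q + w e := by
  unfold classValue
  have h1 : (A.filter fun g => Function.update col e q g = q) =
      insert e (A.filter fun g => col g = q) := by
    ext g
    simp only [Finset.mem_filter, Finset.mem_insert, Function.update_apply]
    grind
  rw [h1, Finset.sum_insert]
  · ring
  · simp [hep, hpq]

theorem Data.classValue_nonneg (d : Data N B mm k A w) (col : ℤ → ℤ) (q : ℤ) :
    0 ≤ classValue A w col q := Finset.sum_nonneg fun g _ => d.w_nonneg g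

theorem Data.classValue_le (d : Data N B mm k A w) (col : ℤ → ℤ) (q : ℤ) :
    classValue A w col q ≤ ∑ g ∈ A, w g :=
  Finset.sum_le_sum_of_subset_of_nonneg (Finset.filter_subset _ _) fun g _ _ => d.w_nonneg g

/-- When the balance `u` changes its sign by a change of `k * (a - b)`, one of its values before and
after is small compared with the larger one of `a` and `b`. -/
theorem balance_before {u k a b : ℤ} (hk : 0 < k) (ha : 0 ≤ a) (hb : 0 ≤ b)
    (h : u * (u + k * (a - b)) ≤ 0) (h' : 0 ≤ k * (a - b) * (2 * u + k * (a - b))) :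
    (0 < u → 2 * |u| ≤ k * b ∧ 0 < b) ∧ (u ≤ 0 → 2 * |u| ≤ k * a) := by
  have ha' := mul_nonneg hk.le ha
  have hb' := mul_nonneg hk.le hb
  rw [mul_sub] at h h'
  constructor
  · intro hu
    have h1 : u + (k * a - k * b) ≤ 0 := by
      by_contra hc
      have := mul_pos hu (not_le.1 hc)
      omega
    have h2 : 2 * u + (k * a - k * b) ≤ 0 := by
      by_contra hc
      have := mul_neg_of_neg_of_pos (show k * a - k * b < 0 by omega) (not_le.1 hc)
      omega
    rw [abs_of_pos hu]
    refine ⟨by omega, ?_⟩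
    by_contra hc
    have : b = 0 := by omega
    rw [this] at h2
    omega
  · intro hu
    rcases hu.eq_or_lt with rfl | hu
    · simpa using ha'
    have h1 : 0 ≤ u + (k * a - k * b) := by
      by_contra hc
      have := mul_pos_of_neg_of_neg hu (not_le.1 hc)
      omega
    have h2 : 0 ≤ 2 * u + (k * a - k * b) := by
      by_contra hc
      have := mul_neg_of_pos_of_neg (show 0 < k * a - k * b by omega) (not_le.1 hc)
      omega
    rw [abs_of_neg hu]
    omega

end Chain

end FairDivision

/-! ### Correctness of the exchange along a chain -/

namespace FairDivision

open RAM Expr Prog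

section Chain

variable {N : ℕ} {B mm k : ℤ} {A : Finset ℤ} {w L R χ : ℤ → ℤ} {μ : Mem} {p q : ℤ} {col₀ : ℤ → ℤ}
  {l₀ : ℤ}

/-- Variable `38` holds an edge of colour `q` at the right end of edge `37`, or `-1` if there is
none. -/
def IsPartner (A : Finset ℤ) (R : ℤ → ℤ) (q : ℤ) (μ : Mem) : Prop :=
  (μ 38 0 = -1 ∧ ∀ h ∈ A, R h = R (μ 37 0) → μ 16 h ≠ q) ∨
    (μ 38 0 ∈ A ∧ R (μ 38 0) = R (μ 37 0) ∧ μ 16 (μ 38 0) = q)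

theorem does_chainStep (d : Data N B mm k A w) (h : Holds B mm k A w L R μ)
    (hrun : ChainRun A L R χ p q col₀ l₀ (μ 16) (μ 37 0)) (hp : μ 39 0 = p) (hq : μ 40 0 = q)
    (hf : IsPartner A R q μ) (hs : |μ 41 0 + μ 43 0| ≤ B) :
    Does N B chainStep μ fun μ' => Holds B mm k A w L R μ' ∧
      (∀ a, a ≠ 16 → a ≠ 33 → a ≠ 34 → a ≠ 35 → a ≠ 36 → a ≠ 37 → a ≠ 41 → μ' a = μ a) ∧
      μ' 41 0 = μ 41 0 + μ 43 0 ∧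
      classValue A w (μ' 16) q = classValue A w (μ 16) q + (w (μ 37 0) - w (μ 38 0)) ∧
      ((ChainRun A L R χ p q col₀ l₀ (μ' 16) (μ' 37 0) ∧
        (A.filter fun g => χ g = p ∧ μ' 16 g = p).card <
          (A.filter fun g => χ g = p ∧ μ 16 g = p).card) ∨
        (μ' 37 0 = -1 ∧ ChainEnd A L R χ p q col₀ l₀ (μ' 16))) := by
  have hB := d.sum_le
  have := d.sum_nonneg
  have := d.mm_three
  have he := hrun.mem
  refine Does.line_seq (by simp) h.bd ?_
  obtain ⟨μ₁, e₁⟩ : ∃ μ₁, μ₁ = (assign 41 (var 41 + var 43) ;; set 16 (var 37) (var 40)).exec μ :=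
    ⟨_, rfl⟩
  rw [← e₁]
  have b₁ : Bd B μ₁ := by
    rw [e₁]; exact (h.bd.store (by simpa using hs)).store (by simpa using h.bd _ _)
  have f₁ : ∀ a, a ≠ 16 → a ≠ 41 → μ₁ a = μ a := by
    intro a a1 a2; rw [e₁]; simp [a1, a2]
  have c₁ : μ₁ 16 = Function.update (μ 16) (μ 37 0) q := by rw [e₁]; simp [hq]
  have s₁ : μ₁ 41 0 = μ 41 0 + μ 43 0 := by rw [e₁]; simp
  have h₁ : Holds B mm k A w L R μ₁ := by
    refine h.frame b₁ (fun a ha => f₁ a (by omega) (by omega)) fun g hg => ?_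
    rw [c₁, Function.update_of_ne (by rintro rfl; exact hg he)]
    exact h.col g hg
  clear e₁
  refine Does.cond b₁ ?_ ?_
  · intro h38
    simp only [eval_add, eval_var, eval_one, f₁ 38 (by decide) (by decide)] at h38
    rcases hf with ⟨hf, -⟩ | ⟨hf, hfR, hfq⟩
    · omega
    refine Does.line_seq (by simp) b₁ (Does.seq ?_)
    refine (does_find_mem (μ := (assign 34 (read 14 (var 38)) ;; assign 35 (var 39)).exec μ₁) d
      (h₁.frame ((b₁.store (by simpa using b₁ _ _)).store (by simpa using b₁ _ _))
      (by rintro a (rfl | rfl | rfl | rfl | rfl) <;> simp) (by simpa using h₁.col))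
      (by decide) (by decide) (by simp [f₁, hp, hrun.hp])).imp ?_
    rintro μ₂ ⟨h₂, f₂, c₂⟩
    have f₂' : ∀ a, a ≠ 16 → a ≠ 33 → a ≠ 34 → a ≠ 35 → a ≠ 36 → a ≠ 41 → μ₂ a = μ a := by
      intro a a1 a2 a3 a4 a5 a6
      rw [f₂ a a2 a5]; simp [a3, a4, f₁ a a1 a6]
    have k₂ : μ₂ 16 = Function.update (μ 16) (μ 37 0) q := by
      rw [f₂ _ (by decide) (by decide)]; simp [c₁]
    have s₂ : μ₂ 41 = μ₁ 41 := by
      rw [f₂ _ (by decide) (by decide)]; simp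
    simp only [exec_seq, exec_assign, eval_var, eval_read, Mem.store_apply, Function.update_self,
      Nat.reduceEqDiff, if_true, if_false, f₁ 38 (by decide) (by decide),
      f₁ 39 (by decide) (by decide), h₁.L, c₁, hp] at c₂
    refine Does.line (by simp) h₂.bd ?_
    have k₃ : ((assign 37 (var 36) ;; set 16 (var 38) (var 39)).exec μ₂) 16 =
        Function.update (Function.update (μ 16) (μ 37 0) q) (μ 38 0) p := by
      simp [k₂, f₂', hp]
    have e₃ : ((assign 37 (var 36) ;; set 16 (var 38) (var 39)).exec μ₂) 37 0 = μ₂ 36 0 := by simp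
    refine ⟨?_, ?_, ?_, ?_, ?_⟩
    · refine h₂.frame ((h₂.bd.store (by simpa using h₂.bd _ _)).store (by simpa using h₂.bd _ _))
        (by rintro a (rfl | rfl | rfl | rfl | rfl) <;> simp) fun g hg => ?_
      rw [k₃, Function.update_of_ne (by rintro rfl; exact hg hf),
        Function.update_of_ne (by rintro rfl; exact hg he)]
      exact h.col g hg
    · intro a a1 a2 a3 a4 a5 a6 a7
      simp [a1, a6, f₂' a a1 a2 a3 a4 a5 a7]
    · simp [s₂, s₁]
    · rw [k₃, classValue_update hrun.ne he hrun.cur hf hfq (hrun.mem_right hf hfR hfq).2.1]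
    · rw [k₃, e₃]
      rcases c₂ with ⟨c₂, c₃⟩ | ⟨c₂, c₃, c₄⟩
      · exact Or.inr ⟨c₂, hrun.finish hf hfR hfq c₃⟩
      · exact Or.inl ⟨hrun.next hf hfR hfq c₂ c₃ c₄, hrun.measure_lt hf hfR hfq⟩
  · intro h38
    simp only [eval_add, eval_var, eval_one, f₁ 38 (by decide) (by decide)] at h38
    rcases hf with ⟨hf, hno⟩ | ⟨hf, -⟩
    swap
    · have := (d.sub _ hf).1; omega
    refine Does.line (by simp) b₁ ?_
    have k₂ : (assign 37 (const (-1))).exec μ₁ 16 = Function.update (μ 16) (μ 37 0) q := by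
      simp [c₁]
    refine ⟨?_, ?_, ?_, ?_, ?_⟩
    · exact h₁.frame (b₁.store (by simp; omega))
        (by rintro a (rfl | rfl | rfl | rfl | rfl) <;> simp) (by simpa using h₁.col)
    · intro a a1 a2 a3 a4 a5 a6 a7
      simp [a6, f₁ a a1 a7]
    · simp [s₁]
    · rw [k₂, classValue_update_one hrun.ne he hrun.cur, hf, d.w_neg]; ring
    · right
      rw [k₂]
      exact ⟨by simp, hrun.not_mem_right hno⟩

theorem does_chainStop (d : Data N B mm k A w) (h : Holds B mm k A w L R μ)
    (hrun : ChainRun A L R χ p q col₀ l₀ (μ 16) (μ 37 0)) (hp : μ 39 0 = p) (hq : μ 40 0 = q)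
    (hf : IsPartner A R q μ) (hs : |μ 41 0 + μ 43 0| ≤ B) :
    Does N B chainStop μ fun μ' => Holds B mm k A w L R μ' ∧
      (∀ a, a ≠ 16 → a ≠ 37 → a ≠ 41 → a ≠ 44 → μ' a = μ a) ∧ μ' 37 0 = -1 ∧ μ' 44 0 = 1 ∧
      ((∃ e, ChainRun A L R χ p q col₀ l₀ (μ' 16) e) ∨ ChainEnd A L R χ p q col₀ l₀ (μ' 16)) ∧
      ((0 ≤ μ 43 0 * (2 * μ 41 0 + μ 43 0) ∧ μ' 41 0 = μ 41 0 ∧ μ' 16 = μ 16) ∨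
        (μ 43 0 * (2 * μ 41 0 + μ 43 0) < 0 ∧ μ' 41 0 = μ 41 0 + μ 43 0 ∧
        classValue A w (μ' 16) q = classValue A w (μ 16) q + (w (μ 37 0) - w (μ 38 0)) ∧
        μ' 16 (μ 37 0) = q ∧ (μ 38 0 ∈ A → μ' 16 (μ 38 0) = p))) := by
  have hB := d.sum_le
  have := d.sum_nonneg
  have := d.mm_three
  have he := hrun.mem
  refine Does.line (by simp [chainStop]) h.bd ?_
  by_cases hδ : 0 < 0 - μ 43 0 * (2 * μ 41 0 + μ 43 0)
  · rcases hf with ⟨hf, hno⟩ | ⟨hf, hfR, hfq⟩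
    · have key : chainStop.exec μ = (((μ.store 44 0 1).store 41 0 (μ 41 0 + μ 43 0)).store 16
          (μ 37 0) q).store 37 0 (-1) := by
        simp [chainStop, show μ 43 0 * (2 * μ 41 0 + μ 43 0) < 0 by omega, hf, hq]
      have k16 : chainStop.exec μ 16 = Function.update (μ 16) (μ 37 0) q := by rw [key]; simp
      refine ⟨h.frame ?_ ?_ ?_, ?_, ?_, ?_, ?_, Or.inr ⟨by omega, ?_, ?_, ?_, ?_⟩⟩
      · rw [key]
        exact (((h.bd.store (by simp; omega)).store hs).store (by rw [← hq]; exact h.bd _ _)).store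
          (by simp; omega)
      · rw [key]; rintro a (rfl | rfl | rfl | rfl | rfl) <;> simp
      · intro g hg
        rw [k16, Function.update_of_ne (by rintro rfl; exact hg he)]
        exact h.col g hg
      · intro a a1 a2 a3 a4; rw [key]; simp [a1, a2, a3, a4]
      · rw [key]; simp
      · rw [key]; simp
      · rw [k16]; exact Or.inr (hrun.not_mem_right hno)
      · rw [key]; simp
      · rw [k16, classValue_update_one hrun.ne he hrun.cur, hf, d.w_neg]; ring
      · rw [k16]; simp
      · intro hfA; have := (d.sub _ hfA).1; omega
    · have hf0 := (d.sub _ hf).1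
      have hfe := (hrun.mem_right hf hfR hfq).2.1
      have key : chainStop.exec μ = ((((μ.store 44 0 1).store 41 0 (μ 41 0 + μ 43 0)).store 16
          (μ 37 0) q).store 16 (μ 38 0) p).store 37 0 (-1) := by
        simp [chainStop, show μ 43 0 * (2 * μ 41 0 + μ 43 0) < 0 by omega,
          show 0 < μ 38 0 + 1 by omega, hq, hp]
      have k16 : chainStop.exec μ 16 =
          Function.update (Function.update (μ 16) (μ 37 0) q) (μ 38 0) p := by rw [key]; simp
      refine ⟨h.frame ?_ ?_ ?_, ?_, ?_, ?_, ?_, Or.inr ⟨by omega, ?_, ?_, ?_, ?_⟩⟩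
      · rw [key]
        exact ((((h.bd.store (by simp; omega)).store hs).store (by rw [← hq]; exact h.bd _ _)).store
          (by rw [← hp]; exact h.bd _ _)).store (by simp; omega)
      · rw [key]; rintro a (rfl | rfl | rfl | rfl | rfl) <;> simp
      · intro g hg
        rw [k16, Function.update_of_ne (by rintro rfl; exact hg hf),
          Function.update_of_ne (by rintro rfl; exact hg he)]
        exact h.col g hg
      · intro a a1 a2 a3 a4; rw [key]; simp [a1, a2, a3, a4]
      · rw [key]; simp
      · rw [key]; simp
      · rw [k16]
        by_cases hno : ∀ g ∈ A, L g = L (μ 38 0) → Function.update (μ 16) (μ 37 0) q g ≠ p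
        · exact Or.inr (hrun.finish hf hfR hfq hno)
        · push Not at hno
          obtain ⟨e', a1, a2, a3⟩ := hno
          exact Or.inl ⟨e', hrun.next hf hfR hfq a1 a2 a3⟩
      · rw [key]; simp
      · rw [k16, classValue_update hrun.ne he hrun.cur hf hfq hfe]
      · rw [k16]; simp [hfe.symm]
      · intro _; rw [k16]; simp
  · have key : chainStop.exec μ = (μ.store 44 0 1).store 37 0 (-1) := by
      simp only [chainStop, exec_seq, exec_assign, exec_cond, exec_skip, eval_sub, eval_mul,
        eval_add, eval_var, eval_zero, eval_one, eval_const, Mem.store_apply, Nat.reduceEqDiff,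
        if_false,
        eval_two, hδ]
    refine ⟨h.frame ?_ ?_ ?_, ?_, ?_, ?_, ?_, Or.inl ⟨by omega, ?_, ?_⟩⟩
    · rw [key]; exact (h.bd.store (by simp; omega)).store (by simp; omega)
    · rw [key]; rintro a (rfl | rfl | rfl | rfl | rfl) <;> simp
    · rw [key]; simpa using h.col
    · intro a a1 a2 a3 a4; rw [key]; simp [a2, a4]
    · rw [key]; simp
    · rw [key]; simp
    · rw [key]; exact Or.inl ⟨_, by simpa using hrun⟩
    · rw [key]; simp
    · rw [key]; simp

/-- The result of an interrupted chain: the balance is at most half the value of an edge, times `k`,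
and that edge lies on the heavy side. -/
structure Stopped (k : ℤ) (A : Finset ℤ) (w L R χ : ℤ → ℤ) (p q : ℤ) (col₀ : ℤ → ℤ) (l₀ σ : ℤ)
    (μ : Mem) : Prop where
  done : μ 44 0 = 1
  ne : σ ≠ 0
  state : (∃ e, ChainRun A L R χ p q col₀ l₀ (μ 16) e) ∨ ChainEnd A L R χ p q col₀ l₀ (μ 16)
  value : ∃ y ∈ A, 2 * |μ 41 0| ≤ k * w y ∧ (0 < σ * μ 41 0 → μ 16 y = q) ∧
    (σ * μ 41 0 < 0 → μ 16 y = p)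

theorem does_chainBody (d : Data N B mm k A w) (h : Holds B mm k A w L R μ)
    (hrun : ChainRun A L R χ p q col₀ l₀ (μ 16) (μ 37 0)) (hp : μ 39 0 = p) (hq : μ 40 0 = q)
    {σ : ℤ} (hσ : μ 42 0 = σ) (hσ1 : σ = 0 ∨ σ = 1 ∨ σ = -1) (hσ0 : σ = 0 → μ 41 0 ≠ 0)
    (hs : |μ 41 0| ≤ 6 * ∑ g ∈ A, w g + 1) :
    Does N B chainBody μ fun μ' => Holds B mm k A w L R μ' ∧
      (∀ a, a ≠ 16 → a ≠ 33 → a ≠ 34 → a ≠ 35 → a ≠ 36 → a ≠ 37 → a ≠ 38 → a ≠ 41 → a ≠ 43 →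
        a ≠ 44 → μ' a = μ a) ∧
      μ' 41 0 = μ 41 0 + σ * k * (classValue A w (μ' 16) q - classValue A w (μ 16) q) ∧
      ((μ' 44 = μ 44 ∧ (μ' 41 0).sign = (μ 41 0).sign ∧
        ((ChainRun A L R χ p q col₀ l₀ (μ' 16) (μ' 37 0) ∧
          (A.filter fun g => χ g = p ∧ μ' 16 g = p).card <
            (A.filter fun g => χ g = p ∧ μ 16 g = p).card) ∨
        (μ' 37 0 = -1 ∧ ChainEnd A L R χ p q col₀ l₀ (μ' 16)))) ∨
      (μ' 37 0 = -1 ∧ Stopped k A w L R χ p q col₀ l₀ σ μ')) := by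
  have hB := d.sum_le
  have hk2 := d.k_two
  have hk3 := d.k_three
  have := d.mm_three
  have he := hrun.mem
  refine Does.line_seq (by simp) h.bd (Does.seq ?_)
  refine (does_find_mem (μ := (assign 34 (read 15 (var 37)) ;; assign 35 (var 40)).exec μ) d
    (h.frame ((h.bd.store (by simpa using h.bd _ _)).store (by simpa using h.bd _ _))
    (by rintro a (rfl | rfl | rfl | rfl | rfl) <;> simp) (by simpa using h.col))
    (by decide) (by decide) (by simp [hq, hrun.hq])).imp ?_
  rintro μ₁ ⟨h₁, f₁, c₁⟩
  have f₁' : ∀ a, a ≠ 33 → a ≠ 34 → a ≠ 35 → a ≠ 36 → μ₁ a = μ a := by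
    intro a a1 a2 a3 a4
    rw [f₁ a a1 a4]; simp [a2, a3]
  simp only [exec_seq, exec_assign, eval_var, eval_read, Mem.store_apply, Function.update_self,
    Nat.reduceEqDiff, if_true, if_false, h.R, hq] at c₁
  refine Does.line_seq (by simp) h₁.bd ?_
  obtain ⟨μ₂, e₂⟩ : ∃ μ₂, μ₂ = (assign 38 (var 36) ;;
    assign 43 (var 42 * var 31 * (read 12 (var 37) - read 12 (var 38)))).exec μ₁ := ⟨_, rfl⟩
  rw [← e₂]
  have f₂ : ∀ a, a ≠ 33 → a ≠ 34 → a ≠ 35 → a ≠ 36 → a ≠ 38 → a ≠ 43 → μ₂ a = μ a := by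
    intro a a1 a2 a3 a4 a5 a6
    rw [e₂]; simp [a5, a6, f₁' a a1 a2 a3 a4]
  have g₂ : μ₂ 38 0 = μ₁ 36 0 := by rw [e₂]; simp
  have hpar : IsPartner A R q μ₂ := by
    unfold IsPartner
    rw [g₂, f₂ 37 (by decide) (by decide) (by decide) (by decide) (by decide) (by decide),
      f₂ 16 (by decide) (by decide) (by decide) (by decide) (by decide) (by decide)]
    exact c₁
  have hfA : μ₁ 36 0 ∈ A ∨ μ₁ 36 0 = -1 := by
    rcases c₁ with c₁ | c₁
    exacts [Or.inr c₁.1, Or.inl c₁.1]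
  have δ₂ : μ₂ 43 0 = σ * k * (w (μ 37 0) - w (μ₁ 36 0)) := by
    rw [e₂]; simp [f₁', hσ, h.k, h.w]
  have w1 := d.w_le (Or.inl he)
  have w2 := d.w_le hfA
  have w3 := d.w_nonneg (μ 37 0)
  have w4 := d.w_nonneg (μ₁ 36 0)
  have hδ : |μ₂ 43 0| ≤ 3 * ∑ g ∈ A, w g := by
    rw [δ₂, abs_mul, abs_mul]
    have a1 : |σ| ≤ 1 := by rcases hσ1 with rfl | rfl | rfl <;> simp
    have a2 : |k| ≤ 3 := abs_le.2 (by omega)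
    have a3 : |w (μ 37 0) - w (μ₁ 36 0)| ≤ ∑ g ∈ A, w g := abs_le.2 (by omega)
    calc _ ≤ 1 * 3 * ∑ g ∈ A, w g := by
          apply mul_le_mul (mul_le_mul a1 a2 (abs_nonneg _) (by norm_num)) a3 (abs_nonneg _)
            (by norm_num)
      _ = _ := by ring
  have h₂ : Holds B mm k A w L R μ₂ := by
    refine h₁.frame ?_ ?_ ?_
    · rw [e₂] at hδ ⊢
      refine (h₁.bd.store (by simpa using h₁.bd _ _)).store ?_
      simp only [exec_seq, exec_assign] at hδ ⊢
      rw [Mem.store_apply, if_pos rfl, Function.update_self] at hδ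
      omega
    · rw [e₂]; rintro a (rfl | rfl | rfl | rfl | rfl) <;> simp
    · rw [e₂]; simpa using h₁.col
  have t41 := f₂ 41 (by decide) (by decide) (by decide) (by decide) (by decide) (by decide)
  have t37 := f₂ 37 (by decide) (by decide) (by decide) (by decide) (by decide) (by decide)
  have t16 := f₂ 16 (by decide) (by decide) (by decide) (by decide) (by decide) (by decide)
  have hrun₂ : ChainRun A L R χ p q col₀ l₀ (μ₂ 16) (μ₂ 37 0) := by rwa [t16, t37]
  have hp₂ : μ₂ 39 0 = p := by rw [f₂] <;> first | exact hp | decide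
  have hq₂ : μ₂ 40 0 = q := by rw [f₂] <;> first | exact hq | decide
  have hs₂ : |μ₂ 41 0 + μ₂ 43 0| ≤ B := by
    rw [t41]
    exact (abs_add_le _ _).trans (by omega)
  have k0 : 0 < k := by omega
  clear e₂
  refine Does.cond h₂.bd ?_ ?_
  · intro hpos
    simp only [eval_mul, eval_add, eval_var] at hpos
    refine (does_chainStep d h₂ hrun₂ hp₂ hq₂ hpar hs₂).imp ?_
    rintro μ₃ ⟨h₃, f₃, s₃, v₃, r₃⟩
    refine ⟨h₃, ?_, ?_, Or.inl ⟨?_, ?_, ?_⟩⟩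
    · intro a a1 a2 a3 a4 a5 a6 a7 a8 a9 a10
      rw [f₃ a a1 a2 a3 a4 a5 a6 a8, f₂ a a2 a3 a4 a5 a7 a9]
    · rw [s₃, v₃, δ₂, t41, t16, t37, g₂]; ring
    · rw [f₃, f₂] <;> decide
    · rw [s₃]
      rw [t41] at hpos ⊢
      rcases lt_trichotomy (μ 41 0) 0 with hlt | heq | hlt
      · rw [Int.sign_eq_neg_one_of_neg hlt, Int.sign_eq_neg_one_of_neg (by nlinarith)]
      · rw [heq] at hpos; simp at hpos
      · rw [Int.sign_eq_one_of_pos hlt, Int.sign_eq_one_of_pos (by nlinarith)]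
    · rwa [t16] at r₃
  · intro hneg
    simp only [eval_mul, eval_add, eval_var, not_lt] at hneg
    rw [t41, δ₂] at hneg
    have hσne : σ ≠ 0 := by
      rintro rfl
      simp only [zero_mul, add_zero] at hneg
      exact hσ0 rfl (mul_self_eq_zero.1 (le_antisymm hneg (mul_self_nonneg _)))
    have hσσ : σ * σ = 1 := by rcases hσ1 with rfl | rfl | rfl <;> simp at hσne ⊢
    have habs : ∀ x, |σ * x| = |x| := by
      intro x; rcases hσ1 with rfl | rfl | rfl <;> simp at hσne ⊢
    refine (does_chainStop d h₂ hrun₂ hp₂ hq₂ hpar hs₂).imp ?_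
    rintro μ₃ ⟨h₃, f₃, e₃, d₃, st₃, r₃⟩
    refine ⟨h₃, ?_, ?_, Or.inr ⟨e₃, d₃, hσne, st₃, ?_⟩⟩
    · intro a a1 a2 a3 a4 a5 a6 a7 a8 a9 a10
      rw [f₃ a a1 a6 a8 a10, f₂ a a2 a3 a4 a5 a7 a9]
    · rcases r₃ with ⟨-, r1, r2⟩ | ⟨-, r1, r2, -⟩
      · rw [r1, r2, t41, t16]; ring
      · rw [r1, r2, δ₂, t41, t16, t37, g₂]; ring
    · rw [t41, t37, t16, g₂, δ₂] at r₃
      -- in terms of `u = σ * s` the edge `e` counts positively and `f` negatively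
      have hneg' : σ * μ 41 0 * (σ * μ 41 0 + k * (w (μ 37 0) - w (μ₁ 36 0))) ≤ 0 := by
        calc _ = σ * σ * (μ 41 0 * μ 41 0) + μ 41 0 * (σ * k * (w (μ 37 0) - w (μ₁ 36 0))) := by
              ring
          _ = μ 41 0 * (μ 41 0 + σ * k * (w (μ 37 0) - w (μ₁ 36 0))) := by rw [hσσ]; ring
          _ ≤ 0 := hneg
      have hδ' : σ * k * (w (μ 37 0) - w (μ₁ 36 0)) *
          (2 * μ 41 0 + σ * k * (w (μ 37 0) - w (μ₁ 36 0))) =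
          k * (w (μ 37 0) - w (μ₁ 36 0)) *
            (2 * (σ * μ 41 0) + k * (w (μ 37 0) - w (μ₁ 36 0))) := by
        calc _ = σ * k * (w (μ 37 0) - w (μ₁ 36 0)) * (2 * μ 41 0) +
              σ * σ * (k * (w (μ 37 0) - w (μ₁ 36 0)) * (k * (w (μ 37 0) - w (μ₁ 36 0)))) := by ring
          _ = _ := by rw [hσσ]; ring
      rw [hδ'] at r₃
      have hfpos : 0 < w (μ₁ 36 0) → μ₁ 36 0 ∈ A := by
        intro hw
        rcases hfA with hfA | hfA
        · exact hfA
        · rw [hfA, d.w_neg] at hw; exact absurd hw (lt_irrefl _)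
      have hfq : μ₁ 36 0 ∈ A → μ 16 (μ₁ 36 0) = q := by
        intro hfA'
        rcases c₁ with ⟨c₁, -⟩ | ⟨-, -, c₁⟩
        · rw [c₁] at hfA'; have := (d.sub _ hfA').1; omega
        · exact c₁
      rcases r₃ with ⟨r0, r1, r2⟩ | ⟨r0, r1, -, r3, r4⟩
      · obtain ⟨b1, b2⟩ := balance_before k0 w3 w4 hneg' r0
        rw [habs] at b1 b2
        rw [r1, r2]
        rcases le_or_gt (σ * μ 41 0) 0 with hu | hu
        · exact ⟨_, he, b2 hu, fun hu' => absurd hu' hu.not_gt, fun _ => hrun.cur⟩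
        · have := hfpos (b1 hu).2
          exact ⟨_, this, (b1 hu).1, fun _ => hfq this, fun hu' => absurd hu' hu.not_gt⟩
      · -- seen backwards, the exchange is one with `e` and `f` in each other's place
        have hu' : σ * (μ 41 0 + σ * k * (w (μ 37 0) - w (μ₁ 36 0))) =
            σ * μ 41 0 + k * (w (μ 37 0) - w (μ₁ 36 0)) := by
          calc _ = σ * μ 41 0 + σ * σ * (k * (w (μ 37 0) - w (μ₁ 36 0))) := by ring
            _ = _ := by rw [hσσ, one_mul]
        obtain ⟨b1, b2⟩ := balance_before (u := σ * μ 41 0 + k * (w (μ 37 0) - w (μ₁ 36 0))) k0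
          w4 w3 (by linarith) (by linarith)
        rw [← hu', habs, ← r1] at b1 b2
        rcases lt_or_ge 0 (σ * μ₃ 41 0) with hu | hu
        · exact ⟨_, he, (b1 hu).1, fun _ => r3, fun h => absurd h hu.not_gt⟩
        · rcases hu.eq_or_lt with hu0 | hu0
          · refine ⟨_, he, ?_, fun h => absurd h hu.not_gt, fun h => absurd hu0 h.ne⟩
            have : μ₃ 41 0 = 0 := by
              rcases mul_eq_zero.1 hu0 with h | h
              · exact absurd h hσne
              · exact h
            rw [this]; simp; exact mul_nonneg k0.le w3
          · have h1 := b2 hu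
            have : 0 < w (μ₁ 36 0) := by
              by_contra hc
              have h2 : w (μ₁ 36 0) = 0 := by omega
              rw [h2, mul_zero] at h1
              have h3 : μ₃ 41 0 = 0 := abs_eq_zero.1 (by have := abs_nonneg (μ₃ 41 0); omega)
              rw [h3] at hu0; simp at hu0
            exact ⟨_, hfpos this, h1, fun h => absurd h hu.not_gt, fun _ => r4 (hfpos this)⟩

end Chain

end FairDivision

/-! ### A proper edge colouring -/

namespace FairDivision

open RAM Expr Prog

/-- Only the arrays in `S` differ. -/
def Frame (S : Finset ℕ) (μ μ' : Mem) : Prop := ∀ a, a ∉ S → μ' a = μ a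

theorem Frame.get {S : Finset ℕ} {μ μ' : Mem} (h : Frame S μ μ') (a : ℕ)
    (ha : a ∉ S := by decide) : μ' a = μ a := h a ha

theorem Frame.refl (S : Finset ℕ) (μ : Mem) : Frame S μ μ := fun _ _ => rfl

theorem Frame.trans {S T U : Finset ℕ} {μ μ' μ'' : Mem} (h : Frame S μ μ') (h' : Frame T μ' μ'')
    (hS : S ⊆ U := by decide) (hT : T ⊆ U := by decide) : Frame U μ μ'' :=
  fun a ha => (h' a fun h => ha (hT h)).trans (h a fun h => ha (hS h))

theorem Frame.mono {S U : Finset ℕ} {μ μ' : Mem} (h : Frame S μ μ') (hS : S ⊆ U := by decide) :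
    Frame U μ μ' := fun a ha => h a fun h => ha (hS h)

theorem line_then {N : ℕ} {B : ℤ} {P P' : Prog} {μ : Mem} {Q : Mem → Prop} (hP : P.LoopFree)
    (hB : Bd B μ) (h : ∀ μ₁, P.exec μ = μ₁ → Does N B P' μ₁ Q) : Does N B (P ;; P') μ Q :=
  Does.line_seq hP hB (h _ rfl)

/-- The arrays that `chainProg` changes. -/
def chainVars : Finset ℕ := {16, 33, 34, 35, 36, 37, 38, 41, 43, 44}

section Chain

variable {N : ℕ} {B mm k : ℤ} {A : Finset ℤ} {w L R χ : ℤ → ℤ} {μ : Mem} {p q : ℤ} {col₀ : ℤ → ℤ}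
  {l₀ : ℤ}

theorem Holds.of_frame {S : Finset ℕ} {μ' : Mem} (h : Holds B mm k A w L R μ) (bd : Bd B μ')
    (hf : Frame S μ μ') (col : ∀ g, g ∉ A → μ' 16 g = 0)
    (hS : 12 ∉ S ∧ 14 ∉ S ∧ 15 ∉ S ∧ 30 ∉ S ∧ 31 ∉ S := by decide) : Holds B mm k A w L R μ' :=
  h.frame bd (by rintro a (rfl | rfl | rfl | rfl | rfl) <;> exact hf _ (by tauto)) col

theorem Data.card_le (d : Data N B mm k A w) : (A.card : ℤ) ≤ mm := by
  have h1 : A ⊆ Finset.Ico 0 mm := fun g hg => Finset.mem_Ico.2 (d.sub g hg)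
  have h2 := Finset.card_le_card h1
  have h3 := d.mm_three
  rw [Int.card_Ico] at h2
  omega

theorem does_chain (d : Data N B mm k A w) (h : Holds B mm k A w L R μ)
    (hrun : ChainRun A L R χ p q col₀ l₀ (μ 16) (μ 37 0)) (hp : μ 39 0 = p) (hq : μ 40 0 = q)
    {σ : ℤ} (hσ : μ 42 0 = σ) (hσ1 : σ = 0 ∨ σ = 1 ∨ σ = -1) (hσ0 : σ = 0 → μ 41 0 ≠ 0)
    (hs : |μ 41 0| ≤ 3 * ∑ g ∈ A, w g + 1) :
    Does N B chainProg μ fun μ' => Holds B mm k A w L R μ' ∧ Frame chainVars μ μ' ∧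
      μ' 41 0 = μ 41 0 + σ * k * (classValue A w (μ' 16) q - classValue A w (μ 16) q) ∧
      ((μ' 44 = μ 44 ∧ (μ' 41 0).sign = (μ 41 0).sign ∧
        ChainEnd A L R χ p q col₀ l₀ (μ' 16)) ∨ Stopped k A w L R χ p q col₀ l₀ σ μ') := by
  have hk2 := d.k_two
  have hk3 := d.k_three
  have hcard : ∀ μ' : Mem,
      ((A.filter fun g => χ g = p ∧ μ' 16 g = p).card : ℤ) ≤ mm := fun μ' =>
    le_trans (by exact_mod_cast Finset.card_filter_le _ _) d.card_le
  have hN := d.N_le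
  have h0 := hcard μ
  refine (Does.loop (fun n μ' => Holds B mm k A w L R μ' ∧ Frame chainVars μ μ' ∧
      μ' 41 0 = μ 41 0 + σ * k * (classValue A w (μ' 16) q - classValue A w (μ 16) q) ∧
      ((μ' 44 = μ 44 ∧ (μ' 41 0).sign = (μ 41 0).sign ∧
        ((ChainRun A L R χ p q col₀ l₀ (μ' 16) (μ' 37 0) ∧
          n = (A.filter fun g => χ g = p ∧ μ' 16 g = p).card + 1) ∨
          (n = 0 ∧ μ' 37 0 = -1 ∧ ChainEnd A L R χ p q col₀ l₀ (μ' 16)))) ∨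
        (n = 0 ∧ μ' 37 0 = -1 ∧ Stopped k A w L R χ p q col₀ l₀ σ μ')))
    (fun n μ' hI => hI.1.bd) ?_
    ⟨h, Frame.refl _ _, by simp, Or.inl ⟨rfl, rfl, Or.inl ⟨hrun, rfl⟩⟩⟩ (by omega)).imp ?_
  · rintro n μ₁ ⟨h₁, f₁, s₁, r₁⟩ he
    simp only [eval_add, eval_var, eval_one] at he
    obtain ⟨t₁, g₁, hrun₁, hn⟩ : μ₁ 44 = μ 44 ∧ (μ₁ 41 0).sign = (μ 41 0).sign ∧
        ChainRun A L R χ p q col₀ l₀ (μ₁ 16) (μ₁ 37 0) ∧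
          n = (A.filter fun g => χ g = p ∧ μ₁ 16 g = p).card + 1 := by
      rcases r₁ with ⟨t₁, g₁, ⟨hr, hn⟩ | ⟨-, hr, -⟩⟩ | ⟨-, hr, -⟩
      · exact ⟨t₁, g₁, hr, hn⟩
      · omega
      · omega
    have hσk : |σ * k * (classValue A w (μ₁ 16) q - classValue A w (μ 16) q)| ≤
        3 * ∑ g ∈ A, w g := by
      have c1 := d.classValue_nonneg (μ₁ 16) q
      have c2 := d.classValue_nonneg (μ 16) q
      have c3 := d.classValue_le (μ₁ 16) q
      have c4 := d.classValue_le (μ 16) q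
      rw [abs_mul, abs_mul]
      have a1 : |σ| ≤ 1 := by rcases hσ1 with rfl | rfl | rfl <;> simp
      have a2 : |k| ≤ 3 := abs_le.2 (by omega)
      have a3 : |classValue A w (μ₁ 16) q - classValue A w (μ 16) q| ≤ ∑ g ∈ A, w g :=
        abs_le.2 (by omega)
      calc _ ≤ 1 * 3 * ∑ g ∈ A, w g :=
            mul_le_mul (mul_le_mul a1 a2 (abs_nonneg _) (by norm_num)) a3 (abs_nonneg _)
              (by norm_num)
        _ = _ := by ring
    refine (does_chainBody d h₁ hrun₁ (by rw [f₁.get 39, hp]) (by rw [f₁.get 40, hq])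
      (by rw [f₁.get 42, hσ]) hσ1 ?_ ?_).imp ?_
    · rintro rfl
      rw [s₁]; simpa using hσ0 rfl
    · rw [s₁]; exact (abs_add_le _ _).trans (by omega)
    · rintro μ₂ ⟨h₂, f₂, s₂, r₂⟩
      have f₂' : Frame chainVars μ₁ μ₂ := by
        intro a ha
        simp only [chainVars, Finset.mem_insert, Finset.mem_singleton, not_or] at ha
        obtain ⟨a1, a2, a3, a4, a5, a6, a7, a8, a9, a10⟩ := ha
        exact f₂ a a1 a2 a3 a4 a5 a6 a7 a8 a9 a10
      have s₂' : μ₂ 41 0 =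
          μ 41 0 + σ * k * (classValue A w (μ₂ 16) q - classValue A w (μ 16) q) := by
        rw [s₂, s₁]; ring
      rcases r₂ with ⟨t₂, g₂, ⟨r₂, r₃⟩ | ⟨r₂, r₃⟩⟩ | ⟨r₂, r₃⟩
      · exact ⟨_, by omega, h₂, f₁.trans f₂', s₂',
          Or.inl ⟨t₂.trans t₁, g₂.trans g₁, Or.inl ⟨r₂, rfl⟩⟩⟩
      · exact ⟨0, by omega, h₂, f₁.trans f₂', s₂',
          Or.inl ⟨t₂.trans t₁, g₂.trans g₁, Or.inr ⟨rfl, r₂, r₃⟩⟩⟩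
      · exact ⟨0, by omega, h₂, f₁.trans f₂', s₂', Or.inr ⟨rfl, r₂, r₃⟩⟩
  · rintro μ₁ ⟨⟨n, h₁, f₁, s₁, r₁⟩, he⟩
    simp only [eval_add, eval_var, eval_one] at he
    refine ⟨h₁, f₁, s₁, ?_⟩
    rcases r₁ with ⟨t₁, g₁, ⟨hr, hn⟩ | ⟨-, -, hr⟩⟩ | ⟨-, -, hr⟩
    · have := (d.sub _ hr.mem).1; omega
    · exact Or.inl ⟨t₁, g₁, hr⟩
    · exact Or.inr hr

end Chain

theorem Proper.update {A : Finset ℤ} {L χ : ℤ → ℤ} {g p : ℤ} (h : Proper A L χ)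
    (hp : ∀ h ∈ A, L h = L g → h ≠ g → χ h ≠ p) : Proper A L (Function.update χ g p) := by
  intro a ha b hb
  have h1 := h a ha b hb
  have h2 := hp a ha
  have h3 := hp b hb
  simp only [Function.update_apply]
  grind

theorem Proper.base {A : Finset ℤ} {L R χ : ℤ → ℤ} {p q : ℤ} (hL : Proper A L χ)
    (hR : Proper A R χ) (ne : p ≠ q) (hp : p ≠ 0) (hq : q ≠ 0) :
    ChainBase A L R χ p q χ χ :=
  ⟨hL, hR, ne, hp, hq, fun _ => Or.inl rfl, fun _ h => h, hR,
    fun _ _ h _ h' => absurd (h'.symm.trans h) ne⟩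

theorem ChainEnd.proper {A : Finset ℤ} {L R χ col₀ col : ℤ → ℤ} {p q l₀ : ℤ}
    (h : ChainEnd A L R χ p q col₀ l₀ col) (hq : ∀ h ∈ A, L h = l₀ → χ h ≠ q) :
    Proper A L col := by
  obtain ⟨⟨hL, hR, ne, hp, hq, flip, -, right, back⟩, left, start, -⟩ := h
  intro a ha b hb
  have h1 := hL a ha b hb
  have h2 := left a ha b hb
  have h3 := start a ha
  have h4 := start b hb
  have h7 := flip a
  have h8 := flip b
  grind

/-- After the exchange, the colour `p` is free at both ends of the uncoloured edge `g`. -/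
theorem ChainEnd.insert {A : Finset ℤ} {L R χ col : ℤ → ℤ} {p q g : ℤ}
    (h : ChainEnd A L R χ p q χ (L g) col) (hqL : ∀ h ∈ A, L h = L g → χ h ≠ q)
    (hpR : ∀ h ∈ A, R h = R g → χ h ≠ p) :
    Proper A L (Function.update col g p) ∧ Proper A R (Function.update col g p) := by
  refine ⟨(h.proper hqL).update fun a ha e _ => ?_, h.right.update fun a ha e _ => ?_⟩
  · have h1 := h.start a ha
    have h2 := hqL a ha
    have h3 := h.flip a
    have h4 := h.ne
    grind
  · have h1 := hpR a ha
    have h2 := h.back a ha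
    have h3 := h.flip a
    grind

/-- Edge `g` (variable `32`) receives a colour that is missing at its right end, after that colour has
been exchanged, along a chain, for a colour that is missing at its left end. -/
def insertBody : Prog :=
  assign 34 (read 14 (var 32)) ;;
  missingProg 14 ;;
  (assign 40 (var 35) ;; assign 34 (read 15 (var 32))) ;;
  missingProg 15 ;;
  (assign 39 (var 35) ;; assign 41 1 ;; assign 42 0 ;; assign 34 (read 14 (var 32))) ;;
  findProg 14 ;;
  Prog.cond (var 36 + 1) (assign 37 (var 36) ;; chainProg) skip ;;
  set 16 (var 32) (var 39)

/-- All items of `A` are coloured one after another; array `13` marks the items of `A`. -/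
def insertProg : Prog :=
  assign 32 0 ;;
  loop (var 30 - var 32) (Prog.cond (read 13 (var 32)) insertBody skip ;; assign 32 (var 32 + 1))

/-- The arrays that `insertProg` changes. -/
def insertVars : Finset ℕ := {16, 32, 33, 34, 35, 36, 37, 38, 39, 40, 41, 42, 43, 44}

section Insert

variable {N : ℕ} {B mm k G : ℤ} {A : Finset ℤ} {w L R : ℤ → ℤ} {μ : Mem}

theorem IsGroupGraph.L_le (h : IsGroupGraph k G A L R) (z : ℤ) :
    ((A.filter fun g => L g = z).card : ℤ) ≤ k := by
  by_cases hz : 0 ≤ z ∧ z < G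
  · rcases hz.1.eq_or_lt with rfl | h0
    · rw [h.L_zero]; omega
    · rw [h.L_pos z h0 hz.2]
  · rw [Finset.filter_eq_empty_iff.2]
    · have := h.two_le; simp; omega
    · rintro g hg rfl; exact hz (h.L_mem g hg)

theorem exists_missing_end {L : ℤ → ℤ} (hL : ∀ z, ((A.filter fun g => L g = z).card : ℤ) ≤ k)
    {g : ℤ} (hg : g ∈ A) {col : ℤ → ℤ} (hc : col g = 0) :
    ∃ c, 1 ≤ c ∧ c ≤ k ∧ ∀ h ∈ A, L h = L g → col h ≠ c := by
  have hgm : g ∈ A.filter fun h => L h = L g := Finset.mem_filter.2 ⟨hg, rfl⟩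
  obtain ⟨c, h1, h2, h3⟩ := exists_missing_colour (T := (A.filter fun h => L h = L g).erase g)
    (col := col) (k := k) (by
      have := hL (L g)
      have h2 := Finset.card_pos.2 ⟨g, hgm⟩
      rw [Finset.card_erase_of_mem hgm]
      omega)
  refine ⟨c, h1, h2, fun h hh e => ?_⟩
  by_cases hgh : h = g
  · subst hgh; omega
  · exact h3 h (Finset.mem_erase.2 ⟨hgh, Finset.mem_filter.2 ⟨hh, e⟩⟩)

theorem does_insertBody (d : Data N B mm k A w) (hG : IsGroupGraph k G A L R)
    (h : Holds B mm k A w L R μ) {g : ℤ} (hg : g ∈ A) (h32 : μ 32 0 = g) (hg0 : μ 16 g = 0)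
    (hL : Proper A L (μ 16)) (hR : Proper A R (μ 16)) :
    Does N B insertBody μ fun μ' => Holds B mm k A w L R μ' ∧
      Frame (insertVars.erase 32) μ μ' ∧ Proper A L (μ' 16) ∧ Proper A R (μ' 16) ∧
      1 ≤ μ' 16 g ∧ μ' 16 g ≤ k ∧ ∀ h, h ≠ g → (μ 16 h = 0 → μ' 16 h = 0) ∧
        (1 ≤ μ 16 h ∧ μ 16 h ≤ k → 1 ≤ μ' 16 h ∧ μ' 16 h ≤ k) := by
  have hk2 := d.k_two
  have hsum := d.sum_le
  have hsum0 := d.sum_nonneg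
  have hmm := d.mm_three
  refine Does.line_seq (by simp) h.bd (Does.seq ?_)
  refine (does_missing (μ := (assign 34 (read 14 (var 32))).exec μ) d
    (h.of_frame (S := {34}) (h.bd.store (by simpa using h.bd _ _))
      (fun a ha => by simp at ha; simp [ha]) (by simpa using h.col))
    (by decide) (by decide) (by decide)
    (by simpa [h32, h.L] using exists_missing_end hG.L_le hg hg0)).imp ?_
  rintro μ₁ ⟨h₁, f₁, q1, q2, q3⟩
  have F₁ : Frame {33, 34, 35, 36} μ μ₁ := fun a ha => by
    simp at ha; rw [f₁ a ha.1 ha.2.2.1 ha.2.2.2]; simp [ha]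
  obtain ⟨q, hq⟩ : ∃ q, q = μ₁ 35 0 := ⟨_, rfl⟩
  rw [← hq] at q1 q2 q3
  simp [h32, h.L] at q3
  refine Does.line_seq (by simp) h₁.bd (Does.seq ?_)
  have e34 : (assign 40 (var 35) ;; assign 34 (read 15 (var 32))).exec μ₁ 34 0 = R g := by
    simp [F₁.get 32, h32, h₁.R]
  have e15 : (assign 40 (var 35) ;; assign 34 (read 15 (var 32))).exec μ₁ 15 = R := by
    simp [h₁.R]
  have e16 : (assign 40 (var 35) ;; assign 34 (read 15 (var 32))).exec μ₁ 16 = μ 16 := by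
    simp [F₁.get 16]
  refine (does_missing (μ := (assign 40 (var 35) ;; assign 34 (read 15 (var 32))).exec μ₁) d
    (h₁.of_frame (S := {34, 40})
      ((h₁.bd.store (by simpa using h₁.bd _ _)).store (by simpa using h₁.bd _ _))
      (fun a ha => by simp at ha; simp [ha]) (by simpa using h₁.col))
    (by decide) (by decide) (by decide)
    (by rw [e34, e15, e16]; exact exists_missing_end hG.R_le hg hg0)).imp ?_
  rintro μ₂ ⟨h₂, f₂, p1, p2, p3⟩
  rw [e34, e15, e16] at p3
  have F₂ : Frame {33, 34, 35, 36, 40} μ μ₂ := fun a ha => by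
    simp at ha; rw [f₂ a ha.1 ha.2.2.1 ha.2.2.2.1]; simp [ha]; exact F₁ a (by simp [ha])
  have q₂ : μ₂ 40 0 = q := by
    rw [f₂ 40 (by decide) (by decide) (by decide)]; simp [hq]
  obtain ⟨p, hp⟩ : ∃ p, p = μ₂ 35 0 := ⟨_, rfl⟩
  rw [← hp] at p1 p2 p3
  refine Does.line_seq (by simp) h₂.bd ?_
  obtain ⟨μ₃, e₃⟩ : ∃ μ₃, μ₃ = (assign 39 (var 35) ;; assign 41 1 ;; assign 42 0 ;;
    assign 34 (read 14 (var 32))).exec μ₂ := ⟨_, rfl⟩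
  rw [← e₃]
  have F₃ : Frame {33, 34, 35, 36, 39, 40, 41, 42} μ μ₃ := fun a ha => by
    simp at ha; rw [e₃]; simp [ha]; exact F₂ a (by simp [ha])
  have b₃ : Bd B μ₃ := by
    rw [e₃]
    exact (((h₂.bd.store (by simpa using h₂.bd _ _)).store (by simp; omega)).store
      (by simp; omega)).store (by simpa using h₂.bd _ _)
  have h₃ : Holds B mm k A w L R μ₃ := h.of_frame b₃ F₃ (by rw [F₃.get 16]; exact h.col)
  have c35 : μ₃ 35 0 = p := by rw [e₃]; simp [hp]
  have c34 : μ₃ 34 0 = L g := by rw [e₃]; simp [F₂.get 32, h32, h₂.L]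
  have c39 : μ₃ 39 0 = p := by rw [e₃]; simp [hp]
  have c40 : μ₃ 40 0 = q := by rw [e₃]; simp [q₂]
  have c41 : μ₃ 41 0 = 1 := by rw [e₃]; simp
  have c42 : μ₃ 42 0 = 0 := by rw [e₃]; simp
  clear e₃
  refine Does.seq ?_
  refine (does_find_mem (side := 14) d h₃ (by decide) (by decide) (by omega)).imp ?_
  rintro μ₄ ⟨h₄, f₄, r₄⟩
  rw [h₃.L, c34, c35, F₃.get 16] at r₄
  have F₄ : Frame {33, 34, 35, 36, 39, 40, 41, 42} μ μ₄ := fun a ha => by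
    rw [f₄ a (by rintro rfl; simp at ha) (by rintro rfl; simp at ha)]; exact F₃ a ha
  have d39 : μ₄ 39 0 = p := by rw [f₄ _ (by decide) (by decide), c39]
  have d40 : μ₄ 40 0 = q := by rw [f₄ _ (by decide) (by decide), c40]
  have d41 : μ₄ 41 0 = 1 := by rw [f₄ _ (by decide) (by decide), c41]
  have d42 : μ₄ 42 0 = 0 := by rw [f₄ _ (by decide) (by decide), c42]
  refine Does.seq ?_
  -- the last assignment, from any proper colouring in which `p` is free at `g`
  have last : ∀ μ₅, Holds B mm k A w L R μ₅ → Frame (insertVars.erase 32) μ μ₅ → μ₅ 39 0 = p →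
      Proper A L (Function.update (μ₅ 16) g p) → Proper A R (Function.update (μ₅ 16) g p) →
      (∀ h, μ₅ 16 h = μ 16 h ∨ (μ 16 h = p ∧ μ₅ 16 h = q) ∨ (μ 16 h = q ∧ μ₅ 16 h = p)) →
      Does N B (set 16 (var 32) (var 39)) μ₅ fun μ' => Holds B mm k A w L R μ' ∧
        Frame (insertVars.erase 32) μ μ' ∧ Proper A L (μ' 16) ∧ Proper A R (μ' 16) ∧
        1 ≤ μ' 16 g ∧ μ' 16 g ≤ k ∧ ∀ h, h ≠ g → (μ 16 h = 0 → μ' 16 h = 0) ∧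
          (1 ≤ μ 16 h ∧ μ 16 h ≤ k → 1 ≤ μ' 16 h ∧ μ' 16 h ≤ k) := by
    intro μ₅ h₅ F₅ p₅ L₅ R₅ c₅
    refine Does.line (by simp) h₅.bd ?_
    have e16 : (set 16 (var 32) (var 39)).exec μ₅ 16 = Function.update (μ₅ 16) g p := by
      simp [F₅.get 32, h32, p₅]
    have F₆ : Frame (insertVars.erase 32) μ ((set 16 (var 32) (var 39)).exec μ₅) := fun a ha => by
      have : a ≠ 16 := by rintro rfl; exact ha (by decide)
      simp [this, F₅ a ha]
    refine ⟨h₅.of_frame (S := {16}) (h₅.bd.store (by simpa using h₅.bd _ _))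
      (fun a ha => by simp at ha; simp [ha]) ?_, F₆, ?_⟩
    · intro x hx
      rw [e16, Function.update_of_ne (by rintro rfl; exact hx hg)]
      exact h₅.col x hx
    · rw [e16]
      refine ⟨L₅, R₅, by simpa using p1, by simpa using p2, fun h hne => ?_⟩
      have := c₅ h
      rw [Function.update_of_ne hne]
      omega
  refine Does.cond h₄.bd ?_ ?_
  · intro he
    simp only [eval_add, eval_var, eval_one] at he
    obtain ⟨r1, r2, r3⟩ : μ₄ 36 0 ∈ A ∧ L (μ₄ 36 0) = L g ∧ μ 16 (μ₄ 36 0) = p := by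
      rcases r₄ with r | r
      · omega
      · exact r
    have ne : p ≠ q := by rintro rfl; exact q3 _ r1 r2 r3
    refine Does.line_seq (by simp) h₄.bd ?_
    have hrun : ChainRun A L R (μ 16) p q (μ 16) (L g) (μ 16) (μ₄ 36 0) := by
      rw [← r2]; exact (hL.base hR ne (by omega) (by omega)).run hL r1 r3 r3
    refine (does_chain (μ := (assign 37 (var 36)).exec μ₄) (σ := 0) (χ := μ 16) (p := p) (q := q)
      (col₀ := μ 16) (l₀ := L g) d
      (h₄.of_frame (S := {37}) (h₄.bd.store (by simpa using h₄.bd _ _))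
        (fun a ha => by simp at ha; simp [ha]) (by simpa using h₄.col))
      (by simpa [F₄.get 16] using hrun) (by simpa using d39) (by simpa using d40)
      (by simpa using d42) (Or.inl rfl) (by simp [d41]) (by simp [d41]; omega)).imp ?_
    rintro μ₅ ⟨h₅, F₅, -, r₅⟩
    have hend : ChainEnd A L R (μ 16) p q (μ 16) (L g) (μ₅ 16) := by
      rcases r₅ with ⟨-, -, r₅⟩ | r₅
      · exact r₅
      · exact absurd rfl r₅.ne
    obtain ⟨i1, i2⟩ := hend.insert q3 p3
    refine last μ₅ h₅ ?_ (by rw [F₅.get 39]; simpa using d39) i1 i2 hend.flip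
    have F₅' : Frame {37} μ₄ ((assign 37 (var 36)).exec μ₄) :=
      fun a ha => by simp at ha; simp [ha]
    exact F₄.trans (F₅'.trans F₅ (U := chainVars))
  · intro he
    simp only [eval_add, eval_var, eval_one] at he
    have r : ∀ h ∈ A, L h = L g → μ 16 h ≠ p := by
      rcases r₄ with ⟨-, r⟩ | ⟨r, -⟩
      · exact r
      · have := (d.sub _ r).1; omega
    refine Does.line (by simp) h₄.bd ?_
    rw [exec_skip]
    refine last μ₄ h₄ F₄.mono d39 ?_ ?_ (by rw [F₄.get 16]; simp)
    · rw [F₄.get 16]; exact hL.update fun h hh e _ => r h hh e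
    · rw [F₄.get 16]; exact hR.update fun h hh e _ => p3 h hh e

theorem does_insert (d : Data N B mm k A w) (hG : IsGroupGraph k G A L R)
    (h : Holds B mm k A w L R μ) (hact : ∀ g, 0 ≤ g → g < mm → (0 < μ 13 g ↔ g ∈ A))
    (hcol : ∀ g, μ 16 g = 0) :
    Does N B insertProg μ fun μ' => Holds B mm k A w L R μ' ∧ Frame insertVars μ μ' ∧
      Proper A L (μ' 16) ∧ Proper A R (μ' 16) ∧ Complete k A (μ' 16) := by
  have hsum := d.sum_le
  have hsum0 := d.sum_nonneg
  have hmm := d.mm_three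
  have hN := d.N_le
  refine Does.line_seq (by simp) h.bd ?_
  refine (Does.count (n := mm) (i₀ := 0) (fun i μ' => Holds B mm k A w L R μ' ∧
    Frame insertVars μ μ' ∧ Proper A L (μ' 16) ∧ Proper A R (μ' 16) ∧ μ' 32 0 = i ∧
    (∀ g ∈ A, g < i → 1 ≤ μ' 16 g ∧ μ' 16 g ≤ k) ∧ ∀ g ∈ A, i ≤ g → μ' 16 g = 0) ?_ ?_ (by omega)
    (by omega) ?_).imp ?_
  · rintro i μ' ⟨h1, -, -, -, h2, -⟩
    exact ⟨h1.bd, by simp [h1.mm, h2]⟩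
  · have F : Frame insertVars μ ((assign 32 0).exec μ) := fun a ha => by
      have : a ≠ 32 := by rintro rfl; exact ha (by decide)
      simp [this]
    have c : (assign 32 0).exec μ 16 = fun _ => 0 := by ext g; simp [hcol]
    refine ⟨h.of_frame (h.bd.store (by simp; omega)) F (by simpa using h.col), F, ?_, ?_, ?_, ?_, ?_⟩
    · rw [c]; intro g _ h _ _ _ h0; exact absurd rfl h0
    · rw [c]; intro g _ h _ _ _ h0; exact absurd rfl h0
    · simp
    · intro g hg h0; have := (d.sub g hg).1; omega
    · rw [c]; simp
  · rintro i μ₁ hi0 hi ⟨h₁, F₁, L₁, R₁, e₁, c₁, z₁⟩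
    have next : ∀ μ₂, Holds B mm k A w L R μ₂ → Frame insertVars μ μ₂ → Proper A L (μ₂ 16) →
        Proper A R (μ₂ 16) → μ₂ 32 0 = i →
        (∀ g ∈ A, g < i + 1 → 1 ≤ μ₂ 16 g ∧ μ₂ 16 g ≤ k) → (∀ g ∈ A, i + 1 ≤ g → μ₂ 16 g = 0) →
        Does N B (assign 32 (var 32 + 1)) μ₂ fun μ' => Holds B mm k A w L R μ' ∧
          Frame insertVars μ μ' ∧ Proper A L (μ' 16) ∧ Proper A R (μ' 16) ∧ μ' 32 0 = i + 1 ∧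
          (∀ g ∈ A, g < i + 1 → 1 ≤ μ' 16 g ∧ μ' 16 g ≤ k) ∧
          ∀ g ∈ A, i + 1 ≤ g → μ' 16 g = 0 := by
      intro μ₂ h₂ F₂ L₂ R₂ e₂ c₂ z₂
      refine Does.line (by simp) h₂.bd ?_
      have F : Frame {32} μ₂ ((assign 32 (var 32 + 1)).exec μ₂) := fun a ha => by
        simp at ha; simp [ha]
      have e16 := F.get 16
      refine ⟨h₂.of_frame (h₂.bd.store (abs_le.2 (by simp [e₂]; omega))) F
        (by rw [e16]; exact h₂.col), F₂.trans F, ?_, ?_, by simp [e₂], ?_, ?_⟩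
      all_goals rw [e16]; assumption
    refine Does.seq (Does.cond h₁.bd ?_ ?_)
    · intro hpos
      simp only [eval_read, eval_var, e₁, F₁.get 13, hact i hi0 hi] at hpos
      refine (does_insertBody d hG h₁ hpos e₁ (z₁ i hpos le_rfl) L₁ R₁).imp ?_
      rintro μ₂ ⟨h₂, F₂, L₂, R₂, c2, c3, c4⟩
      refine next μ₂ h₂ (F₁.trans F₂) L₂ R₂ (by rw [F₂.get 32, e₁]) ?_ ?_
      · intro g hg hgi
        rcases eq_or_ne g i with rfl | hne
        · exact ⟨c2, c3⟩
        · exact (c4 g hne).2 (c₁ g hg (by omega))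
      · intro g hg hgi
        exact (c4 g (by omega)).1 (z₁ g hg (by omega))
    · intro hpos
      simp only [eval_read, eval_var, e₁, F₁.get 13, hact i hi0 hi] at hpos
      refine Does.line (by simp) h₁.bd (next μ₁ h₁ F₁ L₁ R₁ e₁ ?_ ?_)
      · intro g hg hgi
        exact c₁ g hg (by have : g ≠ i := by rintro rfl; exact hpos hg
                          omega)
      · exact fun g hg hgi => z₁ g hg (by omega)
  · rintro μ' ⟨h1, F1, L1, R1, -, c1, -⟩
    exact ⟨h1, F1, L1, R1, fun g hg => c1 g hg (d.sub g hg).2⟩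

end Insert

end FairDivision

/-! ### A colour class of balanced value -/

namespace FairDivision

open RAM Expr Prog

/-- The excess of `k` times the value of the edges of colour `c` over the value of all edges. -/
def balance (k : ℤ) (A : Finset ℤ) (w col : ℤ → ℤ) (c : ℤ) : ℤ :=
  k * classValue A w col c - ∑ g ∈ A, w g

/-- Variable `48` becomes the balance of the colour in variable `47`. -/
def sumProg : Prog :=
  (assign 48 0 ;; assign 33 0) ;;
  loop (var 30 - var 33)
    (Prog.cond (read 13 (var 33))
      (assign 48 (var 48 - read 12 (var 33)) ;;
        Prog.cond (eqv (read 16 (var 33)) (var 47))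
          (assign 48 (var 48 + var 31 * read 12 (var 33))) skip) skip ;;
      assign 33 (var 33 + 1))

section Sum

variable {N : ℕ} {B mm k G : ℤ} {A : Finset ℤ} {w L R : ℤ → ℤ} {μ : Mem}

theorem filter_lt_succ (A : Finset ℤ) (i : ℤ) : (A.filter fun g => g < i + 1) =
    if i ∈ A then insert i (A.filter fun g => g < i) else A.filter fun g => g < i := by
  ext g
  split_ifs with h
  · simp only [Finset.mem_filter, Finset.mem_insert]
    grind
  · simp only [Finset.mem_filter]
    grind

theorem Data.abs_sum_le (d : Data N B mm k A w) (col : ℤ → ℤ) (c : ℤ) {S : Finset ℤ}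
    (hS : S ⊆ A) :
    |∑ g ∈ S, ((if col g = c then k * w g else 0) - w g)| ≤ 3 * ∑ g ∈ A, w g := by
  have hk2 := d.k_two
  have hk3 := d.k_three
  refine (Finset.abs_sum_le_sum_abs _ _).trans ?_
  rw [Finset.mul_sum]
  refine (Finset.sum_le_sum fun g _ => ?_).trans
    (Finset.sum_le_sum_of_subset_of_nonneg hS fun g _ _ => by have := d.w_nonneg g; omega)
  have := d.w_nonneg g
  have h1 : 2 * w g ≤ k * w g := mul_le_mul_of_nonneg_right hk2 this
  have h2 : k * w g ≤ 3 * w g := mul_le_mul_of_nonneg_right hk3 this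
  rw [abs_le]
  split_ifs <;> omega

theorem balance_eq_sum (k : ℤ) (A : Finset ℤ) (w col : ℤ → ℤ) (c : ℤ) :
    balance k A w col c = ∑ g ∈ A, ((if col g = c then k * w g else 0) - w g) := by
  rw [Finset.sum_sub_distrib, ← Finset.sum_filter, ← Finset.mul_sum]; rfl

theorem Data.abs_balance_le (d : Data N B mm k A w) (col : ℤ → ℤ) (c : ℤ) :
    |balance k A w col c| ≤ 3 * ∑ g ∈ A, w g := by
  rw [balance_eq_sum]; exact d.abs_sum_le col c subset_rfl

theorem does_sum (d : Data N B mm k A w) (h : Holds B mm k A w L R μ)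
    (hact : ∀ g, 0 ≤ g → g < mm → (0 < μ 13 g ↔ g ∈ A)) :
    Does N B sumProg μ fun μ' => Holds B mm k A w L R μ' ∧ Frame {33, 48} μ μ' ∧
      μ' 48 0 = balance k A w (μ 16) (μ 47 0) := by
  have hsum := d.sum_le
  have hsum0 := d.sum_nonneg
  have hmm := d.mm_three
  have hN := d.N_le
  refine Does.line_seq (by simp) h.bd ?_
  refine (Does.count (n := mm) (i₀ := 0) (fun i μ' => Holds B mm k A w L R μ' ∧
    Frame {33, 48} μ μ' ∧ μ' 33 0 = i ∧ μ' 48 0 = ∑ g ∈ A.filter fun g => g < i,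
      ((if μ 16 g = μ 47 0 then k * w g else 0) - w g)) ?_ ?_ (by omega) (by omega) ?_).imp ?_
  · rintro i μ' ⟨h1, -, h2, -⟩
    exact ⟨h1.bd, by simp [h1.mm, h2]⟩
  · have F : Frame {33, 48} μ ((assign 48 0 ;; assign 33 0).exec μ) := fun a ha => by
      simp at ha; simp [ha]
    refine ⟨h.of_frame ((h.bd.store (by simp; omega)).store (by simp; omega)) F
      (by simpa using h.col), F, by simp, ?_⟩
    rw [Finset.filter_eq_empty_iff.2]
    · simp
    · intro g hg; have := (d.sub g hg).1; omega
  · rintro i μ₁ hi0 hi ⟨h₁, F₁, e₁, s₁⟩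
    refine Does.line (by simp) h₁.bd ?_
    have b1 := d.abs_sum_le (μ 16) (μ 47 0) (Finset.filter_subset (fun g => g < i) A)
    have b2 := d.abs_sum_le (μ 16) (μ 47 0) (Finset.filter_subset (fun g => g < i + 1) A)
    rw [← s₁] at b1
    by_cases hiA : i ∈ A
    · have hpos := (hact i hi0 hi).2 hiA
      have hw := d.w_le (Or.inl hiA)
      have hw0 := d.w_nonneg i
      rw [filter_lt_succ, if_pos hiA, Finset.sum_insert (by simp), ← s₁] at b2 ⊢
      have b3 : |μ₁ 48 0 - w i| ≤ B := by rw [abs_le] at b1 ⊢; omega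
      by_cases hc : μ 16 i = μ 47 0
      · rw [if_pos hc] at b2 ⊢
        have key : (Prog.cond (read 13 (var 33))
          (assign 48 (var 48 - read 12 (var 33)) ;;
            Prog.cond (eqv (read 16 (var 33)) (var 47))
              (assign 48 (var 48 + var 31 * read 12 (var 33))) skip) skip ;;
          assign 33 (var 33 + 1)).exec μ₁ = ((μ₁.store 48 0 (μ₁ 48 0 - w i)).store 48 0
            (k * w i - w i + μ₁ 48 0)).store 33 0 (i + 1) := by
          have e : μ₁ 48 0 - w i + k * w i = k * w i - w i + μ₁ 48 0 := by ring
          simp [e₁, F₁.get 13, F₁.get 16, F₁.get 47, hpos, hc, h₁.w, h₁.k, e]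
        rw [key]
        have F : Frame {33, 48} μ₁ (((μ₁.store 48 0 (μ₁ 48 0 - w i)).store 48 0
            (k * w i - w i + μ₁ 48 0)).store 33 0 (i + 1)) := fun a ha => by
          simp at ha; simp [ha]
        exact ⟨h₁.of_frame (((h₁.bd.store b3).store (by omega)).store
          (abs_le.2 (by omega))) F (by simpa using h₁.col), F₁.trans F, by simp, by simp⟩
      · rw [if_neg hc]
        have key : (Prog.cond (read 13 (var 33))
          (assign 48 (var 48 - read 12 (var 33)) ;;
            Prog.cond (eqv (read 16 (var 33)) (var 47))
              (assign 48 (var 48 + var 31 * read 12 (var 33))) skip) skip ;;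
          assign 33 (var 33 + 1)).exec μ₁ = (μ₁.store 48 0 (μ₁ 48 0 - w i)).store 33 0 (i + 1) := by
          simp [e₁, F₁.get 13, F₁.get 16, F₁.get 47, hpos, hc, h₁.w]
        rw [key]
        have F : Frame {33, 48} μ₁ ((μ₁.store 48 0 (μ₁ 48 0 - w i)).store 33 0 (i + 1)) :=
          fun a ha => by simp at ha; simp [ha]
        exact ⟨h₁.of_frame ((h₁.bd.store b3).store
          (abs_le.2 (by omega))) F (by simpa using h₁.col), F₁.trans F, by simp, by simp; ring⟩
    · have hpos : ¬ 0 < μ 13 i := by rwa [hact i hi0 hi]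
      rw [filter_lt_succ, if_neg hiA]
      have key : (Prog.cond (read 13 (var 33))
          (assign 48 (var 48 - read 12 (var 33)) ;;
            Prog.cond (eqv (read 16 (var 33)) (var 47))
              (assign 48 (var 48 + var 31 * read 12 (var 33))) skip) skip ;;
          assign 33 (var 33 + 1)).exec μ₁ = μ₁.store 33 0 (i + 1) := by
        rw [exec_seq, exec_cond, if_neg (by simpa [e₁, F₁.get 13] using hpos)]
        simp [e₁]
      rw [key]
      have F : Frame {33, 48} μ₁ (μ₁.store 33 0 (i + 1)) :=
        fun a ha => by simp at ha; simp [ha]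
      exact ⟨h₁.of_frame (h₁.bd.store (abs_le.2 (by omega))) F (by simpa using h₁.col),
        F₁.trans F, by simp, by simpa using s₁⟩
  · rintro μ' ⟨h1, F1, -, s1⟩
    refine ⟨h1, F1, ?_⟩
    rw [s1, balance_eq_sum, Finset.filter_true_of_mem fun g hg => (d.sub g hg).2]

end Sum

/-- The colour `X` missing at the first left end goes to variable `45`, its balance to variable `41`,
and a colour whose balance has not the same sign to variable `46`. -/
def selectProg : Prog :=
  assign 34 0 ;;
  missingProg 14 ;;
  (assign 45 (var 35) ;; assign 47 (var 35)) ;;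
  sumProg ;;
  (assign 41 (var 48) ;; assign 46 0 ;; assign 47 0) ;;
  loop (1 - var 46)
    (assign 47 (var 47 + 1) ;;
      Prog.cond (eqv (var 47) (var 45)) skip
        (sumProg ;; Prog.cond (var 48 * var 41) skip (assign 46 (var 47))))

section Select

variable {N : ℕ} {B mm k G : ℤ} {A : Finset ℤ} {w L R : ℤ → ℤ} {μ : Mem}

theorem sum_balance {col : ℤ → ℤ} (hc : Complete k A col) (hk : 0 ≤ k) :
    ∑ c ∈ Finset.Icc 1 k, balance k A w col c = 0 := by
  unfold balance classValue
  rw [Finset.sum_sub_distrib, ← Finset.mul_sum, Finset.sum_fiberwise_of_maps_to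
    (fun g hg => Finset.mem_Icc.2 (hc g hg))]
  simp [hk]

theorem exists_opposite {col : ℤ → ℤ} (hc : Complete k A col) (hk : 2 ≤ k) {X : ℤ}
    (hX : 1 ≤ X ∧ X ≤ k) :
    ∃ Y, 1 ≤ Y ∧ Y ≤ k ∧ Y ≠ X ∧ balance k A w col Y * balance k A w col X ≤ 0 := by
  by_contra hno
  push Not at hno
  have h1 := sum_balance (w := w) hc (by omega)
  rw [← Finset.add_sum_erase _ _ (Finset.mem_Icc.2 hX)] at h1
  have h2 : 0 < ∑ c ∈ (Finset.Icc 1 k).erase X, balance k A w col c * balance k A w col X := by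
    refine Finset.sum_pos (fun c hc => ?_) ?_
    · rw [Finset.mem_erase, Finset.mem_Icc] at hc
      exact hno c hc.2.1 hc.2.2 hc.1
    · rw [← Finset.card_pos, Finset.card_erase_of_mem (Finset.mem_Icc.2 hX), Int.card_Icc]
      omega
  rw [← Finset.sum_mul] at h2
  have h3 : ∑ c ∈ (Finset.Icc 1 k).erase X, balance k A w col c = -balance k A w col X := by
    linarith
  rw [h3] at h2
  nlinarith [mul_self_nonneg (balance k A w col X)]

theorem does_select (d : Data N B mm k A w) (hG : IsGroupGraph k G A L R)
    (h : Holds B mm k A w L R μ) (hact : ∀ g, 0 ≤ g → g < mm → (0 < μ 13 g ↔ g ∈ A))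
    (hc : Complete k A (μ 16)) :
    Does N B selectProg μ fun μ' => Holds B mm k A w L R μ' ∧
      Frame {33, 34, 35, 36, 41, 45, 46, 47, 48} μ μ' ∧ ∃ X Y, μ' 45 0 = X ∧ μ' 46 0 = Y ∧
      (1 ≤ X ∧ X ≤ k) ∧ (1 ≤ Y ∧ Y ≤ k) ∧ X ≠ Y ∧ (∀ g ∈ A, L g = 0 → μ 16 g ≠ X) ∧
      μ' 41 0 = balance k A w (μ 16) X ∧
      balance k A w (μ 16) Y * balance k A w (μ 16) X ≤ 0 := by
  have hk2 := d.k_two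
  have hk3 := d.k_three
  have hsum := d.sum_le
  have hsum0 := d.sum_nonneg
  have hmm := d.mm_three
  have hN := d.N_le
  refine Does.line_seq (by simp) h.bd (Does.seq ?_)
  refine (does_missing (μ := (assign 34 0).exec μ) d
    (h.of_frame (S := {34}) (h.bd.store (by simp; omega))
      (fun a ha => by simp at ha; simp [ha]) (by simpa using h.col))
    (by decide) (by decide) (by decide) ?_).imp ?_
  · obtain ⟨c, c1, c2, c3⟩ := exists_missing_colour (T := A.filter fun g => L g = 0)
      (col := μ 16) (k := k) (by have := hG.L_zero; omega)
    refine ⟨c, c1, c2, fun g hg hgL => ?_⟩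
    simp [h.L] at hgL ⊢
    exact c3 g (Finset.mem_filter.2 ⟨hg, hgL⟩)
  rintro μ₁ ⟨h₁, f₁, x1, x2, x3⟩
  have F₁ : Frame {33, 34, 35, 36} μ μ₁ := fun a ha => by
    simp at ha; rw [f₁ a ha.1 ha.2.2.1 ha.2.2.2]; simp [ha]
  obtain ⟨X, hX⟩ : ∃ X, X = μ₁ 35 0 := ⟨_, rfl⟩
  rw [← hX] at x1 x2 x3
  simp [h.L] at x3
  refine line_then (by simp) h₁.bd fun μ₁' e₁ => Does.seq ?_
  have F₁' : Frame {45, 47} μ₁ μ₁' := fun a ha => by simp at ha; rw [← e₁]; simp [ha]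
  have E₁ : μ₁' 47 0 = X := by simp [← e₁, hX]
  have E₁' : μ₁' 45 0 = X := by simp [← e₁, hX]
  have b₁ : Bd B μ₁' := by
    rw [← e₁]; exact (h₁.bd.store (by simpa using h₁.bd _ _)).store (by simpa using h₁.bd _ _)
  have F₁₁ := F₁.trans F₁' (U := {33, 34, 35, 36, 45, 47})
  refine (does_sum d (h₁.of_frame b₁ F₁' (by rw [F₁'.get 16]; exact h₁.col)) (by
      rw [F₁₁.get 13]; exact hact)).imp ?_
  rintro μ₂ ⟨h₂, F₂, s₂⟩
  rw [E₁, F₁₁.get 16] at s₂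
  have X₂ : μ₂ 45 0 = X := by rw [F₂.get 45, E₁']
  replace F₂ := F₁₁.trans F₂ (U := {33, 34, 35, 36, 45, 47, 48})
  have hbX := d.abs_balance_le (μ 16) X
  refine Does.line_seq (by simp) h₂.bd ?_
  obtain ⟨c, c1, c2, c3, c4⟩ := exists_opposite (w := w) hc hk2 ⟨x1, x2⟩
  refine (Does.loop (fun n μ' => Holds B mm k A w L R μ' ∧
    Frame {33, 34, 35, 36, 41, 45, 46, 47, 48} μ μ' ∧ μ' 45 0 = X ∧
    μ' 41 0 = balance k A w (μ 16) X ∧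
    ((μ' 46 0 = 0 ∧ 0 ≤ μ' 47 0 ∧ μ' 47 0 < c ∧ n = (c - μ' 47 0).toNat) ∨
      (n = 0 ∧ 1 ≤ μ' 46 0 ∧ μ' 46 0 ≤ k ∧ μ' 46 0 ≠ X ∧
        balance k A w (μ 16) (μ' 46 0) * balance k A w (μ 16) X ≤ 0)))
    (fun n μ' hI => hI.1.bd) ?_ (n := c.toNat) ?_ (by omega)).imp ?_
  · rintro n μ₃ ⟨h₃, F₃, X₃, s₃, r₃⟩ he
    simp only [eval_sub, eval_var, eval_one] at he
    obtain ⟨r1, r2, r3, rfl⟩ : μ₃ 46 0 = 0 ∧ 0 ≤ μ₃ 47 0 ∧ μ₃ 47 0 < c ∧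
        n = (c - μ₃ 47 0).toNat := by
      rcases r₃ with r | ⟨-, r, -⟩
      · exact r
      · omega
    refine Does.line_seq (by simp) h₃.bd ?_
    obtain ⟨μ₄, e₄⟩ : ∃ μ₄, μ₄ = (assign 47 (var 47 + 1)).exec μ₃ := ⟨_, rfl⟩
    rw [← e₄]
    have F₃₄ : Frame {47} μ₃ μ₄ := fun a ha => by simp at ha; rw [e₄]; simp [ha]
    have E₄ : μ₄ 47 0 = μ₃ 47 0 + 1 := by rw [e₄]; simp
    have b₄ : Bd B μ₄ := by rw [e₄]; exact h₃.bd.store (abs_le.2 (by simp; omega))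
    have h₄ := h₃.of_frame b₄ F₃₄ (by rw [F₃₄.get 16]; exact h₃.col)
    have F₄ := F₃.trans F₃₄ (U := {33, 34, 35, 36, 41, 45, 46, 47, 48})
    have X₄ : μ₄ 45 0 = X := by rw [F₃₄.get 45, X₃]
    have Y₄ : μ₄ 46 0 = 0 := by rw [F₃₄.get 46, r1]
    have s₄ : μ₄ 41 0 = balance k A w (μ 16) X := by rw [F₃₄.get 41, s₃]
    refine Does.cond h₄.bd ?_ ?_
    · intro he
      simp only [eval_eqv_pos, eval_var, X₄] at he
      refine Does.line (by simp) h₄.bd ?_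
      exact ⟨(c - μ₄ 47 0).toNat, by omega, h₄, F₄, X₄, s₄, Or.inl ⟨Y₄, by
        rw [exec_skip]; omega, by rw [exec_skip]; omega, rfl⟩⟩
    · intro he
      simp only [eval_eqv_pos, eval_var, X₄] at he
      refine Does.seq ((does_sum d h₄ (by rw [F₄.get 13]; exact hact)).imp ?_)
      rintro μ₅ ⟨h₅, F₄₅, s₅⟩
      rw [F₄.get 16] at s₅
      have F₅ := F₄.trans F₄₅ (U := {33, 34, 35, 36, 41, 45, 46, 47, 48})
      have X₅ : μ₅ 45 0 = X := by rw [F₄₅.get 45, X₄]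
      have E₅ : μ₅ 47 0 = μ₄ 47 0 := by rw [F₄₅.get 47]
      have t₅ : μ₅ 41 0 = balance k A w (μ 16) X := by rw [F₄₅.get 41, s₄]
      refine Does.cond h₅.bd ?_ ?_
      · intro hpos
        simp only [eval_mul, eval_var, s₅, t₅] at hpos
        refine Does.line (by simp) h₅.bd ?_
        have hne : μ₄ 47 0 ≠ c := by
          intro e; rw [e] at hpos; omega
        exact ⟨(c - μ₅ 47 0).toNat, by omega, h₅, F₅, X₅, t₅,
          Or.inl ⟨by rw [exec_skip, F₄₅.get 46, Y₄], by rw [exec_skip]; omega, by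
            rw [exec_skip]; omega, rfl⟩⟩
      · intro hpos
        simp only [eval_mul, eval_var, s₅, t₅, not_lt] at hpos
        refine Does.line (by simp) h₅.bd ?_
        have F₆ : Frame {46} μ₅ ((assign 46 (var 47)).exec μ₅) := fun a ha => by
          simp at ha; simp [ha]
        have e46 : (assign 46 (var 47)).exec μ₅ 46 0 = μ₄ 47 0 := by simp [E₅]
        exact ⟨0, by omega, h₅.of_frame (h₅.bd.store (by simpa using h₅.bd _ _)) F₆
          (by rw [F₆.get 16]; exact h₅.col), F₅.trans F₆, by rw [F₆.get 45, X₅],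
          by rw [F₆.get 41, t₅], Or.inr ⟨rfl, by rw [e46]; omega, by rw [e46]; omega,
            by rw [e46]; exact he, by rw [e46]; exact hpos⟩⟩
  · have F₃ : Frame {41, 46, 47} μ₂
        ((assign 41 (var 48) ;; assign 46 0 ;; assign 47 0).exec μ₂) := fun a ha => by
      simp at ha; simp [ha]
    refine ⟨h₂.of_frame (((h₂.bd.store (by simpa using h₂.bd _ _)).store (by simp; omega)).store
      (by simp; omega)) F₃ (by rw [F₃.get 16]; exact h₂.col), F₂.trans F₃,
      by rw [F₃.get 45, X₂], by simp [s₂], Or.inl ?_⟩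
    refine ⟨by simp, by simp, by simp; omega, by simp⟩
  · rintro μ₃ ⟨⟨n, h₃, F₃, X₃, s₃, r₃⟩, he⟩
    simp only [eval_sub, eval_var, eval_one] at he
    rcases r₃ with ⟨r, -⟩ | ⟨-, r1, r2, r3, r4⟩
    · omega
    · exact ⟨h₃, F₃, X, _, X₃, rfl, ⟨x1, x2⟩, ⟨r1, r2⟩, r3.symm, x3, s₃, r4⟩

end Select

end FairDivision

/-! ### The exchange of two colours -/

namespace FairDivision

open RAM Expr Prog

/-- The colour class `X` has the properties of a split. -/
structure Balanced (k G : ℤ) (A : Finset ℤ) (w L R col : ℤ → ℤ) (X : ℤ) : Prop where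
  complete : Complete k A col
  right : Proper A R col
  counts : LeftCounts G A L col X
  value : ∃ y ∈ A, 2 * |balance k A w col X| ≤ k * w y ∧
    (0 < balance k A w col X → col y = X) ∧ (balance k A w col X < 0 → col y ≠ X)

/-- The colours are copied to array `17`. -/
def copyProg : Prog :=
  assign 32 0 ;;
  loop (var 30 - var 32) (set 17 (var 32) (read 16 (var 32)) ;; assign 32 (var 32 + 1))

/-- The exchange of the colours `Y` and `X` (variables `46` and `45`) along the chain that starts at
the first left end. -/
def firstProg : Prog :=
  (assign 39 (var 46) ;; assign 40 (var 45) ;; assign 42 1 ;; assign 44 0 ;; assign 34 0 ;;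
    assign 35 (var 46)) ;;
  findProg 14 ;; assign 37 (var 36) ;; chainProg

/-- The exchange of the colours along the cycle through the left end `l` (variable `47`), unless
this has been done before. -/
def laterBody : Prog :=
  (assign 34 (var 47) ;; assign 35 (var 45)) ;;
  findProg 14 ;;
  Prog.cond (var 36 + 1)
    (Prog.cond (eqv (read 17 (var 36)) (var 45)) (assign 37 (var 36) ;; chainProg) skip) skip ;;
  assign 47 (var 47 + 1)

/-- The exchange of the colours along all cycles, until the balance changes its sign. -/
def laterProg : Prog :=
  (assign 39 (var 45) ;; assign 40 (var 46) ;; assign 42 (const (-1)) ;; assign 47 0) ;;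
  loop ((var 30 - var 47) * (1 - var 44)) laterBody

/-- The state of the exchange when the colours have been exchanged along the chain from the first
left end and along the cycles through the left ends before `l`. -/
structure Exchanged (k : ℤ) (A : Finset ℤ) (w L R χ : ℤ → ℤ) (X Y l : ℤ) (col : ℤ → ℤ) : Prop where
  flip : ∀ g, col g = χ g ∨ (χ g = X ∧ col g = Y) ∨ (χ g = Y ∧ col g = X)
  left : Proper A L col
  right : Proper A R col
  zero : ∀ g ∈ A, L g = 0 → χ g = Y → col g = X
  lt : ∀ g ∈ A, χ g = X → L g < l → col g = Y
  sign : (balance k A w col X).sign = (balance k A w χ X).sign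

section Exchange

variable {N : ℕ} {B mm k G : ℤ} {A : Finset ℤ} {w L R χ col col₀ : ℤ → ℤ} {μ : Mem} {X Y l : ℤ}

theorem does_copy (d : Data N B mm k A w) (h : Holds B mm k A w L R μ) :
    Does N B copyProg μ fun μ' => Holds B mm k A w L R μ' ∧ Frame {17, 32} μ μ' ∧
      ∀ g ∈ A, μ' 17 g = μ 16 g := by
  have hsum := d.sum_le
  have hsum0 := d.sum_nonneg
  have hmm := d.mm_three
  have hN := d.N_le
  refine Does.line_seq (by simp) h.bd ?_
  refine (Does.count (n := mm) (i₀ := 0) (fun i μ' => Holds B mm k A w L R μ' ∧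
    Frame {17, 32} μ μ' ∧ μ' 32 0 = i ∧ ∀ g, 0 ≤ g → g < i → μ' 17 g = μ 16 g) ?_ ?_ (by omega)
    (by omega) ?_).imp ?_
  · rintro i μ' ⟨h1, -, h2, -⟩
    exact ⟨h1.bd, by simp [h1.mm, h2]⟩
  · have F : Frame {17, 32} μ ((assign 32 0).exec μ) := fun a ha => by
      simp at ha; simp [ha]
    exact ⟨h.of_frame (h.bd.store (by simp; omega)) F (by simpa using h.col), F, by simp,
      fun g h0 h1 => by omega⟩
  · rintro i μ₁ hi0 hi ⟨h₁, F₁, e₁, s₁⟩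
    refine Does.line (by simp) h₁.bd ?_
    have F : Frame {17, 32} μ₁ ((set 17 (var 32) (read 16 (var 32)) ;;
        assign 32 (var 32 + 1)).exec μ₁) := fun a ha => by simp at ha; simp [ha]
    refine ⟨h₁.of_frame ((h₁.bd.store (by simpa using h₁.bd _ _)).store
      (abs_le.2 (by simp [e₁]; omega))) F (by simpa using h₁.col), F₁.trans F, by simp [e₁],
      fun g h0 h1 => ?_⟩
    by_cases hg : g = i
    · simp [e₁, hg, F₁.get 16]
    · simp [e₁, hg, s₁ g h0 (by omega)]
  · rintro μ' ⟨h1, F1, -, s1⟩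
    exact ⟨h1, F1, fun g hg => s1 g (d.sub g hg).1 (d.sub g hg).2⟩

/-- The exchange of `X` and `Y` on some edges does not change the value of both classes together. -/
theorem classValue_flip (hXY : X ≠ Y)
    (flip : ∀ g, col g = χ g ∨ (χ g = X ∧ col g = Y) ∨ (χ g = Y ∧ col g = X)) :
    classValue A w col X + classValue A w col Y = classValue A w χ X + classValue A w χ Y := by
  unfold classValue
  have h : ∀ c : ℤ → ℤ, ∑ g ∈ A with c g = X, w g + ∑ g ∈ A with c g = Y, w g =
      ∑ g ∈ A with (c g = X ∨ c g = Y), w g := by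
    intro c
    rw [← Finset.sum_union, Finset.filter_or]
    rw [Finset.disjoint_filter]
    intro g _ h1 h2
    exact hXY (h1.symm.trans h2)
  rw [h, h]
  refine Finset.sum_congr (Finset.filter_congr fun g _ => ?_) fun _ _ => rfl
  have := flip g
  grind

theorem does_first (d : Data N B mm k A w) (h : Holds B mm k A w L R μ)
    (hb : IsBaseColouring k G A L R (μ 16) X Y) (h45 : μ 45 0 = X) (h46 : μ 46 0 = Y)
    (h41 : μ 41 0 = balance k A w (μ 16) X) :
    Does N B firstProg μ fun μ' => Holds B mm k A w L R μ' ∧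
      Frame (chainVars ∪ {39, 40, 42}) μ μ' ∧ μ' 41 0 = balance k A w (μ' 16) X ∧
      ((μ' 44 0 = 1 ∧ Balanced k G A w L R (μ' 16) X) ∨
        (μ' 44 0 = 0 ∧ Exchanged k A w L R (μ 16) X Y 0 (μ' 16))) := by
  have hsum := d.sum_le
  have hsum0 := d.sum_nonneg
  have hmm := d.mm_three
  have hX := hb.hX
  have hY := hb.hY
  refine line_then (by simp) h.bd fun μ₁ e₁ => Does.seq ?_
  have F₁ : Frame {34, 35, 39, 40, 42, 44} μ μ₁ := fun a ha => by
    simp at ha; rw [← e₁]; simp [ha]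
  have b₁ : Bd B μ₁ := by
    rw [← e₁]
    exact (((((h.bd.store (by simpa using h.bd _ _)).store (by simpa using h.bd _ _)).store
      (by simp; omega)).store (by simp; omega)).store (by simp; omega)).store
      (by simpa using h.bd _ _)
  have h₁ := h.of_frame b₁ F₁ (by rw [F₁.get 16]; exact h.col)
  have c34 : μ₁ 34 0 = 0 := by simp [← e₁]
  have c35 : μ₁ 35 0 = Y := by simp [← e₁, h46]
  have c39 : μ₁ 39 0 = Y := by simp [← e₁, h46]
  have c40 : μ₁ 40 0 = X := by simp [← e₁, h45]
  have c42 : μ₁ 42 0 = 1 := by simp [← e₁]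
  have c44 : μ₁ 44 0 = 0 := by simp [← e₁]
  refine (does_find_mem (side := 14) d h₁ (by decide) (by decide) (by omega)).imp ?_
  rintro μ₂ ⟨h₂, f₂, r₂⟩
  have F₁₂ : Frame {33, 36} μ₁ μ₂ := fun a ha => by
    simp at ha; exact f₂ a ha.1 ha.2
  have F₂ := F₁.trans F₁₂ (U := chainVars ∪ {39, 40, 42})
  rw [h₁.L, c34, c35, F₁.get 16] at r₂
  obtain ⟨y, hy, hyL, hyY⟩ := exists_colour_zero hb.graph hb.complete hb.hL hb.hX hb.X_zero hY.1
    hY.2 hb.ne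
  obtain ⟨r1, r2, r3⟩ : μ₂ 36 0 ∈ A ∧ L (μ₂ 36 0) = 0 ∧ μ 16 (μ₂ 36 0) = Y := by
    rcases r₂ with ⟨-, r⟩ | r
    · exact absurd hyY (r y hy hyL)
    · exact r
  refine line_then (by simp) h₂.bd fun μ₃ e₃ => ?_
  have F₂₃ : Frame {37} μ₂ μ₃ := fun a ha => by
    simp at ha; rw [← e₃]; simp [ha]
  have F₃ := F₂.trans F₂₃ (U := chainVars ∪ {39, 40, 42})
  have F₁₃ := F₁₂.trans F₂₃ (U := {33, 36, 37})
  have h₃ := h₂.of_frame (by rw [← e₃]; exact h₂.bd.store (by simpa using h₂.bd _ _)) F₂₃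
    (by rw [F₂₃.get 16]; exact h₂.col)
  have e37 : μ₃ 37 0 = μ₂ 36 0 := by simp [← e₃]
  have e16 : μ₃ 16 = μ 16 := by rw [F₁₃.get 16, F₁.get 16]
  have e41 : μ₃ 41 0 = balance k A w (μ 16) X := by rw [F₁₃.get 41, F₁.get 41, h41]
  have hrun : ChainRun A L R (μ 16) Y X (μ 16) 0 (μ₃ 16) (μ₃ 37 0) := by
    rw [e16, e37]
    have := (hb.hL.base hb.hR hb.ne.symm (by omega) (by omega)).run hb.hL r1 r3 r3
    rwa [r2] at this
  have hbal := d.abs_balance_le (μ 16) X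
  refine (does_chain (σ := 1) d h₃ hrun (by rw [F₁₃.get 39, c39]) (by rw [F₁₃.get 40, c40])
    (by rw [F₁₃.get 42, c42]) (by simp) (by simp) (by rw [e41]; omega)).imp ?_
  rintro μ₄ ⟨h₄, F₃₄, s₄, r₄⟩
  have s₄' : μ₄ 41 0 = balance k A w (μ₄ 16) X := by
    rw [s₄, e41, e16]; unfold balance; ring
  refine ⟨h₄, F₃.trans F₃₄, s₄', ?_⟩
  rcases r₄ with ⟨t₄, g₄, r₄⟩ | r₄
  · right
    refine ⟨by rw [t₄, F₁₃.get 44, c44], fun g => ?_, r₄.proper hb.X_zero, r₄.right, r₄.start, ?_,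
      ?_⟩
    · have := r₄.flip g; tauto
    · intro g hg _ hlt
      have := hb.graph.L_mem g hg; omega
    · rw [← s₄', g₄, e41]
  · left
    have hbase : ChainBase A L R (μ 16) Y X (μ 16) (μ₄ 16) := by
      rcases r₄.state with ⟨e, r⟩ | r
      exacts [r.toChainBase, r.toChainBase]
    have flip : ∀ g, μ₄ 16 g = μ 16 g ∨ (μ 16 g = X ∧ μ₄ 16 g = Y) ∨
        (μ 16 g = Y ∧ μ₄ 16 g = X) := fun g => by have := hbase.flip g; tauto
    refine ⟨r₄.done, hb.complete_flip flip, hbase.right, ?_, ?_⟩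
    · rcases r₄.state with ⟨e, r⟩ | r
      · exact hb.leftCounts_first r
      · exact hb.leftCounts_proper flip r.start r.left
    · obtain ⟨y, hy, y1, y2, y3⟩ := r₄.value
      rw [s₄', one_mul] at y2 y3
      rw [s₄'] at y1
      exact ⟨y, hy, y1, y2, fun h => by rw [y3 h]; exact hb.ne.symm⟩

theorem Exchanged.of_base (h : Exchanged k A w L R χ X Y l col₀)
    (hc : ChainBase A L R χ X Y col₀ col) :
    (∀ g ∈ A, L g = 0 → χ g = Y → col g = X) ∧ ∀ g ∈ A, χ g = X → L g < l → col g = Y := by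
  constructor
  · intro g hg h0 hgY
    have h1 := h.zero g hg h0 hgY
    have h2 := hc.mono g (by rw [h1, hgY]; exact hc.ne)
    have h3 := hc.flip g
    have h4 := hc.ne
    grind
  · intro g hg hgX hlt
    have h1 := h.lt g hg hgX hlt
    have h2 := hc.mono g (by rw [h1, hgX]; exact hc.ne.symm)
    have h3 := hc.flip g
    have h4 := hc.ne
    grind

theorem does_laterBody (d : Data N B mm k A w) (h : Holds B mm k A w L R μ)
    (hb : IsBaseColouring k G A L R χ X Y) (h45 : μ 45 0 = X) (h39 : μ 39 0 = X)
    (h40 : μ 40 0 = Y) (h42 : μ 42 0 = -1) (h44 : μ 44 0 = 0) (h17 : ∀ g ∈ A, μ 17 g = χ g)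
    (h47 : μ 47 0 = l) (hl0 : 0 ≤ l) (hl : l < mm)
    (h41 : μ 41 0 = balance k A w (μ 16) X) (hx : Exchanged k A w L R χ X Y l (μ 16)) :
    Does N B laterBody μ fun μ' => Holds B mm k A w L R μ' ∧
      Frame (chainVars ∪ {47}) μ μ' ∧ μ' 41 0 = balance k A w (μ' 16) X ∧ μ' 47 0 = l + 1 ∧
      ((μ' 44 0 = 1 ∧ Balanced k G A w L R (μ' 16) X) ∨
        (μ' 44 0 = 0 ∧ Exchanged k A w L R χ X Y (l + 1) (μ' 16))) := by
  have hsum := d.sum_le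
  have hsum0 := d.sum_nonneg
  have hmm := d.mm_three
  have hX := hb.hX
  have hY := hb.hY
  refine line_then (by simp) h.bd fun μ₁ e₁ => Does.seq ?_
  have F₁ : Frame {34, 35} μ μ₁ := fun a ha => by
    simp at ha; rw [← e₁]; simp [ha]
  have b₁ : Bd B μ₁ := by
    rw [← e₁]
    exact (h.bd.store (by simpa using h.bd _ _)).store (by simpa using h.bd _ _)
  have h₁ := h.of_frame b₁ F₁ (by rw [F₁.get 16]; exact h.col)
  have c34 : μ₁ 34 0 = l := by simp [← e₁, h47]
  have c35 : μ₁ 35 0 = X := by simp [← e₁, h45]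
  refine (does_find_mem (side := 14) d h₁ (by decide) (by decide) (by omega)).imp ?_
  rintro μ₂ ⟨h₂, f₂, r₂⟩
  have F₁₂ : Frame {33, 36} μ₁ μ₂ := fun a ha => by
    simp at ha; exact f₂ a ha.1 ha.2
  have F₂ := F₁.trans F₁₂ (U := {33, 34, 35, 36})
  rw [h₁.L, c34, c35, F₁.get 16] at r₂
  have last : ∀ μ₅, Holds B mm k A w L R μ₅ → Frame (chainVars ∪ {47}) μ μ₅ → μ₅ 47 0 = l →
      μ₅ 41 0 = balance k A w (μ₅ 16) X →
      ((μ₅ 44 0 = 1 ∧ Balanced k G A w L R (μ₅ 16) X) ∨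
        (μ₅ 44 0 = 0 ∧ Exchanged k A w L R χ X Y (l + 1) (μ₅ 16))) →
      Does N B (assign 47 (var 47 + 1)) μ₅ fun μ' => Holds B mm k A w L R μ' ∧
      Frame (chainVars ∪ {47}) μ μ' ∧ μ' 41 0 = balance k A w (μ' 16) X ∧ μ' 47 0 = l + 1 ∧
      ((μ' 44 0 = 1 ∧ Balanced k G A w L R (μ' 16) X) ∨
        (μ' 44 0 = 0 ∧ Exchanged k A w L R χ X Y (l + 1) (μ' 16))) := by
    intro μ₅ h₅ F₅ l₅ s₅ r₅
    refine Does.line (by simp) h₅.bd ?_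
    have F : Frame {47} μ₅ ((assign 47 (var 47 + 1)).exec μ₅) := fun a ha => by
      simp at ha; simp [ha]
    refine ⟨h₅.of_frame (h₅.bd.store (abs_le.2 (by simp [l₅]; omega))) F
      (by rw [F.get 16]; exact h₅.col), F₅.trans F, ?_, by simp [l₅], ?_⟩
    · rw [F.get 41, F.get 16, s₅]
    · rw [F.get 44, F.get 16]; exact r₅
  -- without an edge of original colour `X` at `l` that is still of colour `X`
  have skip' : (∀ g ∈ A, L g = l → χ g = X → μ 16 g ≠ X) →
      Does N B skip μ₂ fun μ' => Does N B (assign 47 (var 47 + 1)) μ' fun μ' =>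
        Holds B mm k A w L R μ' ∧
      Frame (chainVars ∪ {47}) μ μ' ∧ μ' 41 0 = balance k A w (μ' 16) X ∧ μ' 47 0 = l + 1 ∧
      ((μ' 44 0 = 1 ∧ Balanced k G A w L R (μ' 16) X) ∨
        (μ' 44 0 = 0 ∧ Exchanged k A w L R χ X Y (l + 1) (μ' 16))) := by
    intro hno
    refine Does.line (by simp) h₂.bd ?_
    refine last μ₂ h₂ F₂.mono (by rw [F₂.get 47, h47]) (by rw [F₂.get 41, F₂.get 16, h41])
      (Or.inr ⟨by rw [F₂.get 44, h44], ?_⟩)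
    rw [F₂.get 16]
    refine ⟨hx.flip, hx.left, hx.right, hx.zero, fun g hg hgX hlt => ?_, hx.sign⟩
    rcases (Int.lt_add_one_iff.1 hlt).eq_or_lt with hgl | hgl
    · have h1 := hno g hg hgl hgX
      have h2 := hx.flip g
      have h3 := hb.ne
      grind
    · exact hx.lt g hg hgX hgl
  refine Does.seq (Does.cond h₂.bd ?_ ?_)
  · intro he
    simp only [eval_add, eval_var, eval_one] at he
    obtain ⟨r1, r2, r3⟩ : μ₂ 36 0 ∈ A ∧ L (μ₂ 36 0) = l ∧ μ 16 (μ₂ 36 0) = X := by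
      rcases r₂ with ⟨r, -⟩ | r
      · omega
      · exact r
    refine Does.cond h₂.bd ?_ ?_
    · intro hχ
      simp only [eval_eqv_pos, eval_var, eval_read, F₂.get 17, h17 _ r1, F₂.get 45, h45] at hχ
      have hlpos : 0 < l := by
        rcases hl0.eq_or_lt with h0 | h0
        · exact absurd hχ (hb.X_zero _ r1 (by omega))
        · exact h0
      refine line_then (by simp) h₂.bd fun μ₃ e₃ => ?_
      have F₂₃ : Frame {37} μ₂ μ₃ := fun a ha => by
        simp at ha; rw [← e₃]; simp [ha]
      have F₃ := F₂.trans F₂₃ (U := {33, 34, 35, 36, 37})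
      have h₃ := h₂.of_frame (by rw [← e₃]; exact h₂.bd.store (by simpa using h₂.bd _ _)) F₂₃
        (by rw [F₂₃.get 16]; exact h₂.col)
      have e37 : μ₃ 37 0 = μ₂ 36 0 := by simp [← e₃]
      have e16 : μ₃ 16 = μ 16 := F₃.get 16
      have e41 : μ₃ 41 0 = balance k A w (μ 16) X := by rw [F₃.get 41, h41]
      have hrun : ChainRun A L R χ X Y (μ 16) l (μ₃ 16) (μ₃ 37 0) := by
        rw [e16, e37, ← r2]
        refine ChainBase.run ⟨hb.hL, hb.hR, hb.ne, by omega, by omega, hx.flip, fun _ h => h,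
          hx.right, fun g _ _ h1 h2 => absurd (h2.symm.trans h1) hb.ne⟩ hx.left r1 r3 hχ
      have hbal := d.abs_balance_le (μ 16) X
      refine (does_chain (σ := -1) d h₃ hrun (by rw [F₃.get 39, h39]) (by rw [F₃.get 40, h40])
        (by rw [F₃.get 42, h42]) (by simp) (by simp) (by rw [e41]; omega)).imp ?_
      rintro μ₄ ⟨h₄, F₃₄, s₄, r₄⟩
      have hbase : ChainBase A L R χ X Y (μ 16) (μ₄ 16) := by
        rcases r₄ with ⟨-, -, r⟩ | r
        · exact r.toChainBase
        · rcases r.state with ⟨e, r⟩ | r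
          exacts [r.toChainBase, r.toChainBase]
      have s₄' : μ₄ 41 0 = balance k A w (μ₄ 16) X := by
        have c1 := classValue_flip (A := A) (w := w) hb.ne hx.flip
        have c2 := classValue_flip (A := A) (w := w) hb.ne hbase.flip
        rw [s₄, e41, e16]
        have c3 : classValue A w (μ₄ 16) Y = classValue A w (μ 16) X + classValue A w (μ 16) Y -
          classValue A w (μ₄ 16) X := by linarith
        rw [c3]
        unfold balance; ring
      obtain ⟨z₄, l₄⟩ := hx.of_base hbase
      refine last μ₄ h₄ (F₃.trans F₃₄) (by rw [F₃₄.get 47, F₃.get 47, h47]) s₄' ?_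
      rcases r₄ with ⟨t₄, g₄, r₄⟩ | r₄
      · right
        refine ⟨by rw [t₄, F₃.get 44, h44], hbase.flip, hb.proper_of_end r₄ hx.zero, hbase.right,
          z₄, fun g hg hgX hlt => ?_, ?_⟩
        · rcases (Int.lt_add_one_iff.1 hlt).eq_or_lt with hgl | hgl
          · exact r₄.start g hg hgl hgX
          · exact l₄ g hg hgX hgl
        · rw [← s₄', g₄, e41, hx.sign]
      · left
        refine ⟨r₄.done, hb.complete_flip hbase.flip, hbase.right, ?_, ?_⟩
        · rcases r₄.state with ⟨e, r⟩ | r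
          · exact hb.leftCounts_later hlpos r z₄ l₄
          · have := hb.proper_of_end r hx.zero
            exact hb.leftCounts_proper hbase.flip z₄ fun g hg h hh hne e _ => this g hg h hh hne e
        · obtain ⟨y, hy, y1, y2, y3⟩ := r₄.value
          rw [s₄'] at y1 y2 y3
          exact ⟨y, hy, y1, fun h => y3 (by omega), fun h => by
            rw [y2 (by omega)]; exact hb.ne.symm⟩
    · intro hχ
      simp only [eval_eqv_pos, eval_var, eval_read, F₂.get 17, h17 _ r1, F₂.get 45, h45] at hχ
      refine skip' fun g hg hgL hgX hc => ?_
      have hne : g ≠ μ₂ 36 0 := by rintro rfl; exact hχ hgX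
      exact hx.left g hg _ r1 hne (hgL.trans r2.symm) (by omega) (hc.trans r3.symm)
  · intro he
    simp only [eval_add, eval_var, eval_one] at he
    refine skip' fun g hg hgL hgX => ?_
    rcases r₂ with ⟨-, r⟩ | ⟨r, -⟩
    · exact r g hg hgL
    · have := (d.sub _ r).1; omega

theorem Exchanged.balanced (hb : IsBaseColouring k G A L R χ X Y)
    (hopp : balance k A w χ Y * balance k A w χ X ≤ 0) (hA : A.Nonempty) (hw : ∀ g, 0 ≤ w g)
    (h : Exchanged k A w L R χ X Y G col) : Balanced k G A w L R col X := by
  have h1 := hb.all_exchanged h.flip h.zero h.left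
    fun g hg hgX => h.lt g hg hgX (hb.graph.L_mem g hg).2
  have h2 : balance k A w col X = balance k A w χ Y := by
    unfold balance classValue; rw [h1]
  have h3 : balance k A w col X = 0 := by
    have h4 := h.sign
    rw [← h2] at hopp
    rcases lt_trichotomy (balance k A w col X) 0 with hlt | heq | hlt
    · rw [Int.sign_eq_neg_one_of_neg hlt, eq_comm, Int.sign_eq_neg_one_iff_neg] at h4
      have := mul_pos_of_neg_of_neg hlt h4
      omega
    · exact heq
    · rw [Int.sign_eq_one_of_pos hlt, eq_comm, Int.sign_eq_one_iff_pos] at h4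
      have := mul_pos hlt h4
      omega
  obtain ⟨y, hy⟩ := hA
  refine ⟨hb.complete_flip h.flip, h.right,
    hb.leftCounts_proper h.flip h.zero fun g hg h' hh hne e _ => h.left g hg h' hh hne e, y, hy, ?_⟩
  rw [h3]
  have := mul_nonneg (show 0 ≤ k by have := hb.graph.two_le; omega) (hw y)
  simpa using this

theorem does_later (d : Data N B mm k A w) (h : Holds B mm k A w L R μ)
    (hb : IsBaseColouring k G A L R χ X Y) (hGm : G ≤ mm) (hA : A.Nonempty)
    (hopp : balance k A w χ Y * balance k A w χ X ≤ 0) (h45 : μ 45 0 = X)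
    (h46 : μ 46 0 = Y) (h17 : ∀ g ∈ A, μ 17 g = χ g) (h41 : μ 41 0 = balance k A w (μ 16) X)
    (hx : (μ 44 0 = 1 ∧ Balanced k G A w L R (μ 16) X) ∨
        (μ 44 0 = 0 ∧ Exchanged k A w L R χ X Y 0 (μ 16))) :
    Does N B laterProg μ fun μ' => Holds B mm k A w L R μ' ∧
      Frame (chainVars ∪ {39, 40, 42, 47}) μ μ' ∧ Balanced k G A w L R (μ' 16) X := by
  have hsum := d.sum_le
  have hsum0 := d.sum_nonneg
  have hmm := d.mm_three
  have hN := d.N_le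
  refine line_then (by simp) h.bd fun μ₁ e₁ => ?_
  have F₁ : Frame {39, 40, 42, 47} μ μ₁ := fun a ha => by
    simp at ha; rw [← e₁]; simp [ha]
  have b₁ : Bd B μ₁ := by
    rw [← e₁]
    exact (((h.bd.store (by simpa using h.bd _ _)).store (by simpa using h.bd _ _)).store
      (by simp; omega)).store (by simp; omega)
  have h₁ := h.of_frame b₁ F₁ (by rw [F₁.get 16]; exact h.col)
  have c39 : μ₁ 39 0 = X := by simp [← e₁, h45]
  have c40 : μ₁ 40 0 = Y := by simp [← e₁, h46]
  have c42 : μ₁ 42 0 = -1 := by simp [← e₁]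
  have c47 : μ₁ 47 0 = 0 := by simp [← e₁]
  refine (Does.loop (fun n μ' => Holds B mm k A w L R μ' ∧ Frame (chainVars ∪ {47}) μ₁ μ' ∧
    μ' 41 0 = balance k A w (μ' 16) X ∧ 0 ≤ μ' 47 0 ∧ μ' 47 0 ≤ mm ∧ n = (mm - μ' 47 0).toNat ∧
    ((μ' 44 0 = 1 ∧ Balanced k G A w L R (μ' 16) X) ∨
      (μ' 44 0 = 0 ∧ Exchanged k A w L R χ X Y (μ' 47 0) (μ' 16))))
    (fun n μ' hI => hI.1.bd) ?_ (n := mm.toNat) ?_ (by omega)).imp ?_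
  · rintro n μ₂ ⟨h₂, F₂, s₂, l1, l2, rfl, r₂⟩ he
    simp only [eval_mul, eval_sub, eval_var, eval_one, h₂.mm] at he
    obtain ⟨t₂, x₂⟩ : μ₂ 44 0 = 0 ∧ Exchanged k A w L R χ X Y (μ₂ 47 0) (μ₂ 16) := by
      rcases r₂ with ⟨r, -⟩ | r
      · rw [r] at he; simp at he
      · exact r
    rw [t₂, sub_zero, mul_one] at he
    refine (does_laterBody d h₂ hb (by rw [F₂.get 45, F₁.get 45, h45]) (by rw [F₂.get 39, c39])
      (by rw [F₂.get 40, c40]) (by rw [F₂.get 42, c42]) t₂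
      (by rw [F₂.get 17, F₁.get 17]; exact h17) rfl l1 (by omega) s₂ x₂).imp ?_
    rintro μ₃ ⟨h₃, F₃, s₃, l₃, r₃⟩
    refine ⟨(mm - μ₃ 47 0).toNat, by omega, h₃, F₂.trans F₃, s₃, by omega, by omega, rfl, ?_⟩
    rw [l₃]; exact r₃
  · refine ⟨h₁, Frame.refl _ _, ?_, by omega, by omega, by rw [c47, sub_zero], ?_⟩
    · rw [F₁.get 41, F₁.get 16, h41]
    · rw [c47, F₁.get 44, F₁.get 16]; exact hx
  · rintro μ₂ ⟨⟨n, h₂, F₂, s₂, l1, l2, -, r₂⟩, he⟩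
    simp only [eval_mul, eval_sub, eval_var, eval_one, h₂.mm] at he
    refine ⟨h₂, F₁.trans F₂, ?_⟩
    rcases r₂ with ⟨-, r⟩ | ⟨t₂, r⟩
    · exact r
    · rw [t₂, sub_zero, mul_one] at he
      exact Exchanged.balanced hb hopp hA d.w_nonneg
        ⟨r.flip, r.left, r.right, r.zero, fun g hg hgX hlt => r.lt g hg hgX (by omega), r.sign⟩

end Exchange

/-- From a proper colouring to a colour class, variable `45`, of balanced value. -/
def exchangeProg : Prog := selectProg ;; copyProg ;; firstProg ;; laterProg

/-- The arrays that `exchangeProg` changes. -/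
def exchangeVars : Finset ℕ :=
  {16, 17, 32, 33, 34, 35, 36, 37, 38, 39, 40, 41, 42, 43, 44, 45, 46, 47, 48}

theorem does_exchange {N : ℕ} {B mm k G : ℤ} {A : Finset ℤ} {w L R : ℤ → ℤ} {μ : Mem}
    (d : Data N B mm k A w) (hG : IsGroupGraph k G A L R) (hGm : G ≤ mm)
    (hA : A.Nonempty) (h : Holds B mm k A w L R μ)
    (hact : ∀ g, 0 ≤ g → g < mm → (0 < μ 13 g ↔ g ∈ A)) (hc : Complete k A (μ 16))
    (hL : Proper A L (μ 16)) (hR : Proper A R (μ 16)) :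
    Does N B exchangeProg μ fun μ' => Holds B mm k A w L R μ' ∧ Frame exchangeVars μ μ' ∧
      1 ≤ μ' 45 0 ∧ μ' 45 0 ≤ k ∧ Balanced k G A w L R (μ' 16) (μ' 45 0) := by
  refine Does.seq ((does_select d hG h hact hc).imp ?_)
  rintro μ₁ ⟨h₁, F₁, X, Y, x1, y1, hX, hY, hXY, hX0, s₁, hopp⟩
  refine Does.seq ((does_copy d h₁).imp ?_)
  rintro μ₂ ⟨h₂, F₂, c₂⟩
  have e16 : μ₂ 16 = μ 16 := by rw [F₂.get 16, F₁.get 16]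
  have hb : IsBaseColouring k G A L R (μ₂ 16) X Y := by
    rw [e16]; exact ⟨hG, hc, hL, hR, hX, hY, hXY, hX0⟩
  refine Does.seq ((does_first d h₂ hb (by rw [F₂.get 45, x1]) (by rw [F₂.get 46, y1])
    (by rw [F₂.get 41, s₁, e16])).imp ?_)
  rintro μ₃ ⟨h₃, F₃, s₃, r₃⟩
  have x3 : μ₃ 45 0 = X := by rw [F₃.get 45, F₂.get 45, x1]
  refine (does_later d h₃ hb hGm hA (by rw [e16]; exact hopp) x3
    (by rw [F₃.get 46, F₂.get 46, y1]) (by rw [F₃.get 17, F₂.get 16]; exact c₂) s₃ r₃).imp ?_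
  rintro μ₄ ⟨h₄, F₄, r₄⟩
  rw [F₄.get 45, x3]
  exact ⟨h₄, ((F₁.trans F₂ (U := exchangeVars)).trans F₃ (U := exchangeVars)).trans F₄, hX.1, hX.2,
    r₄⟩

end FairDivision

/-! ### The computation of a split -/

namespace FairDivision

open RAM Expr Prog

/-- The items of larger value have larger keys, and among items of equal value those of smaller
index. -/
def itemKey (mm : ℤ) (v : ℤ → ℤ) (g : ℤ) : ℤ := v g * mm - g

theorem itemKey_injOn {mm : ℤ} {A : Finset ℤ} (hA : ∀ g ∈ A, 0 ≤ g ∧ g < mm) (v : ℤ → ℤ) :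
    Set.InjOn (itemKey mm v) A := by
  intro g hg h hh e
  unfold itemKey at e
  obtain ⟨g0, g1⟩ := hA g hg
  obtain ⟨h0, h1⟩ := hA h hh
  have e1 : g = h + (v g - v h) * mm := by linarith
  have e2 := congrArg (· % mm) e1
  simp only [Int.add_mul_emod_self_right] at e2
  rwa [Int.emod_eq_of_lt g0 g1, Int.emod_eq_of_lt h0 h1] at e2

theorem itemKey_lt_iff {mm : ℤ} {v : ℤ → ℤ} {g h : ℤ} :
    itemKey mm v g < itemKey mm v h ↔ 0 < (v h - v g) * mm + (g - h) := by
  unfold itemKey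
  rw [sub_mul]
  omega

theorem itemKey_lt_of_lt {mm : ℤ} {v : ℤ → ℤ} {g h : ℤ} (hg : 0 ≤ g) (hh0 : 0 ≤ h) (hh : h < mm)
    (h' : v g < v h) : itemKey mm v g < itemKey mm v h := by
  rw [itemKey_lt_iff]
  have : 1 * mm ≤ (v h - v g) * mm := mul_le_mul_of_nonneg_right (by omega) (by omega)
  omega

/-- Variable `n` is increased if item `33` has, for the values in array `a`, a larger key than item
`32`. -/
def bumpProg (a n : ℕ) : Prog :=
  Prog.cond ((read a (var 33) - read a (var 32)) * var 30 + (var 32 - var 33))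
    (assign n (var n + 1)) skip

/-- The body of the loop that computes the ranks of item `32` for the values in the arrays `a` and
`b`. -/
def rankBody (a b : ℕ) : Prog :=
  Prog.cond (read 13 (var 33)) (bumpProg a 48 ;; bumpProg b 49) skip ;; assign 33 (var 33 + 1)

/-- The groups of all items are put into the arrays `14` and `15`, and the items are uncoloured. -/
def groupsProg (a b : ℕ) : Prog :=
  assign 32 0 ;;
  loop (var 30 - var 32)
    ((assign 48 0 ;; assign 49 0 ;; assign 33 0) ;;
    loop (var 30 - var 33) (rankBody a b) ;;
    (set 14 (var 32) ((var 48 + 1) / var 31) ;; set 15 (var 32) (var 49 / var 31) ;;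
      set 16 (var 32) 0 ;; assign 32 (var 32 + 1)))

section Groups

variable {N : ℕ} {B mm k : ℤ} {A : Finset ℤ} {μ : Mem} {a b : ℕ}

/-- The number of the items of `A` before `i` with the property `P`. -/
def countBefore (A : Finset ℤ) (i : ℤ) (P : ℤ → Prop) [DecidablePred P] : ℤ :=
  ((A.filter fun h => h < i ∧ P h).card : ℤ)

theorem countBefore_succ (A : Finset ℤ) (i : ℤ) (P : ℤ → Prop) [DecidablePred P] :
    countBefore A (i + 1) P = countBefore A i P + if i ∈ A ∧ P i then 1 else 0 := by
  unfold countBefore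
  split_ifs with h
  · have : (A.filter fun h => h < i + 1 ∧ P h) = insert i (A.filter fun h => h < i ∧ P h) := by
      ext g; simp only [Finset.mem_filter, Finset.mem_insert]; grind
    rw [this, Finset.card_insert_of_notMem (by simp)]
    simp
  · have : (A.filter fun h => h < i + 1 ∧ P h) = A.filter fun h => h < i ∧ P h := by
      refine Finset.filter_congr fun g hg => ?_
      constructor
      · rintro ⟨h1, h2⟩
        refine ⟨?_, h2⟩
        by_contra h3
        obtain rfl : g = i := by omega
        exact h ⟨hg, h2⟩
      · rintro ⟨h1, h2⟩; exact ⟨by omega, h2⟩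
    rw [this, add_zero]

theorem countBefore_nonneg (A : Finset ℤ) (i : ℤ) (P : ℤ → Prop) [DecidablePred P] :
    0 ≤ countBefore A i P := Int.natCast_nonneg _

theorem countBefore_le (hA : ∀ g ∈ A, 0 ≤ g ∧ g < mm) (hm : 0 ≤ mm) (i : ℤ) (P : ℤ → Prop)
    [DecidablePred P] : countBefore A i P ≤ mm := by
  have h1 : (A.filter fun h => h < i ∧ P h) ⊆ Finset.Ico 0 mm :=
    fun g hg => Finset.mem_Ico.2 (hA g (Finset.mem_filter.1 hg).1)
  have h2 := Finset.card_le_card h1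
  rw [Int.card_Ico] at h2
  unfold countBefore
  omega

theorem countBefore_zero (hA : ∀ g ∈ A, 0 ≤ g ∧ g < mm) (P : ℤ → Prop) [DecidablePred P] :
    countBefore A 0 P = 0 := by
  unfold countBefore
  rw [Finset.filter_eq_empty_iff.2]
  · simp
  · rintro g hg ⟨h1, -⟩; have := (hA g hg).1; omega

theorem countBefore_rank (hA : ∀ g ∈ A, 0 ≤ g ∧ g < mm) (key : ℤ → ℤ) (g : ℤ) :
    countBefore A mm (fun h => key g < key h) = rank A key g := by
  unfold countBefore rank
  congr 2
  exact Finset.filter_congr fun h hh => by simp [(hA h hh).2]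

theorem does_bump {a n : ℕ} {i g : ℤ} (hBd : Bd B μ) (h30 : μ 30 0 = mm) (h33 : μ 33 0 = i)
    (h32 : μ 32 0 = g) (hn : |μ n 0 + 1| ≤ B) :
    Does N B (bumpProg a n) μ fun μ' => Bd B μ' ∧ Frame {n} μ μ' ∧
      μ' n 0 = μ n 0 + if itemKey mm (μ a) g < itemKey mm (μ a) i then 1 else 0 := by
  refine Does.cond hBd ?_ ?_
  · intro h
    simp only [eval_add, eval_mul, eval_sub, eval_read, eval_var, h30, h33, h32,
      ← itemKey_lt_iff] at h
    exact Does.line (by simp) hBd ⟨hBd.store (by simpa using hn),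
      fun x hx => by simp at hx; simp [hx], by simp [h]⟩
  · intro h
    simp only [eval_add, eval_mul, eval_sub, eval_read, eval_var, h30, h33, h32,
      ← itemKey_lt_iff] at h
    exact Does.line (by simp) hBd ⟨hBd, Frame.refl _ _, by simp [h]⟩

theorem does_rankBody (hb : b = 10 ∨ b = 11) (hBd : Bd B μ)
    (hA : ∀ g ∈ A, 0 ≤ g ∧ g < mm) (hmB : mm + 1 ≤ B) (h30 : μ 30 0 = mm) {i g : ℤ}
    (h33 : μ 33 0 = i) (h0 : 0 ≤ i) (hi : i < mm) (h32 : μ 32 0 = g) (hact : 0 < μ 13 i ↔ i ∈ A)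
    (h48 : μ 48 0 = countBefore A i fun h => itemKey mm (μ a) g < itemKey mm (μ a) h)
    (h49 : μ 49 0 = countBefore A i fun h => itemKey mm (μ b) g < itemKey mm (μ b) h) :
    Does N B (rankBody a b) μ fun μ' => Bd B μ' ∧ Frame {33, 48, 49} μ μ' ∧ μ' 33 0 = i + 1 ∧
      μ' 48 0 = countBefore A (i + 1) (fun h => itemKey mm (μ a) g < itemKey mm (μ a) h) ∧
      μ' 49 0 = countBefore A (i + 1) fun h => itemKey mm (μ b) g < itemKey mm (μ b) h := by
  have c1 := countBefore_nonneg A i fun h => itemKey mm (μ a) g < itemKey mm (μ a) h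
  have c2 := countBefore_nonneg A i fun h => itemKey mm (μ b) g < itemKey mm (μ b) h
  have c3 := countBefore_le hA (by omega) i fun h => itemKey mm (μ a) g < itemKey mm (μ a) h
  have c4 := countBefore_le hA (by omega) i fun h => itemKey mm (μ b) g < itemKey mm (μ b) h
  have last : ∀ μ₁, Bd B μ₁ → Frame {48, 49} μ μ₁ →
      μ₁ 48 0 = countBefore A (i + 1) (fun h => itemKey mm (μ a) g < itemKey mm (μ a) h) →
      μ₁ 49 0 = countBefore A (i + 1) (fun h => itemKey mm (μ b) g < itemKey mm (μ b) h) →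
      Does N B (assign 33 (var 33 + 1)) μ₁ fun μ' => Bd B μ' ∧ Frame {33, 48, 49} μ μ' ∧
        μ' 33 0 = i + 1 ∧
        μ' 48 0 = countBefore A (i + 1) (fun h => itemKey mm (μ a) g < itemKey mm (μ a) h) ∧
        μ' 49 0 = countBefore A (i + 1) fun h => itemKey mm (μ b) g < itemKey mm (μ b) h := by
    intro μ₁ b₁ F₁ h1 h2
    have e33 : μ₁ 33 0 = i := by rw [F₁.get 33, h33]
    have F : Frame {33} μ₁ ((assign 33 (var 33 + 1)).exec μ₁) := fun x hx => by
      simp at hx; simp [hx]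
    exact Does.line (by simp) b₁ ⟨b₁.store (abs_le.2 (by simp [e33]; omega)), F₁.trans F,
      by simp [e33], by rw [F.get 48, h1], by rw [F.get 49, h2]⟩
  refine Does.seq (Does.cond hBd ?_ ?_)
  · intro h
    simp only [eval_read, eval_var, h33, hact] at h
    refine Does.seq ((does_bump (a := a) hBd h30 h33 h32 (abs_le.2 (by omega))).imp ?_)
    rintro μ₁ ⟨b₁, F₁, r₁⟩
    refine (does_bump (a := b) b₁ (by rw [F₁.get 30, h30]) (by rw [F₁.get 33, h33])
      (by rw [F₁.get 32, h32]) (by rw [F₁.get 49]; exact abs_le.2 (by omega))).imp ?_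
    rintro μ₂ ⟨b₂, F₂, r₂⟩
    refine last μ₂ b₂ (F₁.trans F₂) ?_ ?_
    · rw [F₂.get 48, r₁, countBefore_succ, h48]; simp [h]
    · rw [r₂, F₁.get 49, F₁ b (by rcases hb with rfl | rfl <;> decide), countBefore_succ, h49]
      simp [h]
  · intro h
    simp only [eval_read, eval_var, h33, hact] at h
    refine Does.line (by simp) hBd (last μ hBd (Frame.refl _ _) ?_ ?_)
    · rw [countBefore_succ, h48]; simp [h]
    · rw [countBefore_succ, h49]; simp [h]

theorem does_groups (ha : a = 10 ∨ a = 11) (hb : b = 10 ∨ b = 11) (hBd : Bd B μ)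
    (hA : ∀ g ∈ A, 0 ≤ g ∧ g < mm) (hm : 0 ≤ mm) (hmB : mm + 1 ≤ B) (hmN : mm ≤ N)
    (h30 : μ 30 0 = mm) (h31 : μ 31 0 = k) (hact : ∀ g, 0 ≤ g → g < mm → (0 < μ 13 g ↔ g ∈ A)) :
    Does N B (groupsProg a b) μ fun μ' => Bd B μ' ∧
      Frame {14, 15, 16, 32, 33, 48, 49} μ μ' ∧
      (∀ g, 0 ≤ g → g < mm → μ' 14 g = leftGroup k A (itemKey mm (μ a)) g ∧
        μ' 15 g = rightGroup k A (itemKey mm (μ b)) g ∧ μ' 16 g = 0) ∧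
      ∀ g, g < 0 ∨ mm ≤ g → μ' 16 g = μ 16 g := by
  have hS : ∀ {x}, x = 10 ∨ x = 11 → x ∉ ({14, 15, 16, 32, 33, 48, 49} : Finset ℕ) := by
    rintro x (rfl | rfl) <;> decide
  have hS' : ∀ {x}, x = 10 ∨ x = 11 → x ∉ ({33, 48, 49} : Finset ℕ) := by
    rintro x (rfl | rfl) <;> decide
  refine Does.line_seq (by simp) hBd ?_
  refine (Does.count (n := mm) (i₀ := 0) (fun i μ' => Bd B μ' ∧
    Frame {14, 15, 16, 32, 33, 48, 49} μ μ' ∧ μ' 32 0 = i ∧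
    (∀ g, 0 ≤ g → g < i → μ' 14 g = leftGroup k A (itemKey mm (μ a)) g ∧
      μ' 15 g = rightGroup k A (itemKey mm (μ b)) g ∧ μ' 16 g = 0) ∧
    ∀ g, g < 0 ∨ mm ≤ g → μ' 16 g = μ 16 g) ?_ ?_ hm (by omega) ?_).imp ?_
  · rintro i μ' ⟨h1, F, h2, -⟩
    exact ⟨h1, by simp [F.get 30, h30, h2]⟩
  · exact ⟨hBd.store (by simp; omega), fun x hx => by simp at hx; simp [hx], by simp,
      fun g h0 h1 => by omega, fun g _ => by simp⟩
  · rintro g μ₁ hg0 hg ⟨b₁, F₁, e₁, r₁, o₁⟩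
    refine line_then (by simp) b₁ fun μ₂ e₂ => Does.seq ?_
    have F₁₂ : Frame {33, 48, 49} μ₁ μ₂ := fun x hx => by simp at hx; rw [← e₂]; simp [hx]
    have F₂ := F₁.trans F₁₂ (U := {14, 15, 16, 32, 33, 48, 49})
    have b₂ : Bd B μ₂ := by
      rw [← e₂]
      exact ((b₁.store (by simp; omega)).store (by simp; omega)).store (by simp; omega)
    refine (Does.count (n := mm) (i₀ := 0) (fun i μ' => Bd B μ' ∧ Frame {33, 48, 49} μ₂ μ' ∧
      μ' 33 0 = i ∧
      μ' 48 0 = countBefore A i (fun h => itemKey mm (μ a) g < itemKey mm (μ a) h) ∧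
      μ' 49 0 = countBefore A i fun h => itemKey mm (μ b) g < itemKey mm (μ b) h) ?_ ?_ hm
      (by omega) ?_).imp ?_
    · rintro i μ' ⟨h1, F, h2, -⟩
      exact ⟨h1, by simp [F.get 30, F₂.get 30, h30, h2]⟩
    · rw [countBefore_zero hA, countBefore_zero hA]
      exact ⟨b₂, Frame.refl _ _, by simp [← e₂], by simp [← e₂], by simp [← e₂]⟩
    · rintro i μ₃ hi0 hi ⟨b₃, F₂₃, e33, e48, e49⟩
      have F₃ := F₂.trans F₂₃ (U := {14, 15, 16, 32, 33, 48, 49})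
      rw [← F₃ a (hS ha)] at e48
      rw [← F₃ b (hS hb)] at e49
      refine (does_rankBody hb b₃ hA hmB (by rw [F₃.get 30, h30]) e33 hi0 hi
        (by rw [F₂₃.get 32, F₁₂.get 32, e₁]) (by rw [F₃.get 13]; exact hact i hi0 hi)
        e48 e49).imp ?_
      rintro μ₄ ⟨b₄, F₄, r33, r48, r49⟩
      rw [F₃ a (hS ha)] at r48
      rw [F₃ b (hS hb)] at r49
      exact ⟨b₄, F₂₃.trans F₄, r33, r48, r49⟩
    · rintro μ₃ ⟨b₃, F₂₃, -, e48, e49⟩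
      have F₁₃ := F₁₂.trans F₂₃ (U := {33, 48, 49})
      have c1 := countBefore_le hA hm mm fun h => itemKey mm (μ a) g < itemKey mm (μ a) h
      have c2 := countBefore_le hA hm mm fun h => itemKey mm (μ b) g < itemKey mm (μ b) h
      rw [countBefore_rank hA] at e48 e49 c1 c2
      have c3 := rank_nonneg (A := A) (key := itemKey mm (μ a)) g
      have c4 := rank_nonneg (A := A) (key := itemKey mm (μ b)) g
      have d1 := Int.natAbs_ediv_le_natAbs (rank A (itemKey mm (μ a)) g + 1) k
      have d2 := Int.natAbs_ediv_le_natAbs (rank A (itemKey mm (μ b)) g) k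
      have e30 : μ₃ 30 0 = mm := by rw [F₁₃.get 30, F₁.get 30, h30]
      have e31 : μ₃ 31 0 = k := by rw [F₁₃.get 31, F₁.get 31, h31]
      have e32 : μ₃ 32 0 = g := by rw [F₁₃.get 32, e₁]
      refine Does.line (by simp) b₃ ?_
      have key : (set 14 (var 32) ((var 48 + 1) / var 31) ;; set 15 (var 32) (var 49 / var 31) ;;
          set 16 (var 32) 0 ;; assign 32 (var 32 + 1)).exec μ₃ =
          (((μ₃.store 14 g (leftGroup k A (itemKey mm (μ a)) g)).store 15 g
            (rightGroup k A (itemKey mm (μ b)) g)).store 16 g 0).store 32 0 (g + 1) := by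
        simp [leftGroup, rightGroup, e31, e32, e48, e49]
      rw [key]
      have F : Frame {14, 15, 16, 32} μ₃ ((((μ₃.store 14 g
          (leftGroup k A (itemKey mm (μ a)) g)).store 15 g
          (rightGroup k A (itemKey mm (μ b)) g)).store 16 g 0).store 32 0 (g + 1)) :=
        fun x hx => by simp at hx; simp [hx]
      refine ⟨?_, F₁.trans (F₁₃.trans F (U := {14, 15, 16, 32, 33, 48, 49})), by simp, ?_, ?_⟩
      · refine (((b₃.store ?_).store ?_).store ?_).store (abs_le.2 (by omega))
        · unfold leftGroup; exact abs_le.2 (by omega)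
        · unfold rightGroup; exact abs_le.2 (by omega)
        · simp; omega
      · intro x hx0 hx
        by_cases hxg : x = g
        · subst hxg; simp
        · have := r₁ x hx0 (by omega)
          simpa [hxg, F₁₃.get 14, F₁₃.get 15, F₁₃.get 16] using this
      · intro x hx
        have := o₁ x hx
        have hxg : x ≠ g := by omega
        simpa [hxg, F₁₃.get 16] using this
  · rintro μ' ⟨h1, F, -, h2, h3⟩
    exact ⟨h1, F, h2, h3⟩

end Groups

/-- The computation of a split of the items marked in array `13` into `k` parts (variable `31`) for
the agents with the values in the arrays `a`, `b` and `12`; the split consists of the items whose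
colour, in array `16`, is in variable `45`. -/
def splitProg (a b : ℕ) : Prog := groupsProg a b ;; insertProg ;; exchangeProg

/-- The arrays that `splitProg` changes. -/
def splitVars : Finset ℕ :=
  {14, 15, 16, 17, 32, 33, 34, 35, 36, 37, 38, 39, 40, 41, 42, 43, 44, 45, 46, 47, 48, 49}

theorem does_split {N : ℕ} {B mm k G : ℤ} {A : Finset ℤ} {w : ℤ → ℤ} {μ : Mem} {a b : ℕ}
    (ha : a = 10 ∨ a = 11) (hb : b = 10 ∨ b = 11) (d : Data N B mm k A w)
    (hG : (A.card : ℤ) = k * G - 1) (hBd : Bd B μ) (h30 : μ 30 0 = mm) (h31 : μ 31 0 = k)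
    (h12 : μ 12 = w) (hact : ∀ g, 0 ≤ g → g < mm → (0 < μ 13 g ↔ g ∈ A))
    (h16 : ∀ g, g < 0 ∨ mm ≤ g → μ 16 g = 0) :
    Does N B (splitProg a b) μ fun μ' => Bd B μ' ∧ Frame splitVars μ μ' ∧ 1 ≤ μ' 45 0 ∧
      (∀ g, g ∉ A → μ' 16 g = 0) ∧
      IsSplit k G A (itemKey mm (μ a)) (itemKey mm (μ b)) w
        (A.filter fun g => μ' 16 g = μ' 45 0) := by
  have hk2 := d.k_two
  have hsum := d.sum_le
  have hsum0 := d.sum_nonneg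
  have hmm := d.mm_three
  have hN := d.N_le
  have hcard := d.card_le
  have hG1 : 1 ≤ G := by
    by_contra hc
    have := mul_le_mul_of_nonneg_left (show G ≤ 0 by omega) (show 0 ≤ k by omega)
    omega
  have hkG : 2 * G ≤ k * G := mul_le_mul_of_nonneg_right hk2 (by omega)
  refine Does.seq ((does_groups ha hb hBd d.sub (by omega) (by omega) (by omega) h30 h31 hact).imp
    ?_)
  rintro μ₁ ⟨b₁, F₁, r₁, o₁⟩
  have z₁ : ∀ g, μ₁ 16 g = 0 := by
    intro g
    by_cases hg : 0 ≤ g ∧ g < mm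
    · exact (r₁ g hg.1 hg.2).2.2
    · rw [o₁ g (by omega), h16 g (by omega)]
  have h₁ : Holds B mm k A w (μ₁ 14) (μ₁ 15) μ₁ :=
    ⟨b₁, by rw [F₁.get 30, h30], by rw [F₁.get 31, h31], by rw [F₁.get 12, h12], rfl, rfl,
      fun g _ => z₁ g⟩
  have hL : ∀ g ∈ A, μ₁ 14 g = leftGroup k A (itemKey mm (μ a)) g :=
    fun g hg => (r₁ g (d.sub g hg).1 (d.sub g hg).2).1
  have hR : ∀ g ∈ A, μ₁ 15 g = rightGroup k A (itemKey mm (μ b)) g :=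
    fun g hg => (r₁ g (d.sub g hg).1 (d.sub g hg).2).2.1
  have hGr := isGroupGraph_groups hk2 hG1 hG (itemKey_injOn d.sub (μ a)) (itemKey_injOn d.sub (μ b))
    hL hR
  refine Does.seq ((does_insert d hGr h₁ (by rw [F₁.get 13]; exact hact) z₁).imp ?_)
  rintro μ₂ ⟨h₂, F₂, L₂, R₂, c₂⟩
  have hne : A.Nonempty := by
    rw [← Finset.card_pos]; omega
  refine (does_exchange d hGr (by omega) hne h₂ (by rw [F₂.get 13, F₁.get 13]; exact hact) c₂ L₂
    R₂).imp ?_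
  rintro μ₃ ⟨h₃, F₃, x1, x2, r₃⟩
  exact ⟨h₃.bd, (F₁.trans F₂ (U := splitVars)).trans F₃, x1, h₃.col,
    isSplit_of_colouring hGr hL hR r₃.complete r₃.right x1 x2 r₃.counts r₃.value⟩

end FairDivision

/-! ### Envy-freeness for two successive splits -/

namespace FairDivision

section TwoSplits

variable {k G G' mm m : ℤ} {A A' C D : Finset ℤ} {w w' w₂ : ℤ → ℤ}

theorem itemKey_up (hA : ∀ g ∈ A, 0 ≤ g ∧ g < mm) {v : ℤ → ℤ} {t : ℤ} :
    ∀ g ∈ A.filter (fun g => t < v g), ∀ h ∈ A, itemKey mm v g < itemKey mm v h →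
      h ∈ A.filter fun g => t < v g := by
  intro g hg h hh hlt
  rw [Finset.mem_filter] at hg ⊢
  refine ⟨hh, ?_⟩
  by_contra hc
  exact hlt.not_gt (itemKey_lt_of_lt (hA h hh).1 (hA g hg.1).1 (hA g hg.1).2 (by omega))

/-- The first agent of the first split and the second agent of the other one. -/
theorem card_prefix_left (h : IsSplit 3 G A (itemKey mm w) w' w₂ C)
    (h' : IsSplit 2 G' A' w' (itemKey mm w) w₂ D) (hA : ∀ g ∈ A, 0 ≤ g ∧ g < mm)
    (hA' : ∀ g ∈ A', 0 ≤ g ∧ g < mm) (hc : (A.card : ℤ) = 3 * G - 1)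
    (hc' : (A'.card : ℤ) = 2 * G' - 1) {t : ℤ}
    (hAA : (A'.filter fun g => t < w g) = (A \ C).filter fun g => t < w g) :
    ((C.filter fun g => t < w g).card ≤ (D.filter fun g => t < w g).card + 2 ∧
      (C.filter fun g => t < w g).card ≤ ((A' \ D).filter fun g => t < w g).card + 2) ∧
    ((D.filter fun g => t < w g).card ≤ (C.filter fun g => t < w g).card + 2 ∧
      (D.filter fun g => t < w g).card ≤ ((A' \ D).filter fun g => t < w g).card + 2) ∧
    (((A' \ D).filter fun g => t < w g).card ≤ (C.filter fun g => t < w g).card + 2 ∧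
      ((A' \ D).filter fun g => t < w g).card ≤ (D.filter fun g => t < w g).card + 2) := by
  have e1 := h.left_prefix (by norm_num) hc (itemKey_injOn hA w) (Finset.filter_subset _ _)
    (itemKey_up hA (t := t)) (J := ((A.filter fun g => t < w g).card + 1) / 3)
    (r := ((A.filter fun g => t < w g).card + 1) % 3) (by omega) (by omega) (by omega)
  have e2 := h'.right_prefix (by norm_num) hc' (itemKey_injOn hA' w) (Finset.filter_subset _ _)
    (itemKey_up hA' (t := t)) (J := ((A'.filter fun g => t < w g).card) / 2)
    (r := ((A'.filter fun g => t < w g).card) % 2) (by omega) (by omega) (by omega)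
  have i1 : (A.filter fun g => t < w g) ∩ C = C.filter fun g => t < w g := by
    ext g; have := @h.subset g; simp only [Finset.mem_inter, Finset.mem_filter]; tauto
  have i2 : (A'.filter fun g => t < w g) ∩ D = D.filter fun g => t < w g := by
    ext g; have := @h'.subset g; simp only [Finset.mem_inter, Finset.mem_filter]; tauto
  have s1 : ((A \ C).filter fun g => t < w g).card + (C.filter fun g => t < w g).card =
      (A.filter fun g => t < w g).card := by
    rw [← Finset.card_union_of_disjoint
      (Finset.disjoint_filter_filter Finset.sdiff_disjoint), ← Finset.filter_union,
      Finset.sdiff_union_of_subset h.subset]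
  have s2 : ((A' \ D).filter fun g => t < w g).card + (D.filter fun g => t < w g).card =
      (A'.filter fun g => t < w g).card := by
    rw [← Finset.card_union_of_disjoint
      (Finset.disjoint_filter_filter Finset.sdiff_disjoint), ← Finset.filter_union,
      Finset.sdiff_union_of_subset h'.subset]
  rw [i1] at e1
  rw [i2] at e2
  rw [hAA] at s2 e2
  omega

/-- The second agent of the first split and the first agent of the other one. -/
theorem card_prefix_right (h : IsSplit 3 G A w' (itemKey mm w) w₂ C)
    (h' : IsSplit 2 G' A' (itemKey mm w) w' w₂ D) (hA : ∀ g ∈ A, 0 ≤ g ∧ g < mm)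
    (hA' : ∀ g ∈ A', 0 ≤ g ∧ g < mm) (hc : (A.card : ℤ) = 3 * G - 1)
    (hc' : (A'.card : ℤ) = 2 * G' - 1) {t : ℤ}
    (hAA : (A'.filter fun g => t < w g) = (A \ C).filter fun g => t < w g) :
    ((C.filter fun g => t < w g).card ≤ (D.filter fun g => t < w g).card + 2 ∧
      (C.filter fun g => t < w g).card ≤ ((A' \ D).filter fun g => t < w g).card + 2) ∧
    ((D.filter fun g => t < w g).card ≤ (C.filter fun g => t < w g).card + 2 ∧
      (D.filter fun g => t < w g).card ≤ ((A' \ D).filter fun g => t < w g).card + 2) ∧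
    (((A' \ D).filter fun g => t < w g).card ≤ (C.filter fun g => t < w g).card + 2 ∧
      ((A' \ D).filter fun g => t < w g).card ≤ (D.filter fun g => t < w g).card + 2) := by
  have e1 := h.right_prefix (by norm_num) hc (itemKey_injOn hA w) (Finset.filter_subset _ _)
    (itemKey_up hA (t := t)) (J := ((A.filter fun g => t < w g).card) / 3)
    (r := ((A.filter fun g => t < w g).card) % 3) (by omega) (by omega) (by omega)
  have e2 := h'.left_prefix (by norm_num) hc' (itemKey_injOn hA' w) (Finset.filter_subset _ _)
    (itemKey_up hA' (t := t)) (J := ((A'.filter fun g => t < w g).card + 1) / 2)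
    (r := ((A'.filter fun g => t < w g).card + 1) % 2) (by omega) (by omega) (by omega)
  have i1 : (A.filter fun g => t < w g) ∩ C = C.filter fun g => t < w g := by
    ext g; have := @h.subset g; simp only [Finset.mem_inter, Finset.mem_filter]; tauto
  have i2 : (A'.filter fun g => t < w g) ∩ D = D.filter fun g => t < w g := by
    ext g; have := @h'.subset g; simp only [Finset.mem_inter, Finset.mem_filter]; tauto
  have s1 : ((A \ C).filter fun g => t < w g).card + (C.filter fun g => t < w g).card =
      (A.filter fun g => t < w g).card := by
    rw [← Finset.card_union_of_disjoint
      (Finset.disjoint_filter_filter Finset.sdiff_disjoint), ← Finset.filter_union,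
      Finset.sdiff_union_of_subset h.subset]
  have s2 : ((A' \ D).filter fun g => t < w g).card + (D.filter fun g => t < w g).card =
      (A'.filter fun g => t < w g).card := by
    rw [← Finset.card_union_of_disjoint
      (Finset.disjoint_filter_filter Finset.sdiff_disjoint), ← Finset.filter_union,
      Finset.sdiff_union_of_subset h'.subset]
  rw [i1] at e1
  rw [i2] at e2
  rw [hAA] at s2 e2
  omega

/-- No agent with values `w` envies any of the three sets for another one. -/
def NoEnvyAmong (w : ℤ → ℤ) (P Q R : Finset ℤ) : Prop :=
  (NoEnvy w P Q ∧ NoEnvy w P R) ∧ (NoEnvy w Q P ∧ NoEnvy w Q R) ∧ (NoEnvy w R P ∧ NoEnvy w R Q)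

theorem NoEnvyAmong.swap {P Q R : Finset ℤ} (h : NoEnvyAmong w P Q R) : NoEnvyAmong w P R Q := by
  unfold NoEnvyAmong at *
  tauto

theorem noEnvyAmong_of_card_le (hw : ∀ g, 0 ≤ w g) {P Q R : Finset ℤ} (hPQ : Disjoint P Q)
    (hPR : Disjoint P R) (hQR : Disjoint Q R)
    (h : ∀ t, 0 ≤ t → ((P.filter fun g => t < w g).card ≤ (Q.filter fun g => t < w g).card + 2 ∧
      (P.filter fun g => t < w g).card ≤ (R.filter fun g => t < w g).card + 2) ∧
    ((Q.filter fun g => t < w g).card ≤ (P.filter fun g => t < w g).card + 2 ∧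
      (Q.filter fun g => t < w g).card ≤ (R.filter fun g => t < w g).card + 2) ∧
    ((R.filter fun g => t < w g).card ≤ (P.filter fun g => t < w g).card + 2 ∧
      (R.filter fun g => t < w g).card ≤ (Q.filter fun g => t < w g).card + 2)) :
    NoEnvyAmong w P Q R :=
  ⟨⟨noEnvy_of_card_le hw hPQ fun t ht => (h t ht).2.1.1,
    noEnvy_of_card_le hw hPR fun t ht => (h t ht).2.2.1⟩,
   ⟨noEnvy_of_card_le hw hPQ.symm fun t ht => (h t ht).1.1,
    noEnvy_of_card_le hw hQR fun t ht => (h t ht).2.2.2⟩,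
   ⟨noEnvy_of_card_le hw hPR.symm fun t ht => (h t ht).1.2,
    noEnvy_of_card_le hw hQR.symm fun t ht => (h t ht).2.1.2⟩⟩

/-- The agent whose values are used for balancing: the set `C` is close to the average up to half
an item `y`, and the larger one, `P`, of the other two sets exceeds the smaller one by at most the
item `y'`. -/
theorem noEnvyAmong_of_sum_le (hw : ∀ g, 0 ≤ w g) {C P Q : Finset ℤ} (hCP : Disjoint C P)
    (hPQ : Disjoint P Q) {y y' : ℤ} (hy' : y' ∈ P)
    (h0 : ∑ g ∈ Q, w g ≤ ∑ g ∈ P, w g) (h1 : ∑ g ∈ P, w g ≤ ∑ g ∈ Q, w g + w y')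
    (h : (y ∈ C ∧ ∑ g ∈ P, w g + ∑ g ∈ Q, w g ≤ 2 * ∑ g ∈ C, w g ∧
        4 * ∑ g ∈ C, w g ≤ 2 * (∑ g ∈ P, w g + ∑ g ∈ Q, w g) + 3 * w y) ∨
      (y ∉ C ∧ 2 * ∑ g ∈ C, w g ≤ ∑ g ∈ P, w g + ∑ g ∈ Q, w g ∧
        2 * (∑ g ∈ P, w g + ∑ g ∈ Q, w g) ≤ 4 * ∑ g ∈ C, w g + 3 * w y)) :
    NoEnvyAmong w C P Q := by
  have hy0 := hw y
  have hy0' := hw y'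
  have yC : y' ∉ C := fun h => Finset.disjoint_left.1 hCP h hy'
  have yQ : y' ∉ Q := fun h => Finset.disjoint_left.1 hPQ hy' h
  -- `P` and `Q` do not depend on the case
  have hQP : NoEnvy w Q P := noEnvy_of_sum_le (S := {y'}) (T := ∅) (by simpa using yQ) (by simp)
    (by simp) (by simp) (by simp; omega)
  have hPQ' : NoEnvy w P Q := noEnvy_of_sum_le (S := ∅) (T := ∅) (by simp) (by simp)
    (by simp) (by simp) (by simp; omega)
  rcases h with ⟨hy, h2, h3⟩ | ⟨hy, h2, h3⟩
  · have yP : y ∉ P := fun h => Finset.disjoint_left.1 hCP hy h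
    refine ⟨⟨?_, ?_⟩, ⟨?_, hPQ'⟩, ⟨?_, hQP⟩⟩
    · exact noEnvy_of_sum_le (S := {y'}) (T := ∅) (by simpa using yC) (by simp)
        (by simp) (by simp) (by simp; omega)
    · exact noEnvy_of_sum_le (S := ∅) (T := ∅) (by simp) (by simp)
        (by simp) (by simp) (by simp; omega)
    · exact noEnvy_of_sum_le (S := {y}) (T := ∅) (by simpa using yP) (by simp)
        (by simp) (by simp) (by simp; omega)
    · exact noEnvy_of_sum_le (S := {y'}) (T := {y}) (by simpa using yQ) (by simpa using hy)
        (by simp) (by simp) (by simp; omega)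
  · refine ⟨⟨?_, ?_⟩, ⟨?_, hPQ'⟩, ⟨?_, hQP⟩⟩
    · exact noEnvy_of_sum_le (S := {y}) (T := {y'}) (by simpa using hy) (by simpa using hy')
        (by simp) (by simp) (by simp; omega)
    · exact noEnvy_of_sum_le (S := {y}) (T := ∅) (by simpa using hy) (by simp)
        (by simp) (by simp) (by simp; omega)
    · exact noEnvy_of_sum_le (S := ∅) (T := ∅) (by simp) (by simp)
        (by simp) (by simp) (by simp; omega)
    · exact noEnvy_of_sum_le (S := {y'}) (T := ∅) (by simpa using yQ) (by simp)
        (by simp) (by simp) (by simp; omega)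

/-- `A'` consists of the items of `A` that are not in `C` and possibly of an item without value. -/
theorem noEnvyAmong_value {keyL keyR keyL' keyR' : ℤ → ℤ}
    (h : IsSplit 3 G A keyL keyR w C) (h' : IsSplit 2 G' A' keyL' keyR' w D) (hw : ∀ g, 0 ≤ w g)
    (hCA : Disjoint C A') (hsum : ∑ g ∈ A', w g = ∑ g ∈ A \ C, w g) :
    NoEnvyAmong w C D (A' \ D) := by
  obtain ⟨y, hy, y1, y2, y3⟩ := h.value
  obtain ⟨y', hy', z1, z2, z3⟩ := h'.value
  have s1 := Finset.sum_sdiff (f := w) h.subset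
  have s2 := Finset.sum_sdiff (f := w) h'.subset
  have dCD : Disjoint C D := hCA.mono_right h'.subset
  have dCE : Disjoint C (A' \ D) := hCA.mono_right Finset.sdiff_subset
  have dDE : Disjoint D (A' \ D) := Finset.disjoint_sdiff
  rw [← hsum] at s1
  have a1 := le_abs_self (3 * ∑ g ∈ C, w g - ∑ g ∈ A, w g)
  have a2 := neg_abs_le (3 * ∑ g ∈ C, w g - ∑ g ∈ A, w g)
  have a3 := le_abs_self (2 * ∑ g ∈ D, w g - ∑ g ∈ A', w g)
  have a4 := neg_abs_le (2 * ∑ g ∈ D, w g - ∑ g ∈ A', w g)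
  have hcase : (y ∈ C ∧ ∑ g ∈ A', w g ≤ 2 * ∑ g ∈ C, w g ∧
        4 * ∑ g ∈ C, w g ≤ 2 * ∑ g ∈ A', w g + 3 * w y) ∨
      (y ∉ C ∧ 2 * ∑ g ∈ C, w g ≤ ∑ g ∈ A', w g ∧
        2 * ∑ g ∈ A', w g ≤ 4 * ∑ g ∈ C, w g + 3 * w y) := by
    by_cases hyC : y ∈ C
    · left
      have : ¬ (3 * ∑ g ∈ C, w g - ∑ g ∈ A, w g < 0) := fun h => y3 h hyC
      exact ⟨hyC, by omega, by omega⟩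
    · right
      have : ¬ (0 < 3 * ∑ g ∈ C, w g - ∑ g ∈ A, w g) := fun h => hyC (y2 h)
      exact ⟨hyC, by omega, by omega⟩
  rw [← s2] at hcase
  by_cases hyD : y' ∈ D
  · have : ¬ (2 * ∑ g ∈ D, w g - ∑ g ∈ A', w g < 0) := fun h => z3 h hyD
    rw [add_comm] at hcase
    exact noEnvyAmong_of_sum_le hw dCD dDE hyD (by omega) (by omega) hcase
  · have : ¬ (0 < 2 * ∑ g ∈ D, w g - ∑ g ∈ A', w g) := fun h => hyD (z2 h)
    exact (noEnvyAmong_of_sum_le hw dCE dDE.symm (Finset.mem_sdiff.2 ⟨hy', hyD⟩) (by omega)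
      (by omega) hcase).swap

end TwoSplits

/-- The `s`-th cyclic shift of a colouring of the items by the agents. -/
def cyclicAllocation {m : ℕ} (c : Fin m → Fin 3) (s : Fin 3) : Allocation 3 m := fun g => c g + s

theorem sum_eq_sum_fin {m : ℕ} {w : ℤ → ℤ} (hw : ∀ g, g < 0 ∨ (m : ℤ) ≤ g → w g = 0)
    (F : Finset ℤ) :
    ∑ g ∈ F, w g =
      ∑ g ∈ (Finset.univ.filter fun g : Fin m => ((g : ℕ) : ℤ) ∈ F), w ((g : ℕ) : ℤ) := by
  have hinj : Function.Injective fun g : Fin m => ((g : ℕ) : ℤ) := fun a b h =>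
    Fin.ext (by simpa using h)
  rw [← Finset.sum_image (f := w) (g := fun g : Fin m => ((g : ℕ) : ℤ)) hinj.injOn]
  refine (Finset.sum_subset ?_ ?_).symm
  · intro x hx
    obtain ⟨g, hg, rfl⟩ := Finset.mem_image.1 hx
    exact (Finset.mem_filter.1 hg).2
  · intro x hx hx'
    refine hw x ?_
    by_contra hc
    refine hx' (Finset.mem_image.2 ⟨⟨x.toNat, by omega⟩, Finset.mem_filter.2 ⟨Finset.mem_univ _, ?_⟩,
      ?_⟩)
    · simpa [Int.toNat_of_nonneg (show 0 ≤ x by omega)] using hx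
    · simp; omega

theorem isEF_of_noEnvy {m : ℕ} {v : Profile 3 m} {w : Fin 3 → ℤ → ℤ} {P : Fin 3 → ℝ}
    (hP : ∀ i, 0 < P i) (hv : ∀ i g, (v i g : ℝ) * P i = w i ((g : ℕ) : ℤ))
    (hw : ∀ i g, g < 0 ∨ (m : ℤ) ≤ g → w i g = 0) {K : Fin 3 → Finset ℤ} {c : Fin m → Fin 3}
    (hK : ∀ j (g : Fin m), ((g : ℕ) : ℤ) ∈ K j ↔ c g = j)
    (h : ∀ i j j', j ≠ j' → NoEnvy (w i) (K j) (K j')) (s : Fin 3) :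
    IsEF 1 1 v (cyclicAllocation c s) := by
  intro i j
  by_cases hij : i = j
  · subst hij; exact ⟨∅, ∅, by simp, by simp, by simp, by simp, by simp⟩
  obtain ⟨S, T, h1, h2, h3, h4, h5⟩ := h i (i - s) (j - s) fun e => hij (sub_left_injective e)
  have hcard : ∀ F : Finset ℤ, (Finset.univ.filter fun g : Fin m => ((g : ℕ) : ℤ) ∈ F).card ≤
      F.card := fun F => Finset.card_le_card_of_injOn (fun g : Fin m => ((g : ℕ) : ℤ))
        (fun g hg => by simpa using hg) fun a _ b _ h => Fin.ext (by simpa using h)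
  have hmem : ∀ (a : Fin 3) (g : Fin m), g ∈ (cyclicAllocation c s).bundle a ↔
      ((g : ℕ) : ℤ) ∈ K (a - s) := by
    intro a g
    rw [hK, Allocation.bundle, Finset.mem_filter, cyclicAllocation, eq_sub_iff_add_eq]
    simp
  refine ⟨Finset.univ.filter fun g : Fin m => ((g : ℕ) : ℤ) ∈ S,
    Finset.univ.filter fun g : Fin m => ((g : ℕ) : ℤ) ∈ T, ?_, ?_, (hcard S).trans h3,
    (hcard T).trans h4, ?_⟩
  · rw [Finset.disjoint_left]
    intro g hg hg'
    exact Finset.disjoint_left.1 h1 (Finset.mem_filter.1 hg).2 ((hmem i g).1 hg')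
  · intro g hg
    exact (hmem j g).2 (h2 (Finset.mem_filter.1 hg).2)
  · have e1 : (cyclicAllocation c s).bundle j \ (Finset.univ.filter fun g : Fin m =>
        ((g : ℕ) : ℤ) ∈ T) = Finset.univ.filter fun g : Fin m => ((g : ℕ) : ℤ) ∈ K (j - s) \ T := by
      ext g; simp [hmem]
    have e2 : (cyclicAllocation c s).bundle i ∪ (Finset.univ.filter fun g : Fin m =>
        ((g : ℕ) : ℤ) ∈ S) = Finset.univ.filter fun g : Fin m => ((g : ℕ) : ℤ) ∈ K (i - s) ∪ S := by
      ext g; simp [hmem]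
    have e3 : ∀ F : Finset (Fin m), (((v i).value F : ℝ≥0) : ℝ) * P i =
        ((∑ g ∈ F, w i ((g : ℕ) : ℤ) : ℤ) : ℝ) := by
      intro F
      unfold Valuation.value
      push_cast
      rw [Finset.sum_mul]
      exact Finset.sum_congr rfl fun g _ => hv i g
    rw [e1, e2, ← NNReal.coe_le_coe]
    refine le_of_mul_le_mul_right ?_ (hP i)
    rw [e3, e3, ← sum_eq_sum_fin (hw i), ← sum_eq_sum_fin (hw i)]
    exact_mod_cast h5

end FairDivision

/-! ### The program -/

namespace FairDivision

open RAM Expr Prog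

/-- The rational values with the numerators and denominators in the arrays `num` and `den` are
multiplied by the product of the denominators, and put into array `out`. The number of items is
variable `52`. -/
def scaleProg (num den out : ℕ) : Prog :=
  (assign 50 1 ;; assign 32 0) ;;
  loop (var 52 - var 32) (assign 50 (var 50 * read den (var 32)) ;; assign 32 (var 32 + 1)) ;;
  assign 32 0 ;;
  loop (var 52 - var 32)
    (set out (var 32) (read num (var 32) * (var 50 / read den (var 32))) ;; assign 32 (var 32 + 1))

/-- The number of items is rounded up to `3 * G - 1`, and these items are marked in array `13`. -/
def markProg : Prog :=
  (assign 30 (var 52 + 3) ;; assign 31 3 ;; assign 32 0) ;;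
  loop (var 52 / 3 * 3 + 2 - var 32) (set 13 (var 32) 1 ;; assign 32 (var 32 + 1))

/-- The marks of the items of the first split are removed, and if an even number of marks is left
then an additional item is marked. -/
def removeProg : Prog :=
  (assign 51 0 ;; assign 32 0) ;;
  loop (var 30 - var 32)
    (cond (read 13 (var 32))
      (cond (eqv (read 16 (var 32)) (var 45)) (set 13 (var 32) 0) (assign 51 (1 - var 51))) skip ;;
      assign 32 (var 32 + 1)) ;;
  (set 13 (var 52 + 2) (1 - var 51) ;; assign 31 2)

/-- The three cyclic shifts of the colouring, with probability `1 / 3` each, are put into the arrays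
`0` to `3`. -/
def writeProg : Prog :=
  assign 32 0 ;;
  loop (var 52 - var 32)
    (cond (read 13 (var 32)) (cond (eqv (read 16 (var 32)) (var 45)) (assign 51 1) (assign 51 2))
      (assign 51 0) ;;
    set 3 (var 32) (var 51) ;;
    set 3 (var 52 + var 32) (var 51 + 1 - 3 * ((var 51 + 1) / 3)) ;;
    set 3 (2 * var 52 + var 32) (var 51 + 2 - 3 * ((var 51 + 2) / 3)) ;;
    assign 32 (var 32 + 1)) ;;
  (assign 0 3 ;; set 1 0 1 ;; set 1 1 1 ;; set 1 2 1 ;; set 2 0 3 ;; set 2 1 3 ;; set 2 2 3)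

/-- The program that computes the output of the mechanism: the agents `0` and `1` are the left and
the right agent of the first split and change their roles in the second one. -/
def mainProg : Prog :=
  assign 52 (var 0) ;; scaleProg 1 4 10 ;; scaleProg 2 5 11 ;; scaleProg 3 6 12 ;; markProg ;;
  splitProg 10 11 ;; removeProg ;; splitProg 11 10 ;; writeProg

section Main

variable {N : ℕ} {B m : ℤ} {μ : Mem}

theorem prod_Ico_succ (f : ℤ → ℤ) {i : ℤ} (hi : 0 ≤ i) :
    ∏ g ∈ Finset.Ico 0 (i + 1), f g = (∏ g ∈ Finset.Ico 0 i, f g) * f i := by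
  have : Finset.Ico 0 (i + 1) = insert i (Finset.Ico 0 i) := by
    ext; simp only [Finset.mem_Ico, Finset.mem_insert]; omega
  rw [this, Finset.prod_insert (by simp), mul_comm]

theorem does_scale {num den out : ℕ} (hnum : num ≤ 6) (hden : den ≤ 6) (hout : 10 ≤ out)
    (hout' : out ≤ 12) (hBd : Bd B μ) (h52 : μ 52 0 = m) (hm : 0 ≤ m) (hN : m ≤ N) (hmB : m + 1 ≤ B)
    (hpos : ∀ g, 0 ≤ g → g < m → 0 < μ den g) (hP : ∏ g ∈ Finset.Ico 0 m, μ den g ≤ B)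
    (hB : ∀ g, 0 ≤ g → g < m →
      |μ num g * ((∏ g ∈ Finset.Ico 0 m, μ den g) / μ den g)| ≤ B) :
    Does N B (scaleProg num den out) μ fun μ' => Bd B μ' ∧ Frame {32, 50, out} μ μ' ∧
      (∀ g, 0 ≤ g → g < m → μ' out g = μ num g * ((∏ g ∈ Finset.Ico 0 m, μ den g) / μ den g)) ∧
      ∀ g, g < 0 ∨ m ≤ g → μ' out g = μ out g := by
  have n1 : num ≠ 32 := by omega
  have n2 : num ≠ 50 := by omega
  have n3 : num ≠ out := by omega
  have d1 : den ≠ 32 := by omega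
  have d2 : den ≠ 50 := by omega
  have d3 : den ≠ out := by omega
  have o1 : out ≠ 32 := by omega
  have o2 : out ≠ 50 := by omega
  have o3 : 52 ≠ out := by omega
  have o4 : 50 ≠ out := by omega
  have o5 : 32 ≠ out := by omega
  have hPi : ∀ i, 0 ≤ i → i ≤ m → 0 < ∏ g ∈ Finset.Ico 0 i, μ den g ∧
      ∏ g ∈ Finset.Ico 0 i, μ den g ≤ B := by
    intro i hi hi'
    have pos : ∀ j, j ≤ m → 0 < ∏ g ∈ Finset.Ico 0 j, μ den g := fun j hj =>
      Finset.prod_pos fun g hg => hpos g (Finset.mem_Ico.1 hg).1 (by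
        have := (Finset.mem_Ico.1 hg).2; omega)
    refine ⟨pos i hi', le_trans (Int.le_of_dvd (pos m le_rfl) ?_) hP⟩
    exact Finset.prod_dvd_prod_of_subset _ _ _ (Finset.Ico_subset_Ico le_rfl hi')
  refine line_then (by simp) hBd fun μ₁ e₁ => Does.seq ?_
  have F₁ : Frame {32, 50} μ μ₁ := fun x hx => by simp at hx; rw [← e₁]; simp [hx]
  have b₁ : Bd B μ₁ := by
    rw [← e₁]; exact (hBd.store (by simp; omega)).store (by simp; omega)
  refine (Does.count (n := m) (i₀ := 0) (fun i μ' => Bd B μ' ∧ Frame {32, 50} μ μ' ∧ μ' 32 0 = i ∧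
    μ' 50 0 = ∏ g ∈ Finset.Ico 0 i, μ den g) ?_ ?_ hm (by omega) ?_).imp ?_
  · rintro i μ' ⟨h1, F, h2, -⟩
    exact ⟨h1, by simp [F.get 52, h52, h2]⟩
  · exact ⟨b₁, F₁, by simp [← e₁], by simp [← e₁]⟩
  · rintro i μ₂ hi0 hi ⟨b₂, F₂, e32, e50⟩
    have e : (assign 50 (var 50 * read den (var 32)) ;; assign 32 (var 32 + 1)).exec μ₂ =
        (μ₂.store 50 0 (∏ g ∈ Finset.Ico 0 (i + 1), μ den g)).store 32 0 (i + 1) := by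
      simp [e32, e50, prod_Ico_succ _ hi0, F₂ den (by simp [d1, d2])]
    refine Does.line (by simp) b₂ ?_
    rw [e]
    have F : Frame {32, 50} μ₂ ((μ₂.store 50 0 (∏ g ∈ Finset.Ico 0 (i + 1), μ den g)).store 32 0
      (i + 1)) := fun x hx => by simp at hx; simp [hx]
    have := hPi (i + 1) (by omega) (by omega)
    exact ⟨(b₂.store (abs_le.2 (by omega))).store (abs_le.2 (by omega)), F₂.trans F, by simp,
      by simp⟩
  · rintro μ₂ ⟨b₂, F₂, -, e50⟩
    refine line_then (by simp) b₂ fun μ₃ e₃ => ?_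
    have F₂₃ : Frame {32} μ₂ μ₃ := fun x hx => by simp at hx; rw [← e₃]; simp [hx]
    have b₃ : Bd B μ₃ := by
      rw [← e₃]; exact b₂.store (by simp; omega)
    have F₃ : Frame {32, 50} μ μ₃ := F₂.trans F₂₃
    refine (Does.count (n := m) (i₀ := 0) (fun i μ' => Bd B μ' ∧ Frame {32, out} μ₃ μ' ∧
      μ' 32 0 = i ∧ (∀ g, 0 ≤ g → g < i →
        μ' out g = μ num g * ((∏ g ∈ Finset.Ico 0 m, μ den g) / μ den g)) ∧
      ∀ g, g < 0 ∨ m ≤ g → μ' out g = μ out g) ?_ ?_ hm (by omega) ?_).imp ?_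
    · rintro i μ' ⟨h1, F, h2, -⟩
      exact ⟨h1, by simp [F 52 (by simp [o3]), F₃.get 52, h52, h2]⟩
    · exact ⟨b₃, Frame.refl _ _, by simp [← e₃], fun g h0 h1 => by omega,
        fun g _ => by rw [F₃ out (by simp [o1, o2])]⟩
    · rintro i μ₄ hi0 hi ⟨b₄, F₄, e32, r₄, z₄⟩
      have e : (set out (var 32) (read num (var 32) * (var 50 / read den (var 32))) ;;
          assign 32 (var 32 + 1)).exec μ₄ = (μ₄.store out i
            (μ num i * ((∏ g ∈ Finset.Ico 0 m, μ den g) / μ den i))).store 32 0 (i + 1) := by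
        simp [e32, F₄ num (by simp [n1, n3]), F₄ den (by simp [d1, d3]), F₄ 50 (by simp [o4]),
          F₃ num (by simp [n1, n2]), F₃ den (by simp [d1, d2]), F₂₃.get 50, e50, o5]
      refine Does.line (by simp) b₄ ?_
      rw [e]
      have F : Frame {32, out} μ₄ ((μ₄.store out i
            (μ num i * ((∏ g ∈ Finset.Ico 0 m, μ den g) / μ den i))).store 32 0 (i + 1)) :=
        fun x hx => by simp at hx; simp [hx]
      refine ⟨(b₄.store (hB i hi0 hi)).store (abs_le.2 (by omega)),
        fun x hx => (F x hx).trans (F₄ x hx), by simp, ?_, ?_⟩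
      · intro g g0 g1
        by_cases hg : g = i
        · subst hg; simp [o1]
        · simpa [o1, hg] using r₄ g g0 (by omega)
      · intro g hg
        have : g ≠ i := by omega
        simpa [o1, this] using z₄ g hg
    · rintro μ₄ ⟨b₄, F₄, -, r₄, z₄⟩
      refine ⟨b₄, fun x hx => ?_, r₄, z₄⟩
      simp only [Finset.mem_insert, Finset.mem_singleton, not_or] at hx
      rw [F₄ x (by simp [hx]), F₃ x (by simp [hx])]

theorem does_mark (hBd : Bd B μ) (h52 : μ 52 0 = m) (hm : 0 ≤ m) (hN : m + 2 ≤ N)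
    (hmB : m + 3 ≤ B) (h13 : ∀ g, μ 13 g = 0) :
    Does N B markProg μ fun μ' => Bd B μ' ∧ Frame {13, 30, 31, 32} μ μ' ∧ μ' 30 0 = m + 3 ∧
      μ' 31 0 = 3 ∧ ∀ g, 0 < μ' 13 g ↔ g ∈ Finset.Ico 0 (m / 3 * 3 + 2) := by
  refine Does.line_seq (by simp) hBd ?_
  refine (Does.count (n := m / 3 * 3 + 2) (i₀ := 0) (fun i μ' => Bd B μ' ∧
    Frame {13, 30, 31, 32} μ μ' ∧ μ' 32 0 = i ∧ μ' 30 0 = m + 3 ∧ μ' 31 0 = 3 ∧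
    ∀ g, 0 < μ' 13 g ↔ g ∈ Finset.Ico 0 i) ?_ ?_ (by omega) (by omega) ?_).imp ?_
  · rintro i μ' ⟨h1, F, h2, -⟩
    exact ⟨h1, by simp [F.get 52, h52, h2]⟩
  · refine ⟨((hBd.store (abs_le.2 (by simp; omega))).store (by simp; omega)).store (by simp; omega),
      fun x hx => by simp at hx; simp [hx], by simp, by simp [h52], by simp, by simp [h13]⟩
  · rintro i μ₁ hi0 hi ⟨b₁, F₁, e32, e30, e31, r₁⟩
    have F : Frame {13, 32} μ₁ ((set 13 (var 32) 1 ;; assign 32 (var 32 + 1)).exec μ₁) :=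
      fun x hx => by simp at hx; simp [hx]
    refine Does.line (by simp) b₁
      ⟨(b₁.store (by simp; omega)).store (abs_le.2 (by simp [e32]; omega)),
      F₁.trans F, by simp [e32], by rw [F.get 30, e30], by rw [F.get 31, e31], fun g => ?_⟩
    by_cases hg : g = i
    · subst hg; simp [e32, hi0]
    · have := r₁ g
      simp only [Finset.mem_Ico] at this ⊢
      simp [e32, hg, this]; omega
  · rintro μ' ⟨h1, F, -, h2, h3, h4⟩
    exact ⟨h1, F, h2, h3, h4⟩

/-- What is left of `A` after removal of `C`, with the item `x` added if this is an even number of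
items. -/
def rest (x : ℤ) (A C : Finset ℤ) : Finset ℤ :=
  if Odd (A \ C).card then A \ C else insert x (A \ C)

theorem does_remove {A : Finset ℤ} (hBd : Bd B μ) (h52 : μ 52 0 = m) (h30 : μ 30 0 = m + 3)
    (hm : 0 ≤ m) (hN : m + 3 ≤ N) (hmB : m + 4 ≤ B) (hA : ∀ g ∈ A, 0 ≤ g ∧ g < m + 2)
    (hact : ∀ g, 0 < μ 13 g ↔ g ∈ A) :
    Does N B removeProg μ fun μ' => Bd B μ' ∧ Frame {13, 31, 32, 51} μ μ' ∧ μ' 31 0 = 2 ∧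
      ∀ g, 0 < μ' 13 g ↔ g ∈ rest (m + 2) A (A.filter fun g => μ 16 g = μ 45 0) := by
  refine line_then (by simp) hBd fun μ₁ e₁ => Does.seq ?_
  have F₁ : Frame {32, 51} μ μ₁ := fun x hx => by simp at hx; rw [← e₁]; simp [hx]
  have b₁ : Bd B μ₁ := by
    rw [← e₁]; exact (hBd.store (by simp; omega)).store (by simp; omega)
  have hA' : ∀ g ∈ A, 0 ≤ g ∧ g < m + 3 := fun g hg => ⟨(hA g hg).1, by have := hA g hg; omega⟩
  refine (Does.count (n := m + 3) (i₀ := 0) (fun i μ' => Bd B μ' ∧ Frame {13, 32, 51} μ μ' ∧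
    μ' 32 0 = i ∧ μ' 51 0 = countBefore A i (fun g => μ 16 g ≠ μ 45 0) % 2 ∧
    ∀ g, 0 < μ' 13 g ↔ g ∈ A ∧ (g < i → μ 16 g ≠ μ 45 0)) ?_ ?_ (by omega) (by omega) ?_).imp ?_
  · rintro i μ' ⟨h1, F, h2, -⟩
    exact ⟨h1, by simp [F.get 30, h30, h2]⟩
  · refine ⟨b₁, F₁.mono, by simp [← e₁], by simp [← e₁, countBefore_zero hA'], fun g => ?_⟩
    rw [F₁.get 13, hact]
    exact ⟨fun h => ⟨h, fun h' => absurd (hA g h).1 (by omega)⟩, fun h => h.1⟩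
  · rintro i μ₂ hi0 hi ⟨b₂, F₂, e32, e51, r₂⟩
    refine Does.line (by simp) b₂ ?_
    have hi13 : 0 < μ₂ 13 i ↔ i ∈ A := by rw [r₂]; simp
    have e16 := F₂.get 16
    have e45 := F₂.get 45
    by_cases hiA : i ∈ A
    · by_cases hc : μ 16 i = μ 45 0
      · have e : (Prog.cond (read 13 (var 32))
            (Prog.cond (eqv (read 16 (var 32)) (var 45)) (set 13 (var 32) 0)
              (assign 51 (1 - var 51))) skip ;; assign 32 (var 32 + 1)).exec μ₂ =
            (μ₂.store 13 i 0).store 32 0 (i + 1) := by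
          simp [e32, hi13, hiA, e16, e45, hc]
        rw [e]
        have F : Frame {13, 32} μ₂ ((μ₂.store 13 i 0).store 32 0 (i + 1)) :=
          fun x hx => by simp at hx; simp [hx]
        refine ⟨(b₂.store (by simp; omega)).store (abs_le.2 (by omega)), F₂.trans F, by simp,
          ?_, ?_⟩
        · rw [F.get 51, e51, countBefore_succ]; simp [hc]
        · intro g
          by_cases hg : g = i
          · subst hg; simp [hc]
          · have := r₂ g
            have hlt : g < i + 1 ↔ g < i := by omega
            simpa [hg, hlt] using this
      · have e : (Prog.cond (read 13 (var 32))
            (Prog.cond (eqv (read 16 (var 32)) (var 45)) (set 13 (var 32) 0)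
              (assign 51 (1 - var 51))) skip ;; assign 32 (var 32 + 1)).exec μ₂ =
            (μ₂.store 51 0 (1 - μ₂ 51 0)).store 32 0 (i + 1) := by
          simp [e32, hi13, hiA, e16, e45, hc]
        rw [e]
        have F : Frame {32, 51} μ₂ ((μ₂.store 51 0 (1 - μ₂ 51 0)).store 32 0 (i + 1)) :=
          fun x hx => by simp at hx; simp [hx]
        refine ⟨(b₂.store (abs_le.2 (by omega))).store (abs_le.2 (by omega)), F₂.trans F, by simp,
          ?_, ?_⟩
        · have e' : ((μ₂.store 51 0 (1 - μ₂ 51 0)).store 32 0 (i + 1)) 51 0 = 1 - μ₂ 51 0 := by simp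
          rw [e', countBefore_succ, if_pos ⟨hiA, hc⟩]
          omega
        · intro g
          rw [F.get 13, r₂ g]
          by_cases hg : g = i
          · subst hg; simp [hc, hiA]
          · have hlt : g < i + 1 ↔ g < i := by omega
            rw [hlt]
    · have e : (Prog.cond (read 13 (var 32))
            (Prog.cond (eqv (read 16 (var 32)) (var 45)) (set 13 (var 32) 0)
              (assign 51 (1 - var 51))) skip ;; assign 32 (var 32 + 1)).exec μ₂ =
            μ₂.store 32 0 (i + 1) := by
        simp [e32, hi13, hiA]
      rw [e]
      have F : Frame {32} μ₂ (μ₂.store 32 0 (i + 1)) := fun x hx => by simp at hx; simp [hx]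
      refine ⟨b₂.store (abs_le.2 (by omega)), F₂.trans F, by simp, ?_, ?_⟩
      · rw [F.get 51, e51, countBefore_succ]; simp [hiA]
      · intro g
        rw [F.get 13, r₂ g]
        by_cases hg : g = i
        · subst hg; simp [hiA]
        · have hlt : g < i + 1 ↔ g < i := by omega
          rw [hlt]
  · rintro μ₂ ⟨b₂, F₂, -, e51, r₂⟩
    have F : Frame {13, 31} μ₂ ((set 13 (var 52 + 2) (1 - var 51) ;; assign 31 2).exec μ₂) :=
      fun x hx => by simp at hx; simp [hx]
    refine Does.line (by simp) b₂ ⟨?_, F₂.trans F, by simp, fun g => ?_⟩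
    · exact (b₂.store (abs_le.2 (by simp; omega))).store (by simp; omega)
    · have hcount : countBefore A (m + 3) (fun g => μ 16 g ≠ μ 45 0) =
          ((A \ A.filter fun g => μ 16 g = μ 45 0).card : ℤ) := by
        unfold countBefore
        congr 2
        ext g
        have := hA' g
        simp only [Finset.mem_filter, Finset.mem_sdiff]
        tauto
      have hpar : μ₂ 51 0 = 1 ↔ Odd (A \ A.filter fun g => μ 16 g = μ 45 0).card := by
        rw [e51, hcount, Nat.odd_iff]; omega
      have hrg : 0 < μ₂ 13 g ↔ g ∈ A \ A.filter fun g => μ 16 g = μ 45 0 := by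
        rw [r₂]
        have := hA' g
        simp only [Finset.mem_filter, Finset.mem_sdiff]
        tauto
      have e51' : μ₂ 51 0 = 0 ∨ μ₂ 51 0 = 1 := by omega
      have e52 : μ₂ 52 0 = m := by rw [F₂.get 52, h52]
      unfold rest
      by_cases hg : g = m + 2
      · subst hg
        have : m + 2 ∉ A := fun h => by have := hA _ h; omega
        split_ifs with ho
        · simp [hpar.2 ho, e52, this]
        · have : μ₂ 51 0 = 0 := by tauto
          simp [this, e52]
      · have : 0 < (set 13 (var 52 + 2) (1 - var 51) ;; assign 31 2).exec μ₂ 13 g ↔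
            0 < μ₂ 13 g := by simp [e52, hg]
        rw [this, hrg]
        split_ifs with ho
        · rfl
        · rw [Finset.mem_insert, or_iff_right hg]

theorem does_write {c : ℤ → ℤ} (hBd : Bd B μ) (h52 : μ 52 0 = m) (hm : 0 ≤ m) (hN : m ≤ N)
    (hmB : m + 3 ≤ B)
    (hc : ∀ g, c g = if 0 < μ 13 g then if μ 16 g = μ 45 0 then 1 else 2 else 0) :
    Does N B writeProg μ fun μ' => μ' 0 0 = 3 ∧
      (∀ k, 0 ≤ k → k < 3 → μ' 1 k = 1 ∧ μ' 2 k = 3) ∧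
      ∀ k g, 0 ≤ k → k < 3 → 0 ≤ g → g < m → μ' 3 (k * m + g) = (c g + k) % 3 := by
  have hc3 : ∀ g, 0 ≤ c g ∧ c g < 3 := by
    intro g; rw [hc]; split_ifs <;> norm_num
  refine Does.line_seq (by simp) hBd (Does.seq ?_)
  refine (Does.count (n := m) (i₀ := 0) (fun i μ' => Bd B μ' ∧ Frame {3, 32, 51} μ μ' ∧
    μ' 32 0 = i ∧ ∀ g, 0 ≤ g → g < i → μ' 3 g = c g ∧ μ' 3 (m + g) = (c g + 1) % 3 ∧
      μ' 3 (2 * m + g) = (c g + 2) % 3) ?_ ?_ hm (by omega) ?_).imp ?_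
  · rintro i μ' ⟨h1, F, h2, -⟩
    exact ⟨h1, by simp [F.get 52, h52, h2]⟩
  · exact ⟨hBd.store (by simp; omega), fun x hx => by simp at hx; simp [hx], by simp,
      fun g h0 h1 => by omega⟩
  · rintro i μ₁ hi0 hi ⟨b₁, F₁, e32, r₁⟩
    have hci := hc3 i
    refine line_then (by simp) b₁ fun μ₂ e₂ => ?_
    have e : μ₂ = μ₁.store 51 0 (c i) := by
      rw [← e₂, hc]
      simp only [exec_cond, eval_eqv_pos, eval_read, eval_var, e32, F₁.get 13, F₁.get 16,
        F₁.get 45]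
      split_ifs <;> simp
    have F₂ : Frame {51} μ₁ μ₂ := fun x hx => by simp at hx; rw [e]; simp [hx]
    have b₂ : Bd B μ₂ := by rw [e]; exact b₁.store (abs_le.2 (by omega))
    have e51 : μ₂ 51 0 = c i := by simp [e]
    have e52 : μ₂ 52 0 = m := by rw [F₂.get 52, F₁.get 52, h52]
    have e32' : μ₂ 32 0 = i := by rw [F₂.get 32, e32]
    have key : (set 3 (var 32) (var 51) ;;
        set 3 (var 52 + var 32) (var 51 + 1 - 3 * ((var 51 + 1) / 3)) ;;
        set 3 (2 * var 52 + var 32) (var 51 + 2 - 3 * ((var 51 + 2) / 3)) ;;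
        assign 32 (var 32 + 1)).exec μ₂ =
        (((μ₂.store 3 i (c i)).store 3 (m + i) ((c i + 1) % 3)).store 3 (2 * m + i)
          ((c i + 2) % 3)).store 32 0 (i + 1) := by
      have m1 : c i + 1 - 3 * ((c i + 1) / 3) = (c i + 1) % 3 := by omega
      have m2 : c i + 2 - 3 * ((c i + 2) / 3) = (c i + 2) % 3 := by omega
      simp [e51, e52, e32', m1, m2]
    refine Does.line (by simp) b₂ ?_
    rw [key]
    have F : Frame {3, 32} μ₂ ((((μ₂.store 3 i (c i)).store 3 (m + i) ((c i + 1) % 3)).store 3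
        (2 * m + i) ((c i + 2) % 3)).store 32 0 (i + 1)) := fun x hx => by simp at hx; simp [hx]
    refine ⟨(((b₂.store (abs_le.2 (by omega))).store (abs_le.2 (by omega))).store
      (abs_le.2 (by omega))).store (abs_le.2 (by omega)), F₁.trans (F₂.trans F (U := {3, 32, 51})),
      by simp, fun g g0 g1 => ?_⟩
    by_cases hg : g = i
    · subst hg
      have n1 : g ≠ m + g := by omega
      have n2 : g ≠ 2 * m + g := by omega
      have n3 : m + g ≠ 2 * m + g := by omega
      simp [n1, n2, n3]
    · have h := r₁ g g0 (by omega)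
      have n1 : g ≠ m + i := by omega
      have n2 : g ≠ 2 * m + i := by omega
      have n4 : m + g ≠ i := by omega
      have n5 : m + g ≠ 2 * m + i := by omega
      have n6 : 2 * m + g ≠ i := by omega
      have n7 : 2 * m + g ≠ m + i := by omega
      rw [← F₂.get 3] at h
      simpa [Function.update_apply, hg, n1, n2, n4, n5, n6, n7] using h
  · rintro μ₁ ⟨b₁, -, -, r₁⟩
    refine Does.line (by simp) b₁ ⟨by simp, fun k k0 k3 => ?_, fun k g k0 k3 g0 g1 => ?_⟩
    · obtain rfl | rfl | rfl : k = 0 ∨ k = 1 ∨ k = 2 := by omega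
      all_goals simp
    · obtain ⟨h1, h2, h3⟩ := r₁ g g0 g1
      have := hc3 g
      obtain rfl | rfl | rfl : k = 0 ∨ k = 1 ∨ k = 2 := by omega
      · simp [h1]; omega
      · simp [h2]
      · simp [h3]

end Main

end FairDivision

/-! ### Correctness of the program -/

namespace FairDivision

open RAM Expr Prog

section Rest

variable {x : ℤ} {A C : Finset ℤ}

theorem odd_card_rest (hx : x ∉ A) : Odd (rest x A C).card := by
  unfold rest
  split_ifs with h
  · exact h
  · rw [Finset.card_insert_of_notMem fun h' => hx (Finset.mem_sdiff.1 h').1]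
    exact (Nat.not_odd_iff_even.1 h).add_one

theorem mem_rest {g : ℤ} (hg : g ≠ x) : g ∈ rest x A C ↔ g ∈ A ∧ g ∉ C := by
  unfold rest
  split_ifs <;> simp [hg]

theorem rest_subset : rest x A C ⊆ insert x A := by
  unfold rest
  split_ifs
  · exact Finset.sdiff_subset.trans (Finset.subset_insert _ _)
  · exact Finset.insert_subset_insert _ Finset.sdiff_subset

theorem disjoint_rest (hx : x ∉ C) : Disjoint C (rest x A C) := by
  rw [Finset.disjoint_left]
  intro g hg hg'
  exact ((mem_rest fun h : g = x => hx (h ▸ hg)).1 hg').2 hg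

theorem sum_rest {w : ℤ → ℤ} (hx : x ∉ A) (hw : w x = 0) :
    ∑ g ∈ rest x A C, w g = ∑ g ∈ A \ C, w g := by
  unfold rest
  split_ifs
  · rfl
  · rw [Finset.sum_insert fun h' => hx (Finset.mem_sdiff.1 h').1, hw, zero_add]

theorem filter_rest {w : ℤ → ℤ} {t : ℤ} (hw : w x = 0) (ht : 0 ≤ t) :
    ((rest x A C).filter fun g => t < w g) = (A \ C).filter fun g => t < w g := by
  unfold rest
  split_ifs
  · rfl
  · rw [Finset.filter_insert, if_neg (by omega)]

end Rest

theorem noEnvyAmong_splits {m G' : ℤ} {w : Fin 3 → ℤ → ℤ} {C D : Finset ℤ} (hm : 0 ≤ m)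
    (hw : ∀ i g, 0 ≤ w i g) (hz : ∀ i g, g < 0 ∨ m ≤ g → w i g = 0)
    (hC : IsSplit 3 (m / 3 + 1) (Finset.Ico 0 (m / 3 * 3 + 2)) (itemKey (m + 3) (w 0))
      (itemKey (m + 3) (w 1)) (w 2) C)
    (hD : IsSplit 2 G' (rest (m + 2) (Finset.Ico 0 (m / 3 * 3 + 2)) C) (itemKey (m + 3) (w 1))
      (itemKey (m + 3) (w 0)) (w 2) D)
    (hG' : ((rest (m + 2) (Finset.Ico 0 (m / 3 * 3 + 2)) C).card : ℤ) = 2 * G' - 1) (i : Fin 3) :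
    NoEnvyAmong (w i) C D (rest (m + 2) (Finset.Ico 0 (m / 3 * 3 + 2)) C \ D) := by
  set A := Finset.Ico 0 (m / 3 * 3 + 2) with hA
  have hx : m + 2 ∉ A := by rw [hA, Finset.mem_Ico]; omega
  have hxC : m + 2 ∉ C := fun h => hx (hC.subset h)
  have bA : ∀ g ∈ A, 0 ≤ g ∧ g < m + 3 := by
    intro g hg; rw [hA, Finset.mem_Ico] at hg; omega
  have bA' : ∀ g ∈ rest (m + 2) A C, 0 ≤ g ∧ g < m + 3 := by
    intro g hg
    rcases Finset.mem_insert.1 (rest_subset hg) with rfl | h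
    · omega
    · exact bA g h
  have cA : (A.card : ℤ) = 3 * (m / 3 + 1) - 1 := by
    rw [hA, Int.card_Ico]; omega
  have hzx : ∀ i, w i (m + 2) = 0 := fun i => hz i _ (by omega)
  have dis := disjoint_rest (A := A) hxC
  fin_cases i
  · exact noEnvyAmong_of_card_le (hw 0) (dis.mono_right hD.subset)
      (dis.mono_right Finset.sdiff_subset) Finset.disjoint_sdiff fun t ht =>
        card_prefix_left hC hD bA bA' cA hG' (filter_rest (hzx 0) ht)
  · exact noEnvyAmong_of_card_le (hw 1) (dis.mono_right hD.subset)
      (dis.mono_right Finset.sdiff_subset) Finset.disjoint_sdiff fun t ht =>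
        card_prefix_right hC hD bA bA' cA hG' (filter_rest (hzx 1) ht)
  · exact noEnvyAmong_value hC hD (hw 2) dis (sum_rest hx (hzx 2))

/-- The values of the items to agent `i` that the memory holds as numerators and denominators,
multiplied by the product of the denominators. Outside of the range of the items they are `0`. -/
noncomputable def scaledValue (μ : Mem) (m : ℤ) (i : Fin 3) (g : ℤ) : ℤ :=
  if 0 ≤ g ∧ g < m then
    μ (1 + i) g * ((∏ g ∈ Finset.Ico 0 m, μ (4 + i) g) / μ (4 + i) g)
  else 0

set_option maxHeartbeats 2000000 in
/-- The first split is taken of the items below `3 * (m / 3) + 2`, of which those from `m` on have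
no value, and item `m + 2` is the one that may be added before the second split. -/
theorem does_main {N m : ℕ} {B : ℤ} {μ : Mem} (hBd : Bd B μ) (h0 : μ 0 0 = m)
    (hz : ∀ a, 7 ≤ a → ∀ g, μ a g = 0)
    (hden : ∀ (i : Fin 3) (g : ℤ), 0 ≤ g → g < m → 0 < μ (4 + i) g)
    (hnum : ∀ (i : Fin 3) (g : ℤ), 0 ≤ g → g < m → 0 ≤ μ (1 + i) g)
    (hP : ∀ i : Fin 3, ∏ g ∈ Finset.Ico 0 (m : ℤ), μ (4 + i) g ≤ B)
    (hsum : ∀ i, 10 * ∑ g ∈ Finset.Ico 0 (m : ℤ), scaledValue μ m i g + 10 * (m + 3) ≤ B)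
    (hN : m + 4 ≤ N) :
    Does N B mainProg μ fun μ' => ∃ (K : Fin 3 → Finset ℤ) (c : Fin m → Fin 3),
      (∀ i j j', j ≠ j' → NoEnvy (scaledValue μ m i) (K j) (K j')) ∧
      (∀ j (g : Fin m), ((g : ℕ) : ℤ) ∈ K j ↔ c g = j) ∧ μ' 0 0 = 3 ∧
      (∀ k, 0 ≤ k → k < 3 → μ' 1 k = 1 ∧ μ' 2 k = 3) ∧
      ∀ (k : Fin 3) (g : Fin m), μ' 3 ((k : ℕ) * m + (g : ℕ)) = ((c g + k : Fin 3) : ℕ) := by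
  have hnn : ∀ i g, 0 ≤ scaledValue μ m i g := by
    intro i g
    unfold scaledValue
    split_ifs with h
    · refine mul_nonneg (hnum i g h.1 h.2) (Int.ediv_nonneg (Finset.prod_nonneg fun x hx => ?_)
        (hden i g h.1 h.2).le)
      rw [Finset.mem_Ico] at hx
      exact (hden i x hx.1 hx.2).le
    · exact le_rfl
  have hzero : ∀ i g, g < 0 ∨ (m : ℤ) ≤ g → scaledValue μ m i g = 0 := by
    intro i g hg; unfold scaledValue; rw [if_neg (by omega)]
  have hle : ∀ (i : Fin 3) g, 0 ≤ g → g < (m : ℤ) →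
      |μ (1 + i) g * ((∏ g ∈ Finset.Ico 0 (m : ℤ), μ (4 + i) g) / μ (4 + i) g)| ≤ B := by
    intro i g g0 g1
    have h1 : scaledValue μ m i g =
        μ (1 + i) g * ((∏ g ∈ Finset.Ico 0 (m : ℤ), μ (4 + i) g) / μ (4 + i) g) := by
      unfold scaledValue; rw [if_pos ⟨g0, g1⟩]
    rw [← h1, abs_of_nonneg (hnn i g)]
    have := Finset.single_le_sum (f := scaledValue μ m i) (fun x _ => hnn i x)
      (Finset.mem_Ico.2 ⟨g0, g1⟩)
    have := hsum i
    have := hnn i g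
    omega
  have hmB : 10 * ((m : ℤ) + 3) ≤ B := by
    have := hsum 0
    have := Finset.sum_nonneg fun x (_ : x ∈ Finset.Ico 0 (m : ℤ)) => hnn 0 x
    omega
  have hext : ∀ (i : Fin 3) (f : ℤ → ℤ), (∀ g, 0 ≤ g → g < (m : ℤ) → f g = μ (1 + i) g *
      ((∏ g ∈ Finset.Ico 0 (m : ℤ), μ (4 + i) g) / μ (4 + i) g)) →
      (∀ g, g < 0 ∨ (m : ℤ) ≤ g → f g = 0) → f = scaledValue μ m i := by
    intro i f h1 h2
    funext g
    unfold scaledValue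
    split_ifs with h
    · exact h1 g h.1 h.2
    · exact h2 g (by omega)
  -- the scaled values
  refine line_then (by simp) hBd fun μ₁ e₁ => ?_
  have F₁ : Frame {52} μ μ₁ := fun x hx => by simp at hx; rw [← e₁]; simp [hx]
  have b₁ : Bd B μ₁ := by rw [← e₁]; exact hBd.store (by simp [h0]; omega)
  have e52 : μ₁ 52 0 = m := by simp [← e₁, h0]
  refine Does.seq ((does_scale (m := m) (by norm_num) (by norm_num) (by norm_num) (by norm_num) b₁
    e52 (by omega) (by omega) (by omega) (by rw [F₁.get 4]; exact hden 0)
    (by rw [F₁.get 4]; exact hP 0) (by rw [F₁.get 1, F₁.get 4]; exact hle 0)).imp ?_)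
  rintro μ₂ ⟨b₂, F₁₂, r₂, z₂⟩
  have F₂ := F₁.trans F₁₂ (U := {10, 32, 50, 52})
  rw [F₁.get 1, F₁.get 4] at r₂
  have v₂ : μ₂ 10 = scaledValue μ m 0 := hext 0 _ r₂ fun g hg => by
    rw [z₂ g hg, F₁.get 10]; exact hz _ (by norm_num) _
  refine Does.seq ((does_scale (m := m) (by norm_num) (by norm_num) (by norm_num) (by norm_num) b₂
    (by rw [F₁₂.get 52, e52]) (by omega) (by omega) (by omega) (by rw [F₂.get 5]; exact hden 1)
    (by rw [F₂.get 5]; exact hP 1) (by rw [F₂.get 2, F₂.get 5]; exact hle 1)).imp ?_)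
  rintro μ₃ ⟨b₃, F₂₃, r₃, z₃⟩
  have F₃ := F₂.trans F₂₃ (U := {10, 11, 32, 50, 52})
  rw [F₂.get 2, F₂.get 5] at r₃
  have v₃ : μ₃ 11 = scaledValue μ m 1 := hext 1 _ r₃ fun g hg => by
    rw [z₃ g hg, F₂.get 11]; exact hz _ (by norm_num) _
  refine Does.seq ((does_scale (m := m) (by norm_num) (by norm_num) (by norm_num) (by norm_num) b₃
    (by rw [F₂₃.get 52, F₁₂.get 52, e52]) (by omega) (by omega) (by omega)
    (by rw [F₃.get 6]; exact hden 2) (by rw [F₃.get 6]; exact hP 2)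
    (by rw [F₃.get 3, F₃.get 6]; exact hle 2)).imp ?_)
  rintro μ₄ ⟨b₄, F₃₄, r₄, z₄⟩
  have F₄ := F₃.trans F₃₄ (U := {10, 11, 12, 32, 50, 52})
  rw [F₃.get 3, F₃.get 6] at r₄
  have v₄ : μ₄ 12 = scaledValue μ m 2 := hext 2 _ r₄ fun g hg => by
    rw [z₄ g hg, F₃.get 12]; exact hz _ (by norm_num) _
  -- the first split
  refine Does.seq ((does_mark b₄ (by rw [F₃₄.get 52, F₂₃.get 52, F₁₂.get 52, e52]) (by omega)
    (by omega) (by omega) (by rw [F₄.get 13]; exact hz _ (by norm_num))).imp ?_)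
  rintro μ₅ ⟨b₅, F₅, e30, e31, e13⟩
  set A := Finset.Ico (0 : ℤ) (m / 3 * 3 + 2) with hA
  have hAm : ∀ g ∈ A, 0 ≤ g ∧ g < (m : ℤ) + 2 := by
    intro g hg; rw [hA, Finset.mem_Ico] at hg; omega
  have cA : (A.card : ℤ) = 3 * (m / 3 + 1) - 1 := by
    rw [hA, Int.card_Ico]; omega
  have hsub : ∀ (S : Finset ℤ) i, 10 * ∑ g ∈ S, scaledValue μ m i g + 10 * (m + 3) ≤ B := by
    intro S i
    have h1 : ∑ g ∈ S, scaledValue μ m i g ≤ ∑ g ∈ Finset.Ico 0 (m : ℤ), scaledValue μ m i g := by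
      rw [← Finset.sum_filter_add_sum_filter_not S (fun g => 0 ≤ g ∧ g < (m : ℤ))]
      rw [Finset.sum_eq_zero (s := S.filter fun g => ¬ (0 ≤ g ∧ g < (m : ℤ))), add_zero]
      · refine Finset.sum_le_sum_of_subset_of_nonneg (fun g hg => ?_) fun x _ _ => hnn i x
        exact Finset.mem_Ico.2 (Finset.mem_filter.1 hg).2
      · intro x hx
        exact hzero i x (by have := (Finset.mem_filter.1 hx).2; omega)
    have := hsum i
    omega
  have d : Data N B (m + 3) 3 A (scaledValue μ m 2) :=
    ⟨by norm_num, by norm_num, by omega, fun g hg => ⟨(hAm g hg).1, by have := hAm g hg; omega⟩,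
      hnn 2, hzero 2 _ (by norm_num), hsub A 2, by omega⟩
  have w10 : μ₅ 10 = scaledValue μ m 0 := by rw [F₅.get 10, F₃₄.get 10, F₂₃.get 10, v₂]
  have w11 : μ₅ 11 = scaledValue μ m 1 := by rw [F₅.get 11, F₃₄.get 11, v₃]
  have w12 : μ₅ 12 = scaledValue μ m 2 := by rw [F₅.get 12, v₄]
  have e16 : ∀ g, μ₅ 16 g = 0 := by
    intro g; rw [F₅.get 16, F₄.get 16]; exact hz _ (by norm_num) _
  refine Does.seq ((does_split (Or.inl rfl) (Or.inr rfl) d cA b₅ e30 e31 w12 (fun g _ _ => e13 g)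
    fun g _ => e16 g).imp ?_)
  rintro μ₆ ⟨b₆, F₆, c45, c16, hC⟩
  rw [w10, w11] at hC
  have f30 : μ₆ 30 0 = m + 3 := by rw [F₆.get 30, e30]
  have f52 : μ₆ 52 0 = m := by
    rw [F₆.get 52, F₅.get 52, F₃₄.get 52, F₂₃.get 52, F₁₂.get 52, e52]
  refine Does.seq ((does_remove b₆ f52 f30 (by omega) (by omega) (by omega) hAm
    (by rw [F₆.get 13]; exact e13)).imp ?_)
  set C := A.filter fun g => μ₆ 16 g = μ₆ 45 0 with hCdef
  rintro μ₇ ⟨b₇, F₇, g31, g13⟩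
  -- the second split
  have hx : (m : ℤ) + 2 ∉ A := fun h => by have := hAm _ h; omega
  have F₅₇ := F₆.trans F₇ (U := splitVars ∪ {13, 31, 51})
  obtain ⟨G', hG'⟩ : ∃ G' : ℤ, ((rest ((m : ℤ) + 2) A C).card : ℤ) = 2 * G' - 1 := by
    obtain ⟨r, hr⟩ := odd_card_rest (C := C) hx
    exact ⟨r + 1, by omega⟩
  have hRm : ∀ g ∈ rest ((m : ℤ) + 2) A C, 0 ≤ g ∧ g < (m : ℤ) + 3 := by
    intro g hg
    rcases Finset.mem_insert.1 (rest_subset hg) with rfl | h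
    · omega
    · have := hAm g h; omega
  have d' : Data N B (m + 3) 2 (rest ((m : ℤ) + 2) A C) (scaledValue μ m 2) :=
    ⟨by norm_num, by norm_num, by omega, hRm, hnn 2, hzero 2 _ (by norm_num), hsub _ 2, by omega⟩
  refine Does.seq ((does_split (Or.inr rfl) (Or.inl rfl) d' hG' b₇ (by rw [F₇.get 30, f30]) g31
    (by rw [F₅₇.get 12, w12]) (fun g _ _ => g13 g) fun g hg => ?_).imp ?_)
  · rw [F₇.get 16]; exact c16 g fun h => by have := hAm g h; omega
  rintro μ₈ ⟨b₈, F₈, -, -, hD⟩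
  rw [F₅₇.get 10, F₅₇.get 11, w10, w11] at hD
  set D := (rest ((m : ℤ) + 2) A C).filter fun g => μ₈ 16 g = μ₈ 45 0 with hDdef
  have key := noEnvyAmong_splits (by omega) hnn hzero hC hD hG'
  -- the classes
  refine (does_write (c := fun g => if 0 < μ₈ 13 g then if μ₈ 16 g = μ₈ 45 0 then 1 else 2 else 0)
    b₈ (by rw [F₈.get 52, F₇.get 52, f52]) (by omega) (by omega) (by omega) fun g => rfl).imp ?_
  rintro μ₉ ⟨o1, o2, o3⟩
  rw [F₈.get 13] at o3
  refine ⟨![C, D, rest ((m : ℤ) + 2) A C \ D], fun g => if 0 < μ₇ 13 g then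
    if μ₈ 16 g = μ₈ 45 0 then 1 else 2 else 0, ?_, ?_, o1, o2, ?_⟩
  · intro i j j' hj
    obtain ⟨⟨k1, k2⟩, ⟨k3, k4⟩, k5, k6⟩ := key i
    fin_cases j <;> fin_cases j' <;> first | exact absurd rfl hj | assumption
  · intro j g
    have hgx : ((g : ℕ) : ℤ) ≠ (m : ℤ) + 2 := by have := g.2; omega
    have hgA : ((g : ℕ) : ℤ) ∈ A := by rw [hA, Finset.mem_Ico]; have := g.2; omega
    have r1 := g13 ((g : ℕ) : ℤ)
    have r2 := mem_rest (A := A) (C := C) hgx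
    have r3 : ((g : ℕ) : ℤ) ∈ D ↔ ((g : ℕ) : ℤ) ∈ rest ((m : ℤ) + 2) A C ∧
      μ₈ 16 ((g : ℕ) : ℤ) = μ₈ 45 0 := Finset.mem_filter
    beta_reduce
    by_cases q1 : ((g : ℕ) : ℤ) ∈ C
    · have q2 : ((g : ℕ) : ℤ) ∉ rest ((m : ℤ) + 2) A C := fun h => (r2.1 h).2 q1
      rw [if_neg (by tauto)]
      fin_cases j <;> simp [q1, q2, r3]
    · have q2 : ((g : ℕ) : ℤ) ∈ rest ((m : ℤ) + 2) A C := r2.2 ⟨hgA, q1⟩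
      rw [if_pos (r1.2 q2)]
      by_cases q3 : μ₈ 16 ((g : ℕ) : ℤ) = μ₈ 45 0
      · fin_cases j <;> simp [q1, q2, q3, r3]
      · fin_cases j <;> simp [q1, q2, q3, r3]
  · intro k g
    rw [o3 k g (by omega) (by have := k.2; omega) (by omega) (by have := g.2; omega)]
    beta_reduce
    split_ifs <;> fin_cases k <;> rfl

end FairDivision

/-! ### Rational profiles -/

namespace FairDivision

open RAM

theorem natAbs_lt_two_pow_bits (z : ℤ) : z.natAbs < 2 ^ bits z :=
  (Nat.lt_size_self _).trans (Nat.pow_lt_pow_right (by norm_num) (Nat.lt_succ_self _))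

theorem inputSize_eq {m : ℕ} (q : Fin 3 → Fin m → ℚ≥0) :
    inputSize q = bits m +
      ((∑ i, ∑ g, bits ((q i g).num : ℤ)) + ∑ i, ∑ g, bits ((q i g).den : ℤ)) := by
  simp [inputSize, inputLists, List.ofFn_succ, Fin.sum_univ_three, List.map_ofFn, List.sum_ofFn,
    Function.comp_def]
  ring

section Input

variable {m : ℕ} (q : Fin 3 → Fin m → ℚ≥0)

theorem input_zero : Mem.ofLists (inputLists q) 0 0 = m := by
  simp [Mem.ofLists, inputLists]

theorem input_work {a : ℕ} (ha : 7 ≤ a) (g : ℤ) : Mem.ofLists (inputLists q) a g = 0 := by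
  have : (inputLists q).getD a [] = [] := by
    rw [List.getD_eq_getElem?_getD, List.getElem?_eq_none]
    · rfl
    · simpa [inputLists] using ha
  unfold Mem.ofLists
  rw [this]
  simp

theorem getD_ofFn {f : Fin m → ℤ} (k : ℕ) :
    (List.ofFn f).getD k 0 = if h : k < m then f ⟨k, h⟩ else 0 := by
  rw [List.getD_eq_getElem?_getD, List.getElem?_ofFn]
  split_ifs <;> rfl

theorem input_num (i : Fin 3) (g : ℤ) : Mem.ofLists (inputLists q) (1 + i) g =
    if h : 0 ≤ g ∧ g.toNat < m then ((q i ⟨g.toNat, h.2⟩).num : ℤ) else 0 := by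
  have : (inputLists q).getD (1 + i) [] = List.ofFn fun g => ((q i g).num : ℤ) := by
    fin_cases i <;> simp [inputLists, List.ofFn_succ]
  unfold Mem.ofLists
  rw [this, getD_ofFn]
  split_ifs <;> first | rfl | tauto

theorem input_den (i : Fin 3) (g : ℤ) : Mem.ofLists (inputLists q) (4 + i) g =
    if h : 0 ≤ g ∧ g.toNat < m then ((q i ⟨g.toNat, h.2⟩).den : ℤ) else 0 := by
  have : (inputLists q).getD (4 + i) [] = List.ofFn fun g => ((q i g).den : ℤ) := by
    fin_cases i <;> simp [inputLists, List.ofFn_succ]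
  unfold Mem.ofLists
  rw [this, getD_ofFn]
  split_ifs <;> first | rfl | tauto

theorem bits_num_le (i : Fin 3) (g : Fin m) : bits ((q i g).num : ℤ) ≤ inputSize q := by
  rw [inputSize_eq]
  have h1 := Finset.single_le_sum (f := fun g => bits ((q i g).num : ℤ)) (fun _ _ => Nat.zero_le _)
    (Finset.mem_univ g)
  have h2 := Finset.single_le_sum (f := fun i => ∑ g, bits ((q i g).num : ℤ))
    (fun _ _ => Nat.zero_le _) (Finset.mem_univ i)
  omega

theorem sum_bits_den_le (i : Fin 3) : ∑ g, bits ((q i g).den : ℤ) ≤ inputSize q := by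
  rw [inputSize_eq]
  have h2 := Finset.single_le_sum (f := fun i => ∑ g, bits ((q i g).den : ℤ))
    (fun _ _ => Nat.zero_le _) (Finset.mem_univ i)
  omega

theorem items_le_inputSize : m ≤ inputSize q := by
  refine le_trans ?_ (sum_bits_den_le q 0)
  simpa using Finset.card_nsmul_le_sum Finset.univ (fun g => bits ((q 0 g).den : ℤ)) 1
    fun g _ => one_le_bits _

theorem prod_Ico_eq_prod_fin (f : ℤ → ℤ) (m : ℕ) :
    ∏ g ∈ Finset.Ico 0 (m : ℤ), f g = ∏ g : Fin m, f ((g : ℕ) : ℤ) := by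
  induction m with
  | zero => simp
  | succ m ih =>
    rw [Nat.cast_succ, prod_Ico_succ _ (Nat.cast_nonneg m), ih, Fin.prod_univ_castSucc]
    simp

theorem prod_input_den (i : Fin 3) :
    ∏ g ∈ Finset.Ico 0 (m : ℤ), Mem.ofLists (inputLists q) (4 + i) g =
    ((∏ g, (q i g).den : ℕ) : ℤ) := by
  rw [prod_Ico_eq_prod_fin]
  push_cast
  exact Finset.prod_congr rfl fun g _ => by rw [input_den, dif_pos] <;> simp

theorem prod_den_le (i : Fin 3) : ∏ g, (q i g).den ≤ 2 ^ inputSize q := by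
  refine le_trans ?_ (Nat.pow_le_pow_right (by norm_num) (sum_bits_den_le q i))
  rw [← Finset.prod_pow_eq_pow_sum]
  exact Finset.prod_le_prod' fun g _ => (natAbs_lt_two_pow_bits ((q i g).den : ℤ)).le

theorem scaledValue_input (i : Fin 3) (g : Fin m) :
    scaledValue (Mem.ofLists (inputLists q)) m i ((g : ℕ) : ℤ) =
      (((q i g).num * ((∏ g, (q i g).den) / (q i g).den) : ℕ) : ℤ) := by
  unfold scaledValue
  rw [if_pos ⟨by omega, by have := g.2; omega⟩, prod_input_den, input_num, input_den, dif_pos,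
    dif_pos] <;> simp

theorem scaledValue_input_le (i : Fin 3) (g : Fin m) :
    scaledValue (Mem.ofLists (inputLists q)) m i ((g : ℕ) : ℤ) ≤ 4 ^ inputSize q := by
  rw [scaledValue_input]
  have h1 : (q i g).num ≤ 2 ^ inputSize q := (natAbs_lt_two_pow_bits ((q i g).num : ℤ)).le.trans
    (Nat.pow_le_pow_right (by norm_num) (bits_num_le q i g))
  have h2 := (Nat.div_le_self _ (q i g).den).trans (prod_den_le q i)
  have := Nat.mul_le_mul h1 h2
  rw [← mul_pow] at this
  exact_mod_cast this

theorem abs_input_le (a : ℕ) (g : ℤ) :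
    |Mem.ofLists (inputLists q) a g| ≤ 2 ^ inputSize q := by
  have cast : ∀ {z : ℤ}, bits z ≤ inputSize q → |z| ≤ 2 ^ inputSize q := by
    intro z hz
    have := (natAbs_lt_two_pow_bits z).le.trans (Nat.pow_le_pow_right (by norm_num) hz)
    rw [Int.abs_eq_natAbs]
    exact_mod_cast this
  rcases Nat.lt_or_ge a 7 with ha | ha
  · obtain rfl | ⟨i, rfl⟩ | ⟨i, rfl⟩ :
        a = 0 ∨ (∃ i : Fin 3, a = 1 + i) ∨ ∃ i : Fin 3, a = 4 + i := by
      rcases Nat.lt_or_ge a 4 with h | h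
      · rcases Nat.eq_zero_or_pos a with h0 | h0
        · exact Or.inl h0
        · exact Or.inr (Or.inl ⟨⟨a - 1, by omega⟩, by simp; omega⟩)
      · exact Or.inr (Or.inr ⟨⟨a - 4, by omega⟩, by simp; omega⟩)
    · by_cases hg : g = 0
      · subst hg
        rw [input_zero]
        exact cast (by rw [inputSize_eq]; omega)
      · have : Mem.ofLists (inputLists q) 0 g = 0 := by
          unfold Mem.ofLists inputLists
          split_ifs with h
          · obtain ⟨k, hk⟩ : ∃ k, g.toNat = k + 1 := ⟨g.toNat - 1, by omega⟩
            simp [hk]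
          · rfl
        simp [this]
    · rw [input_num]
      split_ifs with h
      · exact cast (bits_num_le q i _)
      · simp
    · rw [input_den]
      split_ifs with h
      · refine cast ((Finset.single_le_sum (f := fun g => bits ((q i g).den : ℤ))
          (fun _ _ => Nat.zero_le _) (Finset.mem_univ _)).trans (sum_bits_den_le q i))
      · simp
  · simp [input_work q ha]

end Input

/-- The memory holds the three cyclic shifts of `c`, with probability `1 / 3` each. -/
def HoldsShifts {m : ℕ} (μ : Mem) (c : Fin m → Fin 3) : Prop :=
  μ 0 0 = 3 ∧ (∀ k, 0 ≤ k → k < 3 → μ 1 k = 1 ∧ μ 2 k = 3) ∧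
    ∀ (k : Fin 3) (g : Fin m), μ 3 ((k : ℕ) * m + (g : ℕ)) = ((c g + k : Fin 3) : ℕ)

/-- With input of bit length `n` there are at most `n` items, numerators and products of
denominators are at most `2 ^ n`, and the scaled values sum to at most `8 ^ n`, so `2 ^ (3 * n + 6)` leaves room
for the factor `10` that the programs need. -/
theorem exists_run_mainProg {m : ℕ} (q : Fin 3 → Fin m → ℚ≥0) :
    ∃ c : Fin m → Fin 3, (∀ s, IsEF 1 1 (fun i g => (q i g : ℝ≥0)) (cyclicAllocation c s)) ∧
      ∃ t μ, Run mainProg (Mem.ofLists (inputLists q)) t μ ∧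
        t ≤ mainProg.time (inputSize q + 4) (3 * inputSize q + 8) ∧ HoldsShifts μ c := by
  set n := inputSize q with hn
  have e8 : (2 : ℤ) ^ (3 * n + 6) = 64 * 8 ^ n := by
    rw [pow_add, pow_mul]; norm_num; ring
  have h28 : (2 : ℤ) ^ n ≤ 8 ^ n := pow_le_pow_left₀ (by norm_num) (by norm_num) n
  have h8 : (1 : ℤ) ≤ 8 ^ n := one_le_pow₀ (by norm_num)
  have hm := items_le_inputSize q
  have hm2 : (m : ℤ) ≤ 2 ^ n := by exact_mod_cast hm.trans (Nat.lt_two_pow_self).le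
  have hbits : bits ((2 : ℤ) ^ (3 * n + 6)) = 3 * n + 8 := by
    unfold bits
    rw [Int.natAbs_pow]
    simp [Nat.size_pow]
  have hden : ∀ (i : Fin 3) (g : ℤ), 0 ≤ g → g < (m : ℤ) →
      0 < Mem.ofLists (inputLists q) (4 + i) g := by
    intro i g g0 g1
    rw [input_den, dif_pos ⟨g0, by omega⟩]
    exact_mod_cast NNRat.den_pos _
  have hsum : ∀ i, ∑ g ∈ Finset.Ico 0 (m : ℤ), scaledValue (Mem.ofLists (inputLists q)) m i g ≤
      8 ^ n := by
    intro i
    have h1 := Finset.sum_le_card_nsmul (Finset.Ico 0 (m : ℤ))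
      (scaledValue (Mem.ofLists (inputLists q)) m i) (4 ^ n) fun g hg => by
        rw [Finset.mem_Ico] at hg
        have := scaledValue_input_le q i ⟨g.toNat, by omega⟩
        simpa [Int.toNat_of_nonneg hg.1] using this
    refine h1.trans ?_
    have h2 : (m : ℤ) * 4 ^ n ≤ 2 ^ n * 4 ^ n := mul_le_mul_of_nonneg_right hm2 (by positivity)
    rw [← mul_pow] at h2
    simpa using h2
  obtain ⟨t, μ, hr, ht, K, c, h1, h2, h3⟩ := does_main (N := n + 4) (B := 2 ^ (3 * n + 6))
    (μ := Mem.ofLists (inputLists q)) (m := m)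
    (fun a g => (abs_input_le q a g).trans (by rw [e8, ← hn]; omega)) (input_zero q)
    (fun a ha g => input_work q ha g) hden
    (fun i g g0 g1 => by rw [input_num, dif_pos ⟨g0, by omega⟩]; exact Int.natCast_nonneg _)
    (fun i => by
      rw [prod_input_den]
      have : ((∏ g, (q i g).den : ℕ) : ℤ) ≤ 2 ^ n := by exact_mod_cast prod_den_le q i
      omega)
    (fun i => by have := hsum i; omega) (by omega)
  rw [hbits] at ht
  refine ⟨c, fun s => ?_, t, μ, hr, ht, h3⟩
  refine isEF_of_noEnvy (P := fun i => ((∏ g, (q i g).den : ℕ) : ℝ)) (fun i => ?_) (fun i g => ?_)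
    (fun i g hg => ?_) h2 h1 s
  · exact_mod_cast Finset.prod_pos fun g _ => NNRat.den_pos _
  · rw [scaledValue_input]
    have hd : (q i g).den ∣ ∏ g, (q i g).den := Finset.dvd_prod_of_mem _ (Finset.mem_univ g)
    obtain ⟨r, hr⟩ := hd
    have h0 : (0 : ℝ) < (q i g).den := by exact_mod_cast (q i g).den_pos
    rw [hr, Nat.mul_div_cancel_left _ (q i g).den_pos, NNRat.cast_def]
    push_cast
    field_simp
  · unfold scaledValue
    rw [if_neg (by omega)]

end FairDivision
/-! ### The mechanism -/

namespace FairDivision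

open RAM

theorem isClosed_isEF {n m a r : ℕ} (A : Allocation n m) :
    IsClosed {v : Profile n m | IsEF a r v A} := by
  have : {v : Profile n m | IsEF a r v A} = ⋂ (i : Fin n) (j : Fin n), ⋃ (S : Finset (Fin m))
      (T : Finset (Fin m)), {v | (Disjoint S (A.bundle i) ∧ T ⊆ A.bundle j ∧ S.card ≤ a ∧
        T.card ≤ r) ∧ (v i).value (A.bundle j \ T) ≤ (v i).value (A.bundle i ∪ S)} := by
    ext v
    simp [IsEF, and_assoc]
  rw [this]
  refine isClosed_iInter fun i => isClosed_iInter fun j => isClosed_iUnion_of_finite fun S =>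
    isClosed_iUnion_of_finite fun T => ?_
  refine IsClosed.inter isClosed_const (isClosed_le ?_ ?_) <;>
  · unfold Valuation.value
    fun_prop

theorem denseRange_ratProfile (m : ℕ) :
    DenseRange fun (q : Fin 3 → Fin m → ℚ≥0) (i : Fin 3) (g : Fin m) => (q i g : ℝ≥0) := by
  have h : DenseRange fun q : ℚ≥0 => (q : ℝ≥0) := by
    have h1 : DenseRange fun q : ℚ => Real.toNNReal (q : ℝ) :=
      (Function.Surjective.denseRange (f := Real.toNNReal) fun x => ⟨x, Real.toNNReal_coe⟩).comp
        (Rat.denseRange_cast (𝕜 := ℝ)) continuous_real_toNNReal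
    refine h1.mono ?_
    rintro _ ⟨q, rfl⟩
    refine ⟨q.toNNRat, ?_⟩
    rcases le_total 0 q with hq | hq
    · lift q to ℚ≥0 using hq
      ext
      rw [NNRat.toNNRat_coe, Real.coe_toNNReal', max_eq_left (by positivity)]
      rfl
    · simp [Rat.toNNRat_of_nonpos hq, Real.toNNReal_of_nonpos (Rat.cast_nonpos.2 hq)]
  exact DenseRange.piMap fun _ => DenseRange.piMap fun _ => h

/-- The rational profiles are dense, and the profiles for which a given colouring works form a
closed set. -/
theorem exists_colouring {m : ℕ} (v : Profile 3 m) :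
    ∃ c : Fin m → Fin 3, ∀ s, IsEF 1 1 v (cyclicAllocation c s) := by
  have hc : IsClosed {v : Profile 3 m | ∃ c : Fin m → Fin 3, ∀ s,
      IsEF 1 1 v (cyclicAllocation c s)} := by
    simp only [Set.ofPred_exists, Set.ofPred_forall]
    exact isClosed_iUnion_of_finite fun c => isClosed_iInter fun s => isClosed_isEF _
  have hd := (denseRange_ratProfile m).mono (s₂ := {v : Profile 3 m | ∃ c : Fin m → Fin 3, ∀ s,
      IsEF 1 1 v (cyclicAllocation c s)}) ?_
  · have := hd v
    rwa [hc.closure_eq] at this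
  · rintro _ ⟨q, rfl⟩
    obtain ⟨c, h, -⟩ := exists_run_mainProg q
    exact ⟨c, h⟩

/-- For rational profiles the colouring is the one that the program computes. -/
theorem exists_computed_colouring {m : ℕ} (v : Profile 3 m) :
    ∃ c : Fin m → Fin 3, (∀ s, IsEF 1 1 v (cyclicAllocation c s)) ∧
      ∀ q : Fin 3 → Fin m → ℚ≥0, (fun i g => (q i g : ℝ≥0)) = v →
        ∃ t μ, Run mainProg (Mem.ofLists (inputLists q)) t μ ∧
          t ≤ mainProg.time (inputSize q + 4) (3 * inputSize q + 8) ∧ HoldsShifts μ c := by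
  by_cases h : ∃ q : Fin 3 → Fin m → ℚ≥0, (fun i g => (q i g : ℝ≥0)) = v
  · obtain ⟨q, rfl⟩ := h
    obtain ⟨c, h1, h2⟩ := exists_run_mainProg q
    refine ⟨c, h1, fun q' hq' => ?_⟩
    obtain rfl : q' = q := by
      funext i g
      have := congrFun (congrFun hq' i) g
      exact_mod_cast this
    exact h2
  · obtain ⟨c, hc⟩ := exists_colouring v
    exact ⟨c, hc, fun q hq => absurd ⟨q, hq⟩ h⟩

/-- Every agent receives a third of every item. -/
noncomputable def uniformShares (m : ℕ) : FractionalAllocation 3 m where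
  share _ _ := 1 / 3
  share_nonneg _ _ := by norm_num
  sum_share _ := by norm_num

/-- The three cyclic shifts of a colouring, with probability `1 / 3` each. -/
noncomputable def shiftLottery {m : ℕ} (c : Fin m → Fin 3) : Lottery 3 m where
  K := 3
  prob _ := 1 / 3
  alloc := cyclicAllocation c
  prob_pos _ := by norm_num
  sum_prob := by norm_num

theorem shiftLottery_marginal {m : ℕ} (c : Fin m → Fin 3) (i : Fin 3) (g : Fin m) :
    (shiftLottery c).marginal i g = (uniformShares m).share i g := by
  have : (Finset.univ.filter fun k : Fin 3 => c g + k = i) = {i - c g} := by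
    ext k
    simp [eq_sub_iff_add_eq, add_comm]
  show ∑ k ∈ Finset.univ.filter (fun k : Fin 3 => c g + k = i), (1 / 3 : ℝ) = 1 / 3
  rw [this, Finset.sum_singleton]

/-- The items are assigned independently with the given probabilities. -/
theorem exists_lottery {n m : ℕ} (X : FractionalAllocation n m) :
    ∃ L : Lottery n m, ∀ i g, L.marginal i g = X.share i g := by
  classical
  set p : Allocation n m → ℝ := fun A => ∏ g, X.share (A g) g with hp
  have hp0 : ∀ A, 0 ≤ p A := fun A => Finset.prod_nonneg fun g _ => X.share_nonneg _ _
  have hsum : ∑ A, p A = 1 := by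
    rw [hp, ← Fintype.prod_sum (fun (g : Fin m) (i : Fin n) => X.share i g)]
    exact Finset.prod_eq_one fun g _ => X.sum_share g
  have hmarg : ∀ i g, ∑ A ∈ Finset.univ.filter (fun A : Allocation n m => A g = i), p A =
      X.share i g := by
    intro i g
    have h1 := Fintype.prod_sum fun (h : Fin m) (j : Fin n) =>
      if h = g ∧ j ≠ i then 0 else X.share j h
    have h2 : ∏ h, ∑ j, (if h = g ∧ j ≠ i then 0 else X.share j h) = X.share i g := by
      rw [Finset.prod_eq_single g]
      · simp
      · intro h _ hh; simpa [hh] using X.sum_share h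
      · simp
    rw [← h2, h1, Finset.sum_filter]
    refine Finset.sum_congr rfl fun A _ => ?_
    split_ifs with hA
    · refine Finset.prod_congr rfl fun h _ => ?_
      rw [if_neg]
      rintro ⟨rfl, hh⟩
      exact hh hA
    · exact (Finset.prod_eq_zero (Finset.mem_univ g) (by simp [hA])).symm
  -- only the allocations with positive probability may be listed
  let e := (Fintype.equivFin {A : Allocation n m // 0 < p A}).symm
  have key : ∀ (P : Allocation n m → Prop) [DecidablePred P],
      ∑ k ∈ Finset.univ.filter (fun k => P (e k).1), p (e k).1 =
        ∑ A ∈ Finset.univ.filter P, p A := by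
    intro P _
    rw [Finset.sum_filter, Finset.sum_filter,
      e.sum_comp fun A : {A : Allocation n m // 0 < p A} => if P A.1 then p A.1 else 0]
    rw [← Finset.sum_subtype (Finset.univ.filter fun A => 0 < p A) (by simp)
      (fun A => if P A then p A else 0), Finset.sum_filter_of_ne]
    intro A _ hA
    refine lt_of_le_of_ne (hp0 A) fun h => hA ?_
    simp [← h]
  refine ⟨⟨_, fun k => p (e k).1, fun k => (e k).1, fun k => (e k).2, ?_⟩, fun i g => ?_⟩
  · have := key fun _ => True
    simpa [hsum] using this
  · exact (key fun A => A g = i).trans (hmarg i g)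

end FairDivision

open FairDivision in
theorem mainTheorem1 :
    ∃ M : (m : ℕ) → FairDivision.RandomizedMechanism 3 m,
      (∀ m, (M m).Truthful) ∧ (∀ m, (M m).IsEF 1 1) ∧
        FairDivision.OutputsInPolynomialTime M := by
  classical
  choose c hc hrun using fun (m : ℕ) (v : Profile 3 m) => exists_computed_colouring v
  choose L hL using fun (m : ℕ) (X : FractionalAllocation 3 m) => exists_lottery X
  obtain ⟨M, hF, hM⟩ : ∃ M : (m : ℕ) → RandomizedMechanism 3 m,
      (∀ m v, (M m).F v = uniformShares m) ∧ ∀ m v, (M m).output v = shiftLottery (c m v) := by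
    refine ⟨fun m => ⟨fun _ => uniformShares m,
      fun v X => if X = uniformShares m then shiftLottery (c m v) else L m X, fun v X i g => ?_⟩,
      fun _ _ => rfl, fun _ _ => if_pos rfl⟩
    split_ifs with h
    · rw [h, shiftLottery_marginal]
    · exact hL m X i g
  refine ⟨M, fun m v i w => ?_, fun m v => ?_, ?_⟩
  · rw [hF, hF]
  · rw [hM]
    exact hc m v
  · obtain ⟨p, hp⟩ := RAM.polyBdd_time (N := fun n => n + 4) (W := fun n => 3 * n + 8)
      (RAM.PolyBdd.id.add (RAM.PolyBdd.const 4))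
      (((RAM.PolyBdd.const 3).mul RAM.PolyBdd.id).add (RAM.PolyBdd.const 8)) mainProg
    refine ⟨mainProg, p, fun m q => ?_⟩
    obtain ⟨t, μ, h1, h2, h3, h4, h5⟩ := hrun m (fun i g => (q i g : ℝ≥0)) q rfl
    refine ⟨t, μ, h1, h2.trans (hp _), ?_⟩
    rw [hM]
    refine ⟨h3, fun k => ?_, fun k g => h5 k g⟩
    obtain ⟨h6, h7⟩ := h4 ((k : ℕ) : ℤ) (by omega) (by have : (k : ℕ) < 3 := k.2; omega)
    rw [h6, h7]
    exact ⟨by norm_num, by simp [shiftLottery]⟩
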